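/- There are a deterministic word RAM algorithm and absolute constants $\alpha>0$ and $a,C,k\in\mathbb N$ with the following property. Let $G$ be a directed acyclic graph with $n$ vertices and $m$ edges (parallel edges allowed), given as a list of edges with capacities $\boldsymbol c(e)\in\{0,1,\dots,U\}$, and let $s\neq t$ be two of its vertices. On a word RAM with words of $W$ bits, where $2^W\ge (n+m+U+2)^a$ (that is, $W\ge a\log_2(n+m+U+2)$) and each operation on words takes one step, the algorithm computes an integral feasible $s$-$t$ flow $\boldsymbol f$ with $$|\boldsymbol f|\ \ge\ \alpha\cdot|\boldsymbol g|\qquad\text{for every (possibly fractional) feasible $s$-$t$ flow }\boldsymbol g,$$ i.e. a constant-factor approximate maximum flow, in at most $$C\,(m+n^2)\,(\lfloor\log_2 n\rfloor+1)^k=\widetilde O(m+n^2)$$ steps; the bound does not depend on $U$. In particular, if $G$ is simple, so that $m\le n^2$, the running time is $\widetilde O(n^2)$. -/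

import Mathlib

/-! ## Word RAM programs and their running time -/

namespace WordRAM

/-- The arithmetic and comparison operations on machine words. -/
inductive Op where
  | add | sub | mul | div | mod | lt | eq

/-- A machine state: finitely many of the registers are used by any given program; the memory is an
array of words that is addressed by words. -/
structure State where
  reg : ℕ → ℕ
  mem : ℕ → ℕ

/-- Expressions: literals, registers, indirect memory reads, and operations. -/
inductive Exp where
  | lit (k : ℕ)
  | reg (r : ℕ)
  | load (addr : Exp)
  | op (o : Op) (a b : Exp)

/-- Programs. A program is a fixed finite text: it depends neither on the input nor on the word
length. `store a e` writes the value of `e` to the memory cell whose address is the value of `a`;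
`branch` and `loop` treat a nonzero word as true. -/
inductive Prog where
  | skip
  | assign (r : ℕ) (e : Exp)
  | store (addr e : Exp)
  | seq (p q : Prog)
  | branch (b : Exp) (p q : Prog)
  | loop (b : Exp) (p : Prog)

/-- The value of an operation before reduction to a word. Subtraction is cut off at zero, division
rounds down, comparisons return `1` or `0`. -/
def Op.apply : Op → ℕ → ℕ → ℕ
  | .add, x, y => x + y
  | .sub, x, y => x - y
  | .mul, x, y => x * y
  | .div, x, y => x / y
  | .mod, x, y => x % y
  | .lt, x, y => if x < y then 1 else 0
  | .eq, x, y => if x = y then 1 else 0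

/-- The value of an expression on a machine with `W`-bit words: every intermediate result is reduced
modulo `2 ^ W`. -/
def Exp.eval (W : ℕ) (σ : State) : Exp → ℕ
  | .lit k => k % 2 ^ W
  | .reg r => σ.reg r % 2 ^ W
  | .load a => σ.mem (a.eval W σ) % 2 ^ W
  | .op o a b => o.apply (a.eval W σ) (b.eval W σ) % 2 ^ W

/-- The number of elementary steps needed to evaluate an expression: one for each literal, register
access, memory access and operation. -/
def Exp.cost : Exp → ℕ
  | .lit _ => 1
  | .reg _ => 1
  | .load a => a.cost + 1
  | .op _ a b => a.cost + b.cost + 1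

/-- `Runs W p σ σ' T`: on a machine with `W`-bit words, the program `p` started in the state `σ` halts
in the state `σ'` after exactly `T` elementary steps. -/
inductive Runs (W : ℕ) : Prog → State → State → ℕ → Prop
  | skip (σ : State) : Runs W .skip σ σ 1
  | assign (r : ℕ) (e : Exp) (σ : State) :
      Runs W (.assign r e) σ ⟨Function.update σ.reg r (e.eval W σ), σ.mem⟩ (e.cost + 1)
  | store (a e : Exp) (σ : State) :
      Runs W (.store a e) σ ⟨σ.reg, Function.update σ.mem (a.eval W σ) (e.eval W σ)⟩
        (a.cost + e.cost + 1)
  | seq {p q : Prog} {σ₁ σ₂ σ₃ : State} {T₁ T₂ : ℕ} :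
      Runs W p σ₁ σ₂ T₁ → Runs W q σ₂ σ₃ T₂ → Runs W (.seq p q) σ₁ σ₃ (T₁ + T₂)
  | branch_true {b : Exp} {p q : Prog} {σ σ' : State} {T : ℕ} :
      b.eval W σ ≠ 0 → Runs W p σ σ' T → Runs W (.branch b p q) σ σ' (b.cost + 1 + T)
  | branch_false {b : Exp} {p q : Prog} {σ σ' : State} {T : ℕ} :
      b.eval W σ = 0 → Runs W q σ σ' T → Runs W (.branch b p q) σ σ' (b.cost + 1 + T)
  | loop_true {b : Exp} {p : Prog} {σ₁ σ₂ σ₃ : State} {T₁ T₂ : ℕ} :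
      b.eval W σ₁ ≠ 0 → Runs W p σ₁ σ₂ T₁ → Runs W (.loop b p) σ₂ σ₃ T₂ →
      Runs W (.loop b p) σ₁ σ₃ (b.cost + 1 + T₁ + T₂)
  | loop_false {b : Exp} {p : Prog} {σ : State} :
      b.eval W σ = 0 → Runs W (.loop b p) σ σ (b.cost + 1)

end WordRAM

/-! ## Flow networks -/

/-- A directed multigraph on the vertices `0, …, n - 1` with edges `0, …, m - 1` (edge `e` goes from
`src e` to `tgt e`), nonnegative integral edge capacities, a source `s` and a sink `t`. -/
structure FlowNetwork (n m : ℕ) where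
  src : Fin m → Fin n
  tgt : Fin m → Fin n
  cap : Fin m → ℕ
  s : Fin n
  t : Fin n

namespace FlowNetwork

variable {n m : ℕ}

/-- There is an edge from `u` to `v`. -/
def Edge (N : FlowNetwork n m) (u v : Fin n) : Prop := ∃ e, N.src e = u ∧ N.tgt e = v

/-- The graph is a DAG: no vertex can be reached from itself by a nonempty directed walk. -/
def Acyclic (N : FlowNetwork n m) : Prop := ∀ v, ¬ Relation.TransGen N.Edge v v

/-- The net amount of `f` that leaves the vertex `v`. -/
def netOut (N : FlowNetwork n m) (f : Fin m → ℝ) (v : Fin n) : ℝ :=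
  (∑ e with N.src e = v, f e) - ∑ e with N.tgt e = v, f e

/-- `f` is a feasible (possibly fractional) `s`-`t` flow. -/
structure IsFlow (N : FlowNetwork n m) (f : Fin m → ℝ) : Prop where
  nonneg : ∀ e, 0 ≤ f e
  le_cap : ∀ e, f e ≤ N.cap e
  conserve : ∀ v, v ≠ N.s → v ≠ N.t → N.netOut f v = 0

/-- The value of an `s`-`t` flow. -/
def value (N : FlowNetwork n m) (f : Fin m → ℝ) : ℝ := N.netOut f N.s

/-- `f` is a feasible flow whose value is at least `α` times the value of every feasible flow. -/
def IsApproxMaxFlow (N : FlowNetwork n m) (α : ℝ) (f : Fin m → ℝ) : Prop :=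
  N.IsFlow f ∧ ∀ g, N.IsFlow g → α * N.value g ≤ N.value f

/-- The input: memory cells `0, 1, 2, 3` hold `n, m, s, t`, then follow the triples
`src e, tgt e, cap e` of the edges in order, and all other cells are zero. -/
def inputMem (N : FlowNetwork n m) (a : ℕ) : ℕ :=
  if a = 0 then n
  else if a = 1 then m
  else if a = 2 then N.s
  else if a = 3 then N.t
  else if h : (a - 4) / 3 < m then
    if (a - 4) % 3 = 0 then N.src ⟨(a - 4) / 3, h⟩
    else if (a - 4) % 3 = 1 then N.tgt ⟨(a - 4) / 3, h⟩
    else N.cap ⟨(a - 4) / 3, h⟩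
  else 0

/-- The initial machine state: all registers are zero and the memory holds the input. -/
def input (N : FlowNetwork n m) : WordRAM.State := ⟨fun _ => 0, N.inputMem⟩

end FlowNetwork

/-- The output: the `m` numbers in the memory cells directly behind the input, one for each edge. -/
def flowOutput (m : ℕ) (σ : WordRAM.State) (e : Fin m) : ℕ := σ.mem (4 + 3 * m + e)

/-!
The algorithm is a push-relabel method whose labels measure weighted distances. The vertices are
put in topological order and parallel edges are merged, so that the capacities form an upper
triangular matrix `C`. The pair of the positions `i`, `j` gets as its `weight` the distance
`|i - j|` rounded up to a power of two. Labels only promise that a residual edge falls by at most its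
weight (`IsLabelled.lev_le_add`), which allows an edge of weight `w` to be looked at only when the
label of its tail is a multiple of `w`. At the label `l`, a vertex therefore scans a window of
radius about the largest power of two that divides `l`. Summed over all labels up to `16 * n`, the
windows of a vertex have total length `O(n log n)` (`sum_gcd_le`).

Stopping at the label `16 * n` is harmless. Along the edges of the DAG the positions increase, so
weights telescope up to a factor of two: summing label differences along a flow of value `F` and
along the preflow that the algorithm maintains gives `∑ ex v * lev v ≤ 4 * n * F`
(`sum_ex_mul_lev_le`). At most `F / 4` units can hence be stuck at vertices with label `16 * n`,
and as soon as all other vertices except for the sink have an excess of at most `F / (4 * n)`, half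
of the `F` units are at the sink if there is a flow of value `F` at all (`le_two_mul_ex`).

The excesses are made small by scaling. In the phase with scale `D`, an active vertex of least
label is scanned until no vertex is active, that is, until the excess of every vertex other than
the sink whose label is below `16 * n` is at most `D / 2`. Since the vertex that receives a push
has a smaller label, it is not active, and the push saturates the edge or moves at least `D / 2`
units; each scan lowers a potential by `D` (`IsPush.potential`, `IsSkip.potential`,
`IsRelabel.potential`), and the potential is at most `D` times `O(n ^ 2 log n)` at the beginning of
a phase (`potential_le`). A tournament tree finds the active vertex of least label in logarithmic
time. The number of phases is logarithmic in `n`, not in the capacities, because the value `F` is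
guessed: with the largest bottleneck capacity `b` of an `s`-`t` path, the maximum is between `b`
and `n ^ 2 * b`, and the guesses are halved downwards from there (`search_spec`). The last guess
leaves at the sink at least a quarter of the maximum. Finally, the excess of the other vertices is
sent back in reverse topological order (`cancelExcess_spec`), and the flow is distributed over
parallel edges (`distribute_spec`).

The algorithm is written in a small language with registers and sixteen arrays (`AProg`), whose
programs are translated to the word RAM (`AProg.comp`). Its semantics `AProg.Exec` uses exact
arithmetic and counts loop iterations only. `AProg.Exec.simulate` shows that the translation is
faithful if the words are long enough, and that each loop iteration costs a constant number of
steps.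
-/

/-! ### Expressions evaluated without overflow -/

namespace WordRAM

/-- The value of an expression in exact arithmetic, without reduction modulo the word size. -/
def Exp.uval (σ : State) : Exp → ℕ
  | .lit k => k
  | .reg r => σ.reg r
  | .load a => σ.mem (a.uval σ)
  | .op o a b => o.apply (a.uval σ) (b.uval σ)

/-- An exponent that controls the size of the intermediate results: if all stored values are smaller
than `P`, then the value of `e` is smaller than `P ^ e.wt`. -/
def Exp.wt : Exp → ℕ
  | .lit k => k + 1
  | .reg _ => 1
  | .load a => a.wt
  | .op _ a b => a.wt + b.wt

/-- The total weight of the expressions in a program. -/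
def Prog.wt : Prog → ℕ
  | .skip => 0
  | .assign _ e => e.wt
  | .store a e => a.wt + e.wt
  | .seq p q => p.wt + q.wt
  | .branch b p q => b.wt + p.wt + q.wt
  | .loop b p => b.wt + p.wt

/-- A bound for the number of steps that a program spends per iteration of its loops. -/
def Prog.unitCost : Prog → ℕ
  | .skip => 1
  | .assign _ e => e.cost + 1
  | .store a e => a.cost + e.cost + 1
  | .seq p q => p.unitCost + q.unitCost
  | .branch b p q => b.cost + 1 + p.unitCost + q.unitCost
  | .loop b p => b.cost + 1 + p.unitCost

theorem Exp.one_le_wt (e : Exp) : 1 ≤ e.wt := by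
  induction e with
  | lit k => simp [Exp.wt]
  | reg r => simp [Exp.wt]
  | load a ih => simpa [Exp.wt] using ih
  | op o a b iha ihb => simp only [Exp.wt]; omega

theorem Op.apply_lt_pow {P a b x y : ℕ} (o : Op) (hP : 2 ≤ P) (ha : 1 ≤ a) (hb : 1 ≤ b)
    (hx : x < P ^ a) (hy : y < P ^ b) : o.apply x y < P ^ (a + b) := by
  have h2a : 2 ≤ P ^ a := le_trans hP (Nat.le_self_pow (by omega) P)
  have h2b : 2 ≤ P ^ b := le_trans hP (Nat.le_self_pow (by omega) P)
  have hab : P ^ a + P ^ b ≤ P ^ (a + b) := by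
    rw [pow_add]; nlinarith
  cases o with
  | add => simp only [Op.apply]; omega
  | sub => simp only [Op.apply]; omega
  | mul => simp only [Op.apply]; rw [pow_add]; exact Nat.mul_lt_mul'' hx hy
  | div => simp only [Op.apply]; have := Nat.div_le_self x y; omega
  | mod => simp only [Op.apply]; have := Nat.mod_le x y; omega
  | lt => simp only [Op.apply]; split_ifs <;> omega
  | eq => simp only [Op.apply]; split_ifs <;> omega

theorem Exp.eval_eq_uval {W P : ℕ} {σ : State} (hP : 2 ≤ P) (hr : ∀ r, σ.reg r < P)
    (hm : ∀ a, σ.mem a < P) (e : Exp) (h : P ^ e.wt ≤ 2 ^ W) :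
    e.eval W σ = e.uval σ ∧ e.uval σ < P ^ e.wt := by
  induction e with
  | lit k =>
    have hk : k < P ^ (k + 1) := lt_of_lt_of_le (Nat.lt_pow_self (by omega : 1 < P))
      (Nat.pow_le_pow_right (by omega) (by omega))
    exact ⟨Nat.mod_eq_of_lt (lt_of_lt_of_le hk h), hk⟩
  | reg r =>
    have := hr r
    simp only [Exp.wt, pow_one] at h
    exact ⟨Nat.mod_eq_of_lt (by omega), by simpa [Exp.wt, Exp.uval] using this⟩
  | load a ih =>
    obtain ⟨h1, h2⟩ := ih h
    have hlt : σ.mem (a.uval σ) < P ^ a.wt :=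
      lt_of_lt_of_le (hm _) (Nat.le_self_pow (by have := a.one_le_wt; omega) P)
    refine ⟨?_, hlt⟩
    simp only [Exp.eval, Exp.uval, h1]
    exact Nat.mod_eq_of_lt (lt_of_lt_of_le hlt h)
  | op o a b iha ihb =>
    have ha : P ^ a.wt ≤ 2 ^ W := le_trans (Nat.pow_le_pow_right (by omega)
      (by simp [Exp.wt])) h
    have hb : P ^ b.wt ≤ 2 ^ W := le_trans (Nat.pow_le_pow_right (by omega)
      (by simp [Exp.wt])) h
    obtain ⟨a1, a2⟩ := iha ha
    obtain ⟨b1, b2⟩ := ihb hb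
    have hlt := Op.apply_lt_pow o hP a.one_le_wt b.one_le_wt a2 b2
    refine ⟨?_, hlt⟩
    simp only [Exp.eval, Exp.uval, a1, b1]
    exact Nat.mod_eq_of_lt (lt_of_lt_of_le hlt h)

end WordRAM

/-! ### An array language over the word RAM -/

/-- A state of the array language: registers, sixteen unbounded arrays, and the block of raw memory
that holds the input and the output. -/
structure ASt where
  reg : ℕ → ℕ
  arr : Fin 16 → ℕ → ℕ
  raw : ℕ → ℕ

namespace ASt

/-- Set register `r` to `v`. -/
def setReg (s : ASt) (r v : ℕ) : ASt := ⟨Function.update s.reg r v, s.arr, s.raw⟩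

/-- Set entry `i` of array `k` to `v`. -/
def setArr (s : ASt) (k : Fin 16) (i v : ℕ) : ASt :=
  ⟨s.reg, Function.update s.arr k (Function.update (s.arr k) i v), s.raw⟩

/-- Set cell `i` of the raw memory to `v`. -/
def setRaw (s : ASt) (i v : ℕ) : ASt := ⟨s.reg, s.arr, Function.update s.raw i v⟩

@[simp] theorem reg_setReg (s : ASt) (r v r' : ℕ) :
    (s.setReg r v).reg r' = if r' = r then v else s.reg r' := by
  simp [setReg, Function.update_apply]

@[simp] theorem arr_setReg (s : ASt) (r v : ℕ) : (s.setReg r v).arr = s.arr := rfl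

@[simp] theorem raw_setReg (s : ASt) (r v : ℕ) : (s.setReg r v).raw = s.raw := rfl

@[simp] theorem reg_setArr (s : ASt) (k : Fin 16) (i v : ℕ) : (s.setArr k i v).reg = s.reg := rfl

@[simp] theorem arr_setArr (s : ASt) (k k' : Fin 16) (i v : ℕ) :
    (s.setArr k i v).arr k' = if k' = k then Function.update (s.arr k) i v else s.arr k' := by
  simp only [setArr, Function.update_apply]

@[simp] theorem raw_setArr (s : ASt) (k : Fin 16) (i v : ℕ) : (s.setArr k i v).raw = s.raw := rfl

@[simp] theorem reg_setRaw (s : ASt) (i v : ℕ) : (s.setRaw i v).reg = s.reg := rfl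

@[simp] theorem arr_setRaw (s : ASt) (i v : ℕ) : (s.setRaw i v).arr = s.arr := rfl

@[simp] theorem raw_setRaw (s : ASt) (i v : ℕ) :
    (s.setRaw i v).raw = Function.update s.raw i v := rfl

end ASt

/-- Expressions of the array language. -/
inductive AExp where
  | lit (k : ℕ)
  | reg (r : ℕ)
  | arr (k : Fin 16) (i : AExp)
  | op (o : WordRAM.Op) (a b : AExp)

namespace AExp

instance : Add AExp := ⟨op .add⟩
instance : Sub AExp := ⟨op .sub⟩
instance : Mul AExp := ⟨op .mul⟩
instance : Div AExp := ⟨op .div⟩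
instance : Mod AExp := ⟨op .mod⟩
instance (k : ℕ) : OfNat AExp k := ⟨lit k⟩

/-- The comparison `a < b`. -/
def lt (a b : AExp) : AExp := op .lt a b

/-- The comparison `a = b`. -/
def eq (a b : AExp) : AExp := op .eq a b

/-- The value of an expression, in exact arithmetic. -/
def val (s : ASt) : AExp → ℕ
  | .lit k => k
  | .reg r => s.reg r
  | .arr k i => s.arr k (i.val s)
  | .op o a b => o.apply (a.val s) (b.val s)

@[simp] theorem val_ofNat (s : ASt) (k : ℕ) : (no_index (OfNat.ofNat k) : AExp).val s = k := rfl
@[simp] theorem val_reg (s : ASt) (r : ℕ) : (reg r).val s = s.reg r := rfl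
@[simp] theorem val_arr (s : ASt) (k : Fin 16) (i : AExp) :
    (arr k i).val s = s.arr k (i.val s) := rfl
@[simp] theorem val_add (s : ASt) (a b : AExp) : (a + b).val s = a.val s + b.val s := rfl
@[simp] theorem val_sub (s : ASt) (a b : AExp) : (a - b).val s = a.val s - b.val s := rfl
@[simp] theorem val_mul (s : ASt) (a b : AExp) : (a * b).val s = a.val s * b.val s := rfl
@[simp] theorem val_div (s : ASt) (a b : AExp) : (a / b).val s = a.val s / b.val s := rfl
@[simp] theorem val_mod (s : ASt) (a b : AExp) : (a % b).val s = a.val s % b.val s := rfl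
@[simp] theorem val_lt (s : ASt) (a b : AExp) :
    (lt a b).val s = if a.val s < b.val s then 1 else 0 := rfl
@[simp] theorem val_eq (s : ASt) (a b : AExp) :
    (eq a b).val s = if a.val s = b.val s then 1 else 0 := rfl

/-- A sufficient condition for the value of an expression to be at most `B` in a state all of whose
entries are at most `B`. Only sums, products and literals are in need of a proof. -/
def Fits (B : ℕ) (s : ASt) : AExp → Prop
  | .lit k => k ≤ B
  | .reg _ => True
  | .arr _ _ => True
  | .op .add a b => a.val s + b.val s ≤ B
  | .op .mul a b => a.val s * b.val s ≤ B
  | .op .sub a _ => a.Fits B s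
  | .op .div a _ => a.Fits B s
  | .op .mod a _ => a.Fits B s
  | .op .lt _ _ => 1 ≤ B
  | .op .eq _ _ => 1 ≤ B

@[simp] theorem fits_ofNat (B : ℕ) (s : ASt) (k : ℕ) :
    (no_index (OfNat.ofNat k) : AExp).Fits B s ↔ k ≤ B := Iff.rfl
@[simp] theorem fits_reg (B : ℕ) (s : ASt) (r : ℕ) : (reg r).Fits B s ↔ True := Iff.rfl
@[simp] theorem fits_arr (B : ℕ) (s : ASt) (k : Fin 16) (i : AExp) :
    (arr k i).Fits B s ↔ True := Iff.rfl
@[simp] theorem fits_add (B : ℕ) (s : ASt) (a b : AExp) :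
    (a + b).Fits B s ↔ a.val s + b.val s ≤ B := Iff.rfl
@[simp] theorem fits_mul (B : ℕ) (s : ASt) (a b : AExp) :
    (a * b).Fits B s ↔ a.val s * b.val s ≤ B := Iff.rfl
@[simp] theorem fits_sub (B : ℕ) (s : ASt) (a b : AExp) :
    (a - b).Fits B s ↔ a.Fits B s := Iff.rfl
@[simp] theorem fits_div (B : ℕ) (s : ASt) (a b : AExp) :
    (a / b).Fits B s ↔ a.Fits B s := Iff.rfl
@[simp] theorem fits_mod (B : ℕ) (s : ASt) (a b : AExp) :
    (a % b).Fits B s ↔ a.Fits B s := Iff.rfl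
@[simp] theorem fits_lt (B : ℕ) (s : ASt) (a b : AExp) :
    (lt a b).Fits B s ↔ 1 ≤ B := Iff.rfl
@[simp] theorem fits_eq (B : ℕ) (s : ASt) (a b : AExp) :
    (eq a b).Fits B s ↔ 1 ≤ B := Iff.rfl

theorem val_le_of_fits {B : ℕ} {s : ASt} (hr : ∀ r, s.reg r ≤ B) (ha : ∀ k i, s.arr k i ≤ B)
    (e : AExp) (h : e.Fits B s) : e.val s ≤ B := by
  induction e with
  | lit k => exact h
  | reg r => exact hr r
  | arr k i _ => exact ha k _
  | op o a b iha _ =>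
    cases o with
    | add => exact h
    | mul => exact h
    | sub => exact le_trans (Nat.sub_le _ _) (iha h)
    | div => exact le_trans (Nat.div_le_self _ _) (iha h)
    | mod => exact le_trans (Nat.mod_le _ _) (iha h)
    | lt => simp only [val, WordRAM.Op.apply]; simp only [Fits] at h; split_ifs <;> omega
    | eq => simp only [val, WordRAM.Op.apply]; simp only [Fits] at h; split_ifs <;> omega

/-- The address of cell `i` of array `k`; the word RAM register `0` holds the base address. -/
def addr (k : Fin 16) (i : WordRAM.Exp) : WordRAM.Exp :=
  .op .add (.reg 0) (.op .add (.op .mul (.lit 16) i) (.lit k))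

/-- Translation of expressions to the word RAM; register numbers are shifted by one. -/
def comp : AExp → WordRAM.Exp
  | .lit k => .lit k
  | .reg r => .reg (r + 1)
  | .arr k i => .load (addr k i.comp)
  | .op o a b => .op o a.comp b.comp

end AExp

/-- Programs of the array language: `set` writes a register and `put` an array entry; `get` and
`out` read and write the raw memory. Expressions have no access to the raw memory. -/
inductive AProg where
  | skip
  | set (r : ℕ) (e : AExp)
  | put (k : Fin 16) (i e : AExp)
  | get (r : ℕ) (i : AExp)
  | out (i e : AExp)
  | seq (p q : AProg)
  | ite (b : AExp) (p q : AProg)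
  | loop (b : AExp) (p : AProg)

/-- Sequential composition. -/
infixr:60 " ;; " => AProg.seq

namespace AProg

/-- Translation of programs to the word RAM. -/
def comp : AProg → WordRAM.Prog
  | .skip => .skip
  | .set r e => .assign (r + 1) e.comp
  | .put k i e => .store (AExp.addr k i.comp) e.comp
  | .get r i => .assign (r + 1) (.load i.comp)
  | .out i e => .store i.comp e.comp
  | .seq p q => .seq p.comp q.comp
  | .ite b p q => .branch b.comp p.comp q.comp
  | .loop b p => .loop b.comp p.comp

/-- Does the program write to register `r`? -/
def writesReg (r : ℕ) : AProg → Bool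
  | .skip => false
  | .set r' _ => r == r'
  | .put _ _ _ => false
  | .get r' _ => r == r'
  | .out _ _ => false
  | .seq p q => p.writesReg r || q.writesReg r
  | .ite _ p q => p.writesReg r || q.writesReg r
  | .loop _ p => p.writesReg r

/-- Does the program write to array `k`? -/
def writesArr (k : Fin 16) : AProg → Bool
  | .skip => false
  | .set _ _ => false
  | .put k' _ _ => k == k'
  | .get _ _ => false
  | .out _ _ => false
  | .seq p q => p.writesArr k || q.writesArr k
  | .ite _ p q => p.writesArr k || q.writesArr k
  | .loop _ p => p.writesArr k

/-- Does the program write to the raw memory block? -/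
def writesRaw : AProg → Bool
  | .skip => false
  | .set _ _ => false
  | .put _ _ _ => false
  | .get _ _ => false
  | .out _ _ => true
  | .seq p q => p.writesRaw || q.writesRaw
  | .ite _ p q => p.writesRaw || q.writesRaw
  | .loop _ p => p.writesRaw

/-- `Exec X B p s s' J`: the program `p` leads from `s` to `s'` with `J` loop iterations in all,
stores only values that are at most `B`, and accesses the raw memory only below the address `X`. -/
inductive Exec (X B : ℕ) : AProg → ASt → ASt → ℕ → Prop
  | skip (s : ASt) : Exec X B .skip s s 0
  | set (r : ℕ) (e : AExp) (s : ASt) : e.Fits B s → Exec X B (.set r e) s (s.setReg r (e.val s)) 0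
  | put (k : Fin 16) (i e : AExp) (s : ASt) : e.Fits B s →
      Exec X B (.put k i e) s (s.setArr k (i.val s) (e.val s)) 0
  | get (r : ℕ) (i : AExp) (s : ASt) : i.val s < X →
      Exec X B (.get r i) s (s.setReg r (s.raw (i.val s))) 0
  | out (i e : AExp) (s : ASt) : i.val s < X → e.Fits B s →
      Exec X B (.out i e) s (s.setRaw (i.val s) (e.val s)) 0
  | seq {p q : AProg} {s₁ s₂ s₃ : ASt} {J₁ J₂ : ℕ} :
      Exec X B p s₁ s₂ J₁ → Exec X B q s₂ s₃ J₂ → Exec X B (.seq p q) s₁ s₃ (J₁ + J₂)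
  | ite_true {b : AExp} {p q : AProg} {s s' : ASt} {J : ℕ} :
      b.val s ≠ 0 → Exec X B p s s' J → Exec X B (.ite b p q) s s' J
  | ite_false {b : AExp} {p q : AProg} {s s' : ASt} {J : ℕ} :
      b.val s = 0 → Exec X B q s s' J → Exec X B (.ite b p q) s s' J
  | loop_true {b : AExp} {p : AProg} {s₁ s₂ s₃ : ASt} {J₁ J₂ : ℕ} :
      b.val s₁ ≠ 0 → Exec X B p s₁ s₂ J₁ → Exec X B (.loop b p) s₂ s₃ J₂ →
      Exec X B (.loop b p) s₁ s₃ (J₁ + J₂ + 1)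
  | loop_false {b : AExp} {p : AProg} {s : ASt} :
      b.val s = 0 → Exec X B (.loop b p) s s 0

/-- What `p` does not write is the same in `s` and `s'`. -/
structure Frame (p : AProg) (s s' : ASt) : Prop where
  reg : ∀ r, p.writesReg r = false → s'.reg r = s.reg r
  arr : ∀ k, p.writesArr k = false → s'.arr k = s.arr k
  raw : p.writesRaw = false → s'.raw = s.raw

theorem Frame.refl (p : AProg) (s : ASt) : Frame p s s :=
  ⟨fun _ _ => rfl, fun _ _ => rfl, fun _ => rfl⟩

theorem Frame.trans {p : AProg} {s₁ s₂ s₃ : ASt} (h : Frame p s₁ s₂) (h' : Frame p s₂ s₃) :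
    Frame p s₁ s₃ :=
  ⟨fun r hr => (h'.reg r hr).trans (h.reg r hr), fun k hk => (h'.arr k hk).trans (h.arr k hk),
    fun hw => (h'.raw hw).trans (h.raw hw)⟩

theorem Frame.mono {p q : AProg} {s s' : ASt} (h : Frame p s s')
    (hr : ∀ r, q.writesReg r = false → p.writesReg r = false)
    (ha : ∀ k, q.writesArr k = false → p.writesArr k = false)
    (hw : q.writesRaw = false → p.writesRaw = false) : Frame q s s' :=
  ⟨fun r h' => h.reg r (hr r h'), fun k h' => h.arr k (ha k h'), fun h' => h.raw (hw h')⟩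

theorem Exec.frame {X B : ℕ} {p : AProg} {s s' : ASt} {J : ℕ} (h : Exec X B p s s' J) :
    Frame p s s' := by
  induction h with
  | skip s => exact Frame.refl _ _
  | set r e s _ =>
    refine ⟨fun r' hr => ?_, fun _ _ => rfl, fun _ => rfl⟩
    have : r' ≠ r := by simpa [writesReg] using hr
    simp [this]
  | put k i e s _ =>
    refine ⟨fun _ _ => rfl, fun k' hk => ?_, fun _ => rfl⟩
    have : k' ≠ k := by simpa [writesArr] using hk
    simp [this]
  | get r i s _ =>
    refine ⟨fun r' hr => ?_, fun _ _ => rfl, fun _ => rfl⟩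
    have : r' ≠ r := by simpa [writesReg] using hr
    simp [this]
  | out i e s _ _ => exact ⟨fun _ _ => rfl, fun _ _ => rfl, fun h => by simp [writesRaw] at h⟩
  | seq _ _ ih₁ ih₂ =>
    exact (ih₁.mono (by simp +contextual [writesReg]) (by simp +contextual [writesArr])
      (by simp +contextual [writesRaw])).trans
      (ih₂.mono (by simp +contextual [writesReg]) (by simp +contextual [writesArr])
      (by simp +contextual [writesRaw]))
  | ite_true _ _ ih =>
    exact ih.mono (by simp +contextual [writesReg]) (by simp +contextual [writesArr])
      (by simp +contextual [writesRaw])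
  | ite_false _ _ ih =>
    exact ih.mono (by simp +contextual [writesReg]) (by simp +contextual [writesArr])
      (by simp +contextual [writesRaw])
  | loop_true _ _ _ ih₁ ih₂ =>
    exact Frame.trans (p := .loop _ _) ⟨ih₁.reg, ih₁.arr, ih₁.raw⟩ ih₂
  | loop_false _ => exact Frame.refl _ _

/-- The word RAM state `σ` represents the state `s`: register `0` holds the base address `X` of the
arrays, which are interleaved from there on, the raw block lies below `X`, and all words are at
most `B`. -/
structure Rep (X B : ℕ) (σ : WordRAM.State) (s : ASt) : Prop where
  base : σ.reg 0 = X
  reg : ∀ r, σ.reg (r + 1) = s.reg r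
  arr : ∀ (k : Fin 16) i, σ.mem (X + (16 * i + k)) = s.arr k i
  raw : ∀ i < X, σ.mem i = s.raw i
  reg_le : ∀ r, σ.reg r ≤ B
  mem_le : ∀ a, σ.mem a ≤ B

theorem Rep.uval_comp {X B : ℕ} {σ : WordRAM.State} {s : ASt} (h : Rep X B σ s) (e : AExp) :
    e.comp.uval σ = e.val s := by
  induction e with
  | lit k => rfl
  | reg r => exact h.reg r
  | arr k i ih =>
    simp only [AExp.comp, AExp.addr, WordRAM.Exp.uval, WordRAM.Op.apply, AExp.val, ih, h.base]
    exact h.arr k _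
  | op o a b iha ihb => simp only [AExp.comp, WordRAM.Exp.uval, AExp.val, iha, ihb]

theorem Rep.eval_eq_uval {X B W : ℕ} {σ : WordRAM.State} {s : ASt} (h : Rep X B σ s)
    (e : WordRAM.Exp) (hW : (B + 2) ^ e.wt ≤ 2 ^ W) : e.eval W σ = e.uval σ :=
  (WordRAM.Exp.eval_eq_uval (by omega) (fun r => by have := h.reg_le r; omega)
    (fun a => by have := h.mem_le a; omega) e hW).1

theorem Rep.eval_comp {X B W : ℕ} {σ : WordRAM.State} {s : ASt} (h : Rep X B σ s) (e : AExp)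
    (hW : (B + 2) ^ e.comp.wt ≤ 2 ^ W) : e.comp.eval W σ = e.val s :=
  (h.eval_eq_uval _ hW).trans (h.uval_comp e)

theorem Rep.eval_addr {X B W : ℕ} {σ : WordRAM.State} {s : ASt} (h : Rep X B σ s) (k : Fin 16)
    (i : AExp) (hW : (B + 2) ^ (AExp.addr k i.comp).wt ≤ 2 ^ W) :
    (AExp.addr k i.comp).eval W σ = X + (16 * i.val s + k) := by
  rw [h.eval_eq_uval _ hW]
  simp only [AExp.addr, WordRAM.Exp.uval, WordRAM.Op.apply, h.uval_comp, h.base]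

theorem Rep.setReg {X B : ℕ} {σ : WordRAM.State} {s : ASt} (h : Rep X B σ s) (r v : ℕ)
    (hv : v ≤ B) : Rep X B ⟨Function.update σ.reg (r + 1) v, σ.mem⟩ (s.setReg r v) where
  base := by simpa [Function.update_apply] using h.base
  reg r' := by
    by_cases hr : r' = r <;> simp [hr, h.reg]
  arr := h.arr
  raw := h.raw
  reg_le r' := by
    simp only [Function.update_apply]; split_ifs; exacts [hv, h.reg_le r']
  mem_le := h.mem_le

theorem Rep.setArr {X B : ℕ} {σ : WordRAM.State} {s : ASt} (h : Rep X B σ s) (k : Fin 16)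
    (i v : ℕ) (hv : v ≤ B) :
    Rep X B ⟨σ.reg, Function.update σ.mem (X + (16 * i + k)) v⟩ (s.setArr k i v) where
  base := h.base
  reg := h.reg
  arr k' i' := by
    by_cases hk : k' = k
    · subst hk
      by_cases hi : i' = i
      · simp [hi]
      · have : X + (16 * i' + (k' : ℕ)) ≠ X + (16 * i + (k' : ℕ)) := by omega
        simp only [Function.update_apply, this, if_false, ASt.arr_setArr, if_true, hi, h.arr]
    · have : X + (16 * i' + (k' : ℕ)) ≠ X + (16 * i + (k : ℕ)) := by
        have h1 := k.2; have h2 := k'.2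
        intro he; exact hk (Fin.ext (by omega))
      simp only [Function.update_apply, this, if_false, ASt.arr_setArr, hk, h.arr]
  raw i' hi' := by
    have : i' ≠ X + (16 * i + (k : ℕ)) := by omega
    simp only [Function.update_apply, this, if_false]; exact h.raw i' hi'
  reg_le := h.reg_le
  mem_le a := by
    simp only [Function.update_apply]; split_ifs; exacts [hv, h.mem_le a]

theorem Rep.setRaw {X B : ℕ} {σ : WordRAM.State} {s : ASt} (h : Rep X B σ s) (i v : ℕ)
    (hi : i < X) (hv : v ≤ B) :
    Rep X B ⟨σ.reg, Function.update σ.mem i v⟩ (s.setRaw i v) where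
  base := h.base
  reg := h.reg
  arr k' i' := by
    have : X + (16 * i' + (k' : ℕ)) ≠ i := by omega
    simp only [Function.update_apply, this, if_false]; exact h.arr k' i'
  raw i' hi' := by
    simp only [Function.update_apply, ASt.raw_setRaw, h.raw i' hi']
  reg_le := h.reg_le
  mem_le a := by
    simp only [Function.update_apply]; split_ifs; exacts [hv, h.mem_le a]

theorem Rep.val_le {X B : ℕ} {σ : WordRAM.State} {s : ASt} (h : Rep X B σ s) {e : AExp}
    (he : e.Fits B s) : e.val s ≤ B :=
  AExp.val_le_of_fits (fun r => h.reg r ▸ h.reg_le _) (fun k i => h.arr k i ▸ h.mem_le _) e he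

/-- An execution of the array language is carried out faithfully by the translated program if the
word length is large enough. The straight-line parts between loop iterations have bounded cost, so
the number of steps is at most a constant times the number of loop iterations. -/
theorem Exec.simulate {X B W : ℕ} {p : AProg} {s s' : ASt} {J : ℕ} (h : Exec X B p s s' J)
    (hW : (B + 2) ^ p.comp.wt ≤ 2 ^ W) :
    ∀ σ, Rep X B σ s → ∃ σ' T, WordRAM.Runs W p.comp σ σ' T ∧ T ≤ p.comp.unitCost * (J + 1) ∧
      Rep X B σ' s' := by
  have mono : ∀ {a b : ℕ}, a ≤ b → (B + 2) ^ b ≤ 2 ^ W → (B + 2) ^ a ≤ 2 ^ W := fun hab hb =>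
    le_trans (Nat.pow_le_pow_right (by omega) hab) hb
  induction h with
  | skip s => exact fun σ hσ => ⟨σ, 1, .skip σ, by simp [comp, WordRAM.Prog.unitCost], hσ⟩
  | set r e s he =>
    intro σ hσ
    refine ⟨_, _, .assign _ _ σ, by simp [comp, WordRAM.Prog.unitCost], ?_⟩
    rw [hσ.eval_comp e hW]
    exact hσ.setReg r _ (hσ.val_le he)
  | put k i e s he =>
    intro σ hσ
    refine ⟨_, _, .store _ _ σ, by simp [comp, WordRAM.Prog.unitCost], ?_⟩
    rw [hσ.eval_comp e (mono (by simp [comp, WordRAM.Prog.wt]) hW),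
      hσ.eval_addr k i (mono (by simp [comp, WordRAM.Prog.wt]) hW)]
    exact hσ.setArr k _ _ (hσ.val_le he)
  | get r i s hi =>
    intro σ hσ
    refine ⟨_, _, .assign _ _ σ, by simp [comp, WordRAM.Prog.unitCost], ?_⟩
    rw [hσ.eval_eq_uval _ hW]
    simp only [WordRAM.Exp.uval, hσ.uval_comp, hσ.raw _ hi]
    exact hσ.setReg r _ (hσ.raw _ hi ▸ hσ.mem_le _)
  | out i e s hi he =>
    intro σ hσ
    refine ⟨_, _, .store _ _ σ, by simp [comp, WordRAM.Prog.unitCost], ?_⟩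
    rw [hσ.eval_comp e (mono (by simp [comp, WordRAM.Prog.wt]) hW),
      hσ.eval_comp i (mono (by simp [comp, WordRAM.Prog.wt]) hW)]
    exact hσ.setRaw _ _ hi (hσ.val_le he)
  | seq _ _ ih₁ ih₂ =>
    intro σ hσ
    obtain ⟨σ₁, T₁, r₁, t₁, hσ₁⟩ := ih₁ (mono (by simp [comp, WordRAM.Prog.wt]) hW) σ hσ
    obtain ⟨σ₂, T₂, r₂, t₂, hσ₂⟩ := ih₂ (mono (by simp [comp, WordRAM.Prog.wt]) hW) σ₁ hσ₁
    refine ⟨σ₂, _, .seq r₁ r₂, ?_, hσ₂⟩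
    simp only [comp, WordRAM.Prog.unitCost]
    nlinarith
  | ite_true hb _ ih =>
    intro σ hσ
    obtain ⟨σ₁, T₁, r₁, t₁, hσ₁⟩ :=
      ih (mono (by simp only [comp, WordRAM.Prog.wt]; omega) hW) σ hσ
    refine ⟨σ₁, _, .branch_true ?_ r₁, ?_, hσ₁⟩
    · rwa [hσ.eval_comp _ (mono (by simp only [comp, WordRAM.Prog.wt]; omega) hW)]
    · simp only [comp, WordRAM.Prog.unitCost]
      nlinarith
  | ite_false hb _ ih =>
    intro σ hσ
    obtain ⟨σ₁, T₁, r₁, t₁, hσ₁⟩ :=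
      ih (mono (by simp only [comp, WordRAM.Prog.wt]; omega) hW) σ hσ
    refine ⟨σ₁, _, .branch_false ?_ r₁, ?_, hσ₁⟩
    · rwa [hσ.eval_comp _ (mono (by simp only [comp, WordRAM.Prog.wt]; omega) hW)]
    · simp only [comp, WordRAM.Prog.unitCost]
      nlinarith
  | loop_true hb _ _ ih₁ ih₂ =>
    intro σ hσ
    obtain ⟨σ₁, T₁, r₁, t₁, hσ₁⟩ :=
      ih₁ (mono (by simp only [comp, WordRAM.Prog.wt]; omega) hW) σ hσ
    obtain ⟨σ₂, T₂, r₂, t₂, hσ₂⟩ := ih₂ hW σ₁ hσ₁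
    refine ⟨σ₂, _, .loop_true ?_ r₁ r₂, ?_, hσ₂⟩
    · rwa [hσ.eval_comp _ (mono (by simp only [comp, WordRAM.Prog.wt]; omega) hW)]
    · simp only [comp, WordRAM.Prog.unitCost] at t₂ ⊢
      nlinarith
  | loop_false hb =>
    intro σ hσ
    refine ⟨σ, _, .loop_false ?_, ?_, hσ⟩
    · rwa [hσ.eval_comp _ (mono (by simp only [comp, WordRAM.Prog.wt]; omega) hW)]
    · simp only [comp, WordRAM.Prog.unitCost]
      nlinarith

/-! ### Program logic -/

/-- `Tri X B p s J Q`: from the state `s`, the program `p` halts after at most `J` loop iterations,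
in a state with the property `Q`. -/
def Tri (X B : ℕ) (p : AProg) (s : ASt) (J : ℕ) (Q : ASt → Prop) : Prop :=
  ∃ s' J', Exec X B p s s' J' ∧ J' ≤ J ∧ Q s'

/-- Sufficient preconditions for programs without loops. Assigned values are abstracted to a
variable `v` with an equation, so that they can be rewritten before they are substituted. -/
def wp (X B : ℕ) : AProg → (ASt → Prop) → ASt → Prop
  | .skip, Q, s => Q s
  | .set r e, Q, s => e.Fits B s ∧ ∀ v, v = e.val s → Q (s.setReg r v)
  | .put k i e, Q, s => e.Fits B s ∧ ∀ v, v = e.val s → Q (s.setArr k (i.val s) v)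
  | .get r i, Q, s => i.val s < X ∧ ∀ v, v = s.raw (i.val s) → Q (s.setReg r v)
  | .out i e, Q, s => (i.val s < X ∧ e.Fits B s) ∧ Q (s.setRaw (i.val s) (e.val s))
  | .seq p q, Q, s => p.wp X B (q.wp X B Q) s
  | .ite b p q, Q, s => (b.val s ≠ 0 → p.wp X B Q s) ∧ (b.val s = 0 → q.wp X B Q s)
  | .loop _ _, _, _ => False

variable {X B : ℕ}

theorem Tri.flat {p : AProg} {s : ASt} {J : ℕ} {Q : ASt → Prop} (h : p.wp X B Q s) :
    Tri X B p s J Q := by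
  suffices h' : ∃ s', Exec X B p s s' 0 ∧ Q s' by
    obtain ⟨s', h1, h2⟩ := h'; exact ⟨s', 0, h1, Nat.zero_le _, h2⟩
  induction p generalizing s Q with
  | skip => exact ⟨s, .skip s, h⟩
  | set r e => exact ⟨_, .set r e s h.1, h.2 _ rfl⟩
  | put k i e => exact ⟨_, .put k i e s h.1, h.2 _ rfl⟩
  | get r i => exact ⟨_, .get r i s h.1, h.2 _ rfl⟩
  | out i e => exact ⟨_, .out i e s h.1.1 h.1.2, h.2⟩
  | seq p q ihp ihq =>
    obtain ⟨s₁, e₁, h₁⟩ := ihp h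
    obtain ⟨s₂, e₂, h₂⟩ := ihq h₁
    exact ⟨s₂, .seq e₁ e₂, h₂⟩
  | ite b p q ihp ihq =>
    by_cases hb : b.val s = 0
    · obtain ⟨s₁, e₁, h₁⟩ := ihq (h.2 hb)
      exact ⟨s₁, .ite_false hb e₁, h₁⟩
    · obtain ⟨s₁, e₁, h₁⟩ := ihp (h.1 hb)
      exact ⟨s₁, .ite_true hb e₁, h₁⟩
  | loop b p => exact h.elim

theorem Tri.mono {p : AProg} {s : ASt} {J J' : ℕ} {Q Q' : ASt → Prop} (h : Tri X B p s J Q)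
    (hJ : J ≤ J') (hQ : ∀ s', Q s' → Q' s') : Tri X B p s J' Q' := by
  obtain ⟨s', I, e, hI, q⟩ := h
  exact ⟨s', I, e, hI.trans hJ, hQ _ q⟩

/-- The frame may be assumed in the postcondition. -/
theorem Tri.framed {p : AProg} {s : ASt} {J : ℕ} {Q : ASt → Prop} (h : Tri X B p s J Q) :
    Tri X B p s J (fun s' => Q s' ∧ Frame p s s') := by
  obtain ⟨s', I, e, hI, q⟩ := h
  exact ⟨s', I, e, hI, q, e.frame⟩

theorem Tri.seq {p q : AProg} {s : ASt} {J₁ J₂ : ℕ} {Q Q' : ASt → Prop}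
    (h₁ : Tri X B p s J₁ Q) (h₂ : ∀ s', Q s' → Frame p s s' → Tri X B q s' J₂ Q') :
    Tri X B (p ;; q) s (J₁ + J₂) Q' := by
  obtain ⟨s₁, I₁, e₁, hI₁, q₁⟩ := h₁
  obtain ⟨s₂, I₂, e₂, hI₂, q₂⟩ := h₂ s₁ q₁ e₁.frame
  exact ⟨s₂, _, .seq e₁ e₂, by omega, q₂⟩

theorem Tri.ite {b : AExp} {p q : AProg} {s : ASt} {J : ℕ} {Q : ASt → Prop}
    (h1 : b.val s ≠ 0 → Tri X B p s J Q) (h2 : b.val s = 0 → Tri X B q s J Q) :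
    Tri X B (.ite b p q) s J Q := by
  by_cases hb : b.val s = 0
  · obtain ⟨s', J', e, hJ, hQ⟩ := h2 hb
    exact ⟨s', J', .ite_false hb e, hJ, hQ⟩
  · obtain ⟨s', J', e, hJ, hQ⟩ := h1 hb
    exact ⟨s', J', .ite_true hb e, hJ, hQ⟩

/-- A loop with an invariant `Inv` whose rank decreases in every iteration. -/
theorem Tri.loop {b : AExp} {p : AProg} {s : ASt} {t : ℕ} (Inv : ℕ → ASt → Prop)
    (hstep : ∀ k s', Frame p s s' → Inv k s' → b.val s' ≠ 0 →
      ∃ k' < k, Tri X B p s' t (Inv k')) {k : ℕ} (h0 : Inv k s) :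
    Tri X B (.loop b p) s (k * (t + 1)) (fun s' => (∃ k', Inv k' s') ∧ b.val s' = 0) := by
  suffices h : ∀ k s', Frame p s s' → Inv k s' →
      Tri X B (.loop b p) s' (k * (t + 1)) (fun s' => (∃ k', Inv k' s') ∧ b.val s' = 0) from
    h k s (Frame.refl _ _) h0
  intro k
  induction k using Nat.strong_induction_on with
  | _ k ih =>
    intro s' hF hI
    by_cases hb : b.val s' = 0
    · exact ⟨s', 0, .loop_false hb, Nat.zero_le _, ⟨k, hI⟩, hb⟩
    · obtain ⟨k', hk, s₁, J₁, e₁, hJ₁, hI₁⟩ := hstep k s' hF hI hb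
      obtain ⟨s₂, J₂, e₂, hJ₂, h₂⟩ := ih k' hk s₁ (hF.trans e₁.frame) hI₁
      refine ⟨s₂, _, .loop_true hb e₁ e₂, ?_, h₂⟩
      have : (k' + 1) * (t + 1) ≤ k * (t + 1) := Nat.mul_le_mul_right _ hk
      nlinarith

/-- The loop that runs `body` for `r = 0, 1, …` as long as `r` is less than the register `b`. -/
def forUp (r b : ℕ) (body : AProg) : AProg :=
  .set r 0 ;; .loop (.lt (.reg r) (.reg b)) (body ;; .set r (.reg r + 1))

/-- The invariant holds after `i` iterations with `i` in the loop register. In the induction step,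
the frames of the whole loop and of the body may be used. -/
theorem Tri.forUp {r b : ℕ} {body : AProg} {s : ASt} {N t : ℕ} (Inv : ℕ → ASt → Prop)
    (hb : s.reg b = N) (hN : N ≤ B) (hbr : b ≠ r) (hwb : body.writesReg b = false)
    (hwr : body.writesReg r = false) (h0 : Inv 0 (s.setReg r 0))
    (hstep : ∀ i s', i < N → Frame (forUp r b body) s s' → s'.reg r = i → Inv i s' →
      Tri X B body s' t (fun s'' => Frame body s' s'' → Inv (i + 1) (s''.setReg r (i + 1)))) :
    Tri X B (forUp r b body) s (N * (t + 1)) (Inv N) := by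
  have hF0 : Frame (AProg.forUp r b body) s (s.setReg r 0) := by
    refine ⟨fun r' h => ?_, fun _ _ => rfl, fun _ => rfl⟩
    have : r' ≠ r := by
      rintro rfl; simp [AProg.forUp, writesReg] at h
    simp [this]
  have hlt : ∀ s' : ASt, (AExp.lt (.reg r) (.reg b)).val s' =
      if s'.reg r < s'.reg b then 1 else 0 := fun _ => rfl
  have key := Tri.loop (X := X) (B := B) (b := .lt (.reg r) (.reg b))
    (p := body ;; .set r (.reg r + 1)) (s := s.setReg r 0) (t := t)
    (fun k s' => k + s'.reg r = N ∧ Inv (s'.reg r) s') ?_ (k := N) ⟨by simp, by simpa using h0⟩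
  · obtain ⟨s', J, e, hJ, ⟨⟨k, hk, hI⟩, hv⟩, hF⟩ := key.framed
    refine ⟨s', _, .seq (.set r 0 s (Nat.zero_le _)) e, by omega, ?_⟩
    have hb' : s'.reg b = N := by
      rw [hF.reg b (by simp [writesReg, hwb, hbr])]; simp [hbr, hb]
    rw [hlt, hb'] at hv
    have : s'.reg r = N := by split_ifs at hv; omega
    rwa [this] at hI
  · rintro k s' hF ⟨hk, hI⟩ hv
    have hb' : s'.reg b = N := by
      rw [hF.reg b (by simp [writesReg, hwb, hbr])]; simp [hbr, hb]
    rw [hlt, hb'] at hv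
    have hlt' : s'.reg r < N := by
      by_contra hc; simp [hc] at hv
    refine ⟨k - 1, by omega, ?_⟩
    have hF' : Frame (AProg.forUp r b body) s s' := hF0.trans
      (hF.mono (by simp +contextual [writesReg, AProg.forUp])
        (by simp +contextual [writesArr, AProg.forUp])
        (by simp +contextual [writesRaw, AProg.forUp]))
    refine Tri.seq (J₂ := 0) (hstep (s'.reg r) s' hlt' hF' rfl hI) (fun s'' hI'' hF'' => ?_)
    have hr : s''.reg r = s'.reg r := hF''.reg r hwr
    refine Tri.flat ⟨?_, ?_⟩
    · simp only [AExp.fits_add, AExp.val_reg, AExp.val_ofNat, hr]; omega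
    · rintro v rfl
      simp only [AExp.val_add, AExp.val_reg, AExp.val_ofNat, hr]
      exact ⟨by simp; omega, by simpa using hI'' hF''⟩

end AProg

/-! ### Push-relabel with weighted distances -/

/-- The distance of two positions, rounded up to a power of two (and to `1` if they coincide). -/
def weight (i j : ℕ) : ℕ := 2 ^ Nat.clog 2 (i - j + (j - i))

theorem weight_comm (i j : ℕ) : weight i j = weight j i := by
  unfold weight; rw [add_comm]

theorem weight_le {i j : ℕ} (h : i < j) : weight i j ≤ 2 * (j - i) := by
  unfold weight
  have h1 : i - j + (j - i) = j - i := by omega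
  rw [h1]
  rcases Nat.lt_or_ge 1 (j - i) with h2 | h2
  · have h3 := Nat.pow_pred_clog_lt_self (b := 2) (by norm_num) h2
    have h4 : 0 < Nat.clog 2 (j - i) := Nat.clog_pos (by norm_num) h2
    calc 2 ^ Nat.clog 2 (j - i) = 2 * 2 ^ (Nat.clog 2 (j - i)).pred := by
          rw [← pow_succ', Nat.pred_eq_sub_one, Nat.sub_add_cancel h4]
      _ ≤ 2 * (j - i) := by omega
  · have : j - i = 1 := by omega
    rw [this]; norm_num

/-- A window of radius `g` around `u` contains all positions whose weighted distance from `u`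
divides `l`, provided that the power of two `g` is as large as possible. -/
theorem dist_le_of_weight_dvd {n g l j u v : ℕ} (hg : g = 2 ^ j) (hmax : n ≤ g ∨ ¬ 2 * g ∣ l)
    (hu : u < n) (hv : v < n) (h : weight u v ∣ l) : u ≤ v + g ∧ v ≤ u + g := by
  rcases hmax with h1 | h1
  · omega
  · have h2 : Nat.clog 2 (u - v + (v - u)) ≤ j := by
      by_contra hc
      apply h1
      rw [hg, ← pow_succ']
      exact (pow_dvd_pow 2 (by omega)).trans h
    have h3 := Nat.le_pow_clog (b := 2) (by norm_num) (u - v + (v - u))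
    have h4 : 2 ^ Nat.clog 2 (u - v + (v - u)) ≤ 2 ^ j := Nat.pow_le_pow_right (by norm_num) h2
    omega

/-- A configuration of the push-relabel algorithm: residual capacities, excesses, labels, and for
every vertex the part `cur ≤ v < hi` of its current window that has not been scanned yet. -/
structure Config (n : ℕ) where
  R : Fin n → Fin n → ℕ
  ex : Fin n → ℕ
  lev : Fin n → ℕ
  cur : Fin n → ℕ
  hi : Fin n → ℕ

/-- `R` and `ex` are the residual capacities and the excesses of a preflow that receives `F` units
at `s`. Conservation is expressed without subtraction: a vertex gains as much residual out-capacity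
as it gains excess. -/
structure IsPreflow {n : ℕ} (C : Fin n → Fin n → ℕ) (s : Fin n) (F : ℕ) (R : Fin n → Fin n → ℕ)
    (ex : Fin n → ℕ) : Prop where
  pair : ∀ i j, R i j + R j i = C i j + C j i
  bal : ∀ v, ex v + ∑ j, C v j = (if v = s then F else 0) + ∑ j, R v j

theorem IsPreflow.sum_ex {n : ℕ} {C : Fin n → Fin n → ℕ} {s : Fin n} {F : ℕ}
    {R : Fin n → Fin n → ℕ} {ex : Fin n → ℕ} (h : IsPreflow C s F R ex) : ∑ v, ex v = F := by
  have h1 : ∑ v, (ex v + ∑ j, C v j) = ∑ v, ((if v = s then F else 0) + ∑ j, R v j) :=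
    Finset.sum_congr rfl fun v _ => h.bal v
  have h2 : ∑ v, ∑ j, (R v j + R j v) = ∑ v, ∑ j, (C v j + C j v) :=
    Finset.sum_congr rfl fun v _ => Finset.sum_congr rfl fun j _ => h.pair v j
  simp only [Finset.sum_add_distrib, Finset.sum_ite_eq', Finset.mem_univ, if_true] at h1 h2
  have h3 : ∑ v, ∑ j, R j v = ∑ v, ∑ j, R v j := Finset.sum_comm
  have h4 : ∑ v, ∑ j, C j v = ∑ v, ∑ j, C v j := Finset.sum_comm
  omega

theorem IsPreflow.ex_le {n : ℕ} {C : Fin n → Fin n → ℕ} {s : Fin n} {F : ℕ}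
    {R : Fin n → Fin n → ℕ} {ex : Fin n → ℕ} (h : IsPreflow C s F R ex) (v : Fin n) : ex v ≤ F := by
  rw [← h.sum_ex]
  exact Finset.single_le_sum (f := ex) (fun _ _ => Nat.zero_le _) (Finset.mem_univ v)

/-- Moving `d` units of excess from `u` to `v` preserves preflows. -/
theorem IsPreflow.push {n : ℕ} {C : Fin n → Fin n → ℕ} {s : Fin n} {F : ℕ}
    {R R' : Fin n → Fin n → ℕ} {ex ex' : Fin n → ℕ} (h : IsPreflow C s F R ex) {u v : Fin n} {d : ℕ}
    (hR : ∀ i j, R' i j + (if i = u ∧ j = v then d else 0) =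
      R i j + if i = v ∧ j = u then d else 0)
    (hex : ∀ w, ex' w + (if w = u then d else 0) = ex w + if w = v then d else 0) :
    IsPreflow C s F R' ex' where
  pair i j := by
    have h1 := hR i j
    have h2 := hR j i
    have h3 := h.pair i j
    have h4 : (if j = u ∧ i = v then d else 0) = if i = v ∧ j = u then d else 0 := by
      simp only [and_comm]
    have h5 : (if j = v ∧ i = u then d else 0) = if i = u ∧ j = v then d else 0 := by
      simp only [and_comm]
    omega
  bal w := by
    have h1 : ∑ j, (R' w j + (if w = u ∧ j = v then d else 0)) =
        ∑ j, (R w j + if w = v ∧ j = u then d else 0) := Finset.sum_congr rfl fun j _ => hR w j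
    have h2 : ∀ a b : Fin n, ∑ j, (if w = a ∧ j = b then d else 0) = if w = a then d else 0 := by
      intro a b
      by_cases hw : w = a <;> simp [hw]
    simp only [Finset.sum_add_distrib, h2] at h1
    have h3 := h.bal w
    have h4 := hex w
    omega

/-- The invariants of the labels. Residual edges out of `u` are scanned whenever the label of `u` is
a multiple of their weight; `label` says that a residual edge never leads below the last multiple at
which it was scanned. -/
structure IsLabelled {n : ℕ} (t : Fin n) (L : ℕ) (c : Config n) : Prop where
  label : ∀ u v k, 0 < c.R u v → weight u v ∣ k →
    (k < c.lev u ∨ k = c.lev u ∧ (v : ℕ) < c.cur u) → k ≤ c.lev v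
  window : ∀ u v : Fin n, 0 < c.lev u → weight u v ∣ c.lev u → (v : ℕ) < c.hi u
  hi_le : ∀ u, c.hi u ≤ n
  lev_t : c.lev t = 0
  lev_le : ∀ u, c.lev u ≤ L

/-- The final property of the labels: along a residual edge, they fall by at most the weight. -/
theorem IsLabelled.lev_le_add {n : ℕ} {t : Fin n} {L : ℕ} {c : Config n} (h : IsLabelled t L c)
    {u v : Fin n} (hR : 0 < c.R u v) : c.lev u ≤ c.lev v + weight u v := by
  rcases Nat.eq_zero_or_pos (c.lev u) with h0 | h0
  · omega
  · have hw : 0 < weight u v := Nat.pow_pos (by norm_num)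
    -- the largest multiple of the weight below the label of `u`
    have h1 := h.label u v (weight u v * ((c.lev u - 1) / weight u v)) hR (dvd_mul_right _ _)
      (Or.inl (lt_of_le_of_lt (Nat.mul_div_le _ _) (by omega)))
    have h2 := Nat.div_add_mod (c.lev u - 1) (weight u v)
    have h3 := Nat.mod_lt (c.lev u - 1) hw
    omega

/-- `c'` arises from `c` by pushing `d` units from `u` to `v`; if this saturates the edge, it counts
as scanned. -/
structure IsPush {n : ℕ} (c c' : Config n) (u v : Fin n) (d : ℕ) : Prop where
  R : ∀ i j, c'.R i j + (if i = u ∧ j = v then d else 0) =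
    c.R i j + if i = v ∧ j = u then d else 0
  ex : ∀ w, c'.ex w + (if w = u then d else 0) = c.ex w + if w = v then d else 0
  lev : c'.lev = c.lev
  hi : c'.hi = c.hi
  cur : ∀ w, c'.cur w = if w = u ∧ c'.R u v = 0 then c.cur u + 1 else c.cur w

theorem IsLabelled.push {n : ℕ} {t : Fin n} {L : ℕ} {c c' : Config n} (h : IsLabelled t L c)
    {u v : Fin n} {d : ℕ} (hp : IsPush c c' u v d) (huv : c.lev v < c.lev u)
    (hcur : c.cur u = v) : IsLabelled t L c' where
  label i j k hR hw hk := by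
    rw [hp.lev] at hk ⊢
    by_cases hij : i = v ∧ j = u
    · rw [hij.1] at hk; rw [hij.2]; omega
    · have h1 := hp.R i j
      rw [if_neg hij] at h1
      refine h.label i j k (by omega) hw ?_
      rcases hk with hk | ⟨hk, hlt⟩
      · exact Or.inl hk
      · refine Or.inr ⟨hk, ?_⟩
        rw [hp.cur i] at hlt
        split_ifs at hlt with hc
        · rw [hc.1]
          have : j ≠ v := by
            rintro rfl
            rw [hc.1] at hR; omega
          have : (j : ℕ) ≠ v := fun he => this (Fin.ext he)
          omega
        · exact hlt
  window i j h0 hw := by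
    rw [hp.lev] at h0 hw
    rw [hp.hi]; exact h.window i j h0 hw
  hi_le i := by rw [hp.hi]; exact h.hi_le i
  lev_t := by rw [hp.lev]; exact h.lev_t
  lev_le i := by rw [hp.lev]; exact h.lev_le i

/-- Skipping the edge from `u` to `cur u`, which is not admissible. -/
structure IsSkip {n : ℕ} (c c' : Config n) (u v : Fin n) : Prop where
  R : c'.R = c.R
  ex : c'.ex = c.ex
  lev : c'.lev = c.lev
  hi : c'.hi = c.hi
  cur : ∀ w, c'.cur w = if w = u then c.cur u + 1 else c.cur w

theorem IsLabelled.skip {n : ℕ} {t : Fin n} {L : ℕ} {c c' : Config n} (h : IsLabelled t L c)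
    {u v : Fin n} (hp : IsSkip c c' u v) (huv : c.R u v = 0 ∨ c.lev u ≤ c.lev v)
    (hcur : c.cur u = v) : IsLabelled t L c' where
  label i j k hR hw hk := by
    rw [hp.lev] at hk ⊢
    rw [hp.R] at hR
    rcases hk with hk | ⟨hk, hlt⟩
    · exact h.label i j k hR hw (Or.inl hk)
    · rw [hp.cur i] at hlt
      split_ifs at hlt with hc
      · by_cases hj : j = v
        · rw [hc, hj] at hR
          rw [hj, hk, hc]; omega
        · have : (j : ℕ) ≠ v := fun he => hj (Fin.ext he)
          exact h.label i j k hR hw (Or.inr ⟨hk, by rw [hc]; omega⟩)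
      · exact h.label i j k hR hw (Or.inr ⟨hk, hlt⟩)
  window i j h0 hw := by
    rw [hp.lev] at h0 hw
    rw [hp.hi]; exact h.window i j h0 hw
  hi_le i := by rw [hp.hi]; exact h.hi_le i
  lev_t := by rw [hp.lev]; exact h.lev_t
  lev_le i := by rw [hp.lev]; exact h.lev_le i

/-- `c'` arises from `c` by raising the label of `u` by one and opening the window of radius `g`. -/
structure IsRelabel {n : ℕ} (c c' : Config n) (u : Fin n) (g : ℕ) : Prop where
  R : c'.R = c.R
  ex : c'.ex = c.ex
  lev : ∀ w, c'.lev w = if w = u then c.lev u + 1 else c.lev w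
  hi : ∀ w, c'.hi w = if w = u then min n (u + g + 1) else c.hi w
  cur : ∀ w, c'.cur w = if w = u then u - g else c.cur w

theorem IsLabelled.relabel {n : ℕ} {t : Fin n} {L : ℕ} {c c' : Config n} (h : IsLabelled t L c)
    {u : Fin n} {g j : ℕ} (hp : IsRelabel c c' u g) (hut : u ≠ t) (hL : c.lev u < L)
    (hcur : c.hi u ≤ c.cur u) (hg : g = 2 ^ j) (hmax : n ≤ g ∨ ¬ 2 * g ∣ c.lev u + 1) :
    IsLabelled t L c' where
  label i j k hR hw hk := by
    rw [hp.R] at hR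
    have hmono : c.lev j ≤ c'.lev j := by rw [hp.lev j]; split_ifs with hj <;> simp [hj]
    refine le_trans ?_ hmono
    rw [hp.lev i, hp.cur i] at hk
    by_cases hi : i = u
    · rw [if_pos hi, if_pos hi] at hk
      rcases hk with hk | ⟨hk, hlt⟩
      · rcases Nat.lt_or_ge k (c.lev u) with hk' | hk'
        · exact h.label i j k hR hw (Or.inl (by rw [hi]; exact hk'))
        · have hke : k = c.lev u := by omega
          rcases Nat.eq_zero_or_pos k with h0 | h0
          · omega
          · refine h.label i j k hR hw (Or.inr ⟨by rw [hi]; exact hke, ?_⟩)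
            rw [hi]
            refine lt_of_lt_of_le (h.window u j (by omega) ?_) hcur
            rw [← hke, ← hi]; exact hw
      · -- below the new window, no weight divides the new label
        have := dist_le_of_weight_dvd hg hmax u.2 j.2 (by rw [← hk, ← hi]; exact hw)
        omega
    · rw [if_neg hi, if_neg hi] at hk
      exact h.label i j k hR hw hk
  window i j h0 hw := by
    rw [hp.lev i] at h0 hw
    rw [hp.hi i]
    split_ifs at h0 hw ⊢ with hi
    · have := dist_le_of_weight_dvd hg hmax u.2 j.2 (by rw [← hi]; rw [hi] at hw ⊢; exact hw)
      have := j.2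
      omega
    · exact h.window i j h0 hw
  hi_le i := by
    rw [hp.hi i]; split_ifs
    · exact min_le_left _ _
    · exact h.hi_le i
  lev_t := by rw [hp.lev t, if_neg (Ne.symm hut)]; exact h.lev_t
  lev_le i := by
    rw [hp.lev i]; split_ifs
    · omega
    · exact h.lev_le i

/-! ### Excess scaling -/

/-- In the phase with scale `D`, a vertex is active if it is not the sink, is alive (its label is
less than `L`), and has an excess of more than `D / 2`. -/
def Config.Active {n : ℕ} (t : Fin n) (L D : ℕ) (c : Config n) (v : Fin n) : Prop :=
  v ≠ t ∧ c.lev v < L ∧ D < 2 * c.ex v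

/-- No living vertex other than the sink has an excess of more than `D`. -/
def Config.Capped {n : ℕ} (t : Fin n) (L D : ℕ) (c : Config n) : Prop :=
  ∀ v, v ≠ t → c.lev v < L → c.ex v ≤ D

/-- The work that is left at the vertex `u`: unscanned entries of the present window, and entries
of the windows of the labels to come (with one unit for each relabelling). -/
def Config.work {n : ℕ} (L K : ℕ) (c : Config n) (u : Fin n) : ℕ :=
  (c.hi u - c.cur u) + ∑ l ∈ Finset.Ioc (c.lev u) L, (2 * Nat.gcd l (2 ^ K) + 2)

/-- The height of the excess at `v`; dead vertices do not count. -/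
def Config.mass {n : ℕ} (L : ℕ) (c : Config n) (v : Fin n) : ℕ :=
  if c.lev v < L then c.ex v * c.lev v else 0

/-- The potential: twice the excesses weighted by the labels, plus `3 * D` for every unit of work.
A push of at least `D / 2` units lowers the first part by `D`; a relabelling raises it by at most
`2 * D`, which is outweighed by the unit of work that is done. -/
def Config.potential {n : ℕ} (L K D : ℕ) (c : Config n) : ℕ :=
  2 * ∑ v, c.mass L v + 3 * D * ∑ u, c.work L K u

theorem sum_lt_of_single {n : ℕ} {f g : Fin n → ℕ} (u : Fin n) (hu : f u + 1 ≤ g u)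
    (h : ∀ w, w ≠ u → f w ≤ g w) : ∑ w, f w + 1 ≤ ∑ w, g w :=
  Finset.sum_lt_sum (fun w _ => by
    by_cases hw : w = u
    · subst hw; exact le_trans (Nat.le_succ _) hu
    · exact h w hw) ⟨u, Finset.mem_univ _, hu⟩

theorem IsPush.sum_mass {n : ℕ} {L : ℕ} {c c' : Config n} {u v : Fin n} {d : ℕ}
    (hp : IsPush c c' u v d) (huv : c.lev v < c.lev u) (hL : c.lev u < L) :
    ∑ w, c'.mass L w + d ≤ ∑ w, c.mass L w := by
  have h1 : ∑ w, (c'.mass L w + if w = u then d * c.lev u else 0) =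
      ∑ w, (c.mass L w + if w = v then d * c.lev v else 0) := by
    refine Finset.sum_congr rfl fun w _ => ?_
    have h2 := hp.ex w
    have hvL : c.lev v < L := by omega
    unfold Config.mass
    rw [hp.lev]
    by_cases hwu : w = u
    · have : w ≠ v := by rintro rfl; rw [hwu] at huv; omega
      rw [if_pos hwu, if_neg this] at h2
      rw [if_pos hwu, if_neg this, hwu, if_pos hL, if_pos hL, ← add_mul, ← hwu, h2, add_zero, add_zero]
    · rw [if_neg hwu] at h2
      rw [if_neg hwu, add_zero]
      by_cases hwv : w = v
      · rw [if_pos hwv] at h2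
        rw [if_pos hwv, hwv, if_pos hvL, if_pos hvL, ← add_mul, ← hwv, ← h2]
        rfl
      · rw [if_neg hwv] at h2
        rw [if_neg hwv, add_zero, ← add_zero (c'.ex w), h2, add_zero]
  simp only [Finset.sum_add_distrib, Finset.sum_ite_eq', Finset.mem_univ, if_true] at h1
  have h3 : d * (c.lev v + 1) ≤ d * c.lev u := Nat.mul_le_mul_left _ huv
  rw [mul_add] at h3
  omega

theorem IsPush.potential {n : ℕ} {L K D : ℕ} {c c' : Config n} {u v : Fin n} {d : ℕ}
    (hp : IsPush c c' u v d) (huv : c.lev v < c.lev u) (hL : c.lev u < L) (hcur : c.cur u = v)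
    (hv : v < c.hi u) (hd : d = c.R u v ∨ D ≤ 2 * d) : c'.potential L K D + D ≤ c.potential L K D := by
  have h1 := hp.sum_mass huv hL
  have hle : ∀ w, c'.work L K w ≤ c.work L K w := by
    intro w
    unfold Config.work
    rw [hp.lev, hp.hi, hp.cur]
    split_ifs with hw
    · rw [hw.1]; omega
    · exact le_rfl
  unfold Config.potential
  rcases hd with hd | hd
  · have h2 : ∑ w, c'.work L K w + 1 ≤ ∑ w, c.work L K w := by
      refine sum_lt_of_single u ?_ (fun w _ => hle w)
      have hz : c'.R u v = 0 := by
        have h3 := hp.R u v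
        have hne : ¬ (u = v ∧ v = u) := by rintro ⟨rfl, _⟩; omega
        rw [if_pos ⟨rfl, rfl⟩, if_neg hne] at h3
        omega
      unfold Config.work
      rw [hp.lev, hp.hi, hp.cur, if_pos ⟨rfl, hz⟩]
      omega
    nlinarith
  · have h2 : ∑ w, c'.work L K w ≤ ∑ w, c.work L K w := Finset.sum_le_sum fun w _ => hle w
    have := Nat.mul_le_mul_left (3 * D) h2
    omega

theorem IsSkip.potential {n : ℕ} {L K D : ℕ} {c c' : Config n} {u v : Fin n}
    (hp : IsSkip c c' u v) (hcur : c.cur u < c.hi u) :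
    c'.potential L K D + D ≤ c.potential L K D := by
  have h2 : ∑ w, c'.work L K w + 1 ≤ ∑ w, c.work L K w := by
    refine sum_lt_of_single u ?_ (fun w hw => ?_)
    · unfold Config.work
      rw [hp.lev, hp.hi, hp.cur, if_pos rfl]
      omega
    · unfold Config.work
      rw [hp.lev, hp.hi, hp.cur, if_neg hw]
  have h1 : ∀ w, c'.mass L w = c.mass L w := fun w => by
    unfold Config.mass; rw [hp.ex, hp.lev]
  unfold Config.potential
  simp only [h1]
  nlinarith

theorem IsRelabel.potential {n : ℕ} {L K D : ℕ} {c c' : Config n} {u : Fin n} {g j : ℕ}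
    (hp : IsRelabel c c' u g) (hL : c.lev u < L) (hex : c.ex u ≤ D)
    (hg : g = 2 ^ j) (hj : j ≤ K) (hdvd : g ∣ c.lev u + 1) :
    c'.potential L K D + D ≤ c.potential L K D := by
  have hgg : g ≤ Nat.gcd (c.lev u + 1) (2 ^ K) := by
    apply Nat.le_of_dvd (Nat.gcd_pos_of_pos_left _ (by omega))
    exact Nat.dvd_gcd hdvd (by rw [hg]; exact pow_dvd_pow 2 hj)
  have hIoc : Finset.Ioc (c.lev u) L = insert (c.lev u + 1) (Finset.Ioc (c.lev u + 1) L) := by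
    ext l; simp only [Finset.mem_Ioc, Finset.mem_insert]; omega
  have h2 : ∑ w, c'.work L K w + 1 ≤ ∑ w, c.work L K w := by
    refine sum_lt_of_single u ?_ (fun w hw => ?_)
    · unfold Config.work
      rw [hp.lev, hp.hi, hp.cur, if_pos rfl, if_pos rfl, if_pos rfl,
        hIoc, Finset.sum_insert (by simp)]
      omega
    · unfold Config.work
      rw [hp.lev, hp.hi, hp.cur, if_neg hw, if_neg hw, if_neg hw]
  have h1 : ∑ w, c'.mass L w ≤ ∑ w, c.mass L w + c.ex u := by
    calc ∑ w, c'.mass L w ≤ ∑ w, (c.mass L w + if w = u then c.ex u else 0) := by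
          refine Finset.sum_le_sum fun w _ => ?_
          unfold Config.mass
          rw [hp.ex, hp.lev]
          by_cases hw : w = u
          · rw [if_pos hw, if_pos hw, hw, if_pos hL, mul_add, mul_one]
            split_ifs <;> omega
          · rw [if_neg hw, if_neg hw, add_zero]
      _ = ∑ w, c.mass L w + c.ex u := by rw [Finset.sum_add_distrib]; simp
  unfold Config.potential
  nlinarith

/-- The amount that is pushed keeps the excesses below `D`, and it saturates the edge or is at
least `D / 2`: as `u` is an active vertex of least label, the vertex `v` below it is not active. -/
theorem push_amount {n : ℕ} {t : Fin n} {L D : ℕ} {c : Config n} {u v : Fin n}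
    (hu : c.Active t L D u) (hmin : ∀ w, c.Active t L D w → c.lev u ≤ c.lev w)
    (huv : c.lev v < c.lev u) {d : ℕ}
    (hd : d = min (c.ex u) (c.R u v) ∧ v = t ∨
      d = min (min (c.ex u) (c.R u v)) (D - c.ex v) ∧ v ≠ t) : d = c.R u v ∨ D ≤ 2 * d := by
  have hua := hu.2.2
  rcases hd with ⟨hd, _⟩ | ⟨hd, hv⟩
  · omega
  · have : ¬ D < 2 * c.ex v := fun hc => by
      have := hmin v ⟨hv, by have := hu.2.1; omega, hc⟩
      omega
    omega

/-- The sum of all window sizes over all labels: each of the `K + 1` powers of two `2 ^ j`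
contributes `2 ^ j` for every multiple of it. -/
theorem sum_gcd_le (K L : ℕ) : ∑ l ∈ Finset.Ioc 0 L, Nat.gcd l (2 ^ K) ≤ (K + 1) * L := by
  have h1 : ∀ l ∈ Finset.Ioc 0 L, Nat.gcd l (2 ^ K) ≤
      ∑ j ∈ Finset.range (K + 1), if 2 ^ j ∣ l then 2 ^ j else 0 := by
    intro l hl
    obtain ⟨j, hj, he⟩ := (Nat.dvd_prime_pow Nat.prime_two).1 (Nat.gcd_dvd_right l (2 ^ K))
    have hdvd : 2 ^ j ∣ l := he ▸ Nat.gcd_dvd_left l (2 ^ K)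
    rw [he]
    calc 2 ^ j = if 2 ^ j ∣ l then 2 ^ j else 0 := by rw [if_pos hdvd]
      _ ≤ _ := Finset.single_le_sum (f := fun j => if 2 ^ j ∣ l then 2 ^ j else 0)
          (fun _ _ => Nat.zero_le _) (Finset.mem_range.2 (by omega))
  calc ∑ l ∈ Finset.Ioc 0 L, Nat.gcd l (2 ^ K)
      ≤ ∑ l ∈ Finset.Ioc 0 L, ∑ j ∈ Finset.range (K + 1), (if 2 ^ j ∣ l then 2 ^ j else 0) :=
        Finset.sum_le_sum h1
    _ = ∑ j ∈ Finset.range (K + 1), ∑ l ∈ Finset.Ioc 0 L, (if 2 ^ j ∣ l then 2 ^ j else 0) :=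
        Finset.sum_comm
    _ ≤ ∑ j ∈ Finset.range (K + 1), L := by
        refine Finset.sum_le_sum fun j _ => ?_
        rw [← Finset.sum_filter, Finset.sum_const, smul_eq_mul, Nat.Ioc_filter_dvd_card_eq_div]
        exact Nat.div_mul_le_self _ _
    _ = (K + 1) * L := by simp

/-- A bound for the potential at the beginning of a phase. -/
theorem potential_le {n : ℕ} {t : Fin n} {L K D : ℕ} {c : Config n} (h : IsLabelled t L c)
    (hcap : c.Capped t L D) : c.potential L K D ≤ (2 * n * L + 3 * n * (n + 2 * (K + 2) * L)) * D := by
  have h1 : ∑ v, c.mass L v ≤ n * (D * L) := by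
    calc ∑ v, c.mass L v ≤ ∑ _v : Fin n, D * L := by
          refine Finset.sum_le_sum fun v _ => ?_
          unfold Config.mass
          split_ifs with hL
          · by_cases hv : v = t
            · rw [hv, h.lev_t]; simp
            · exact Nat.mul_le_mul (hcap v hv hL) hL.le
          · exact Nat.zero_le _
      _ = n * (D * L) := by simp
  have h2 : ∑ u, c.work L K u ≤ n * (n + 2 * (K + 2) * L) := by
    calc ∑ u, c.work L K u ≤ ∑ _u : Fin n, (n + 2 * (K + 2) * L) := by
          refine Finset.sum_le_sum fun u _ => ?_
          unfold Config.work
          have h3 := h.hi_le u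
          have h4 : ∑ l ∈ Finset.Ioc (c.lev u) L, (2 * Nat.gcd l (2 ^ K) + 2) ≤
              ∑ l ∈ Finset.Ioc 0 L, (2 * Nat.gcd l (2 ^ K) + 2) :=
            Finset.sum_le_sum_of_subset (Finset.Ioc_subset_Ioc_left (Nat.zero_le _))
          have h5 := sum_gcd_le K L
          have h6 : ∑ l ∈ Finset.Ioc 0 L, (2 * Nat.gcd l (2 ^ K) + 2) =
              2 * ∑ l ∈ Finset.Ioc 0 L, Nat.gcd l (2 ^ K) + L * 2 := by
            rw [Finset.sum_add_distrib, ← Finset.mul_sum]; simp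
          have h7 : c.hi u - c.cur u ≤ n := by omega
          nlinarith
      _ = n * (n + 2 * (K + 2) * L) := by simp
  unfold Config.potential
  calc _ ≤ 2 * (n * (D * L)) + 3 * D * (n * (n + 2 * (K + 2) * L)) := by gcongr
    _ = _ := by ring

/-! ### Flows given by matrices -/

/-- `G` is a feasible `s`-`t` flow of value `x` for the capacity matrix `C`. -/
structure IsMatFlow {n : ℕ} (C : Fin n → Fin n → ℕ) (s t : Fin n) (G : Fin n → Fin n → ℝ)
    (x : ℝ) : Prop where
  nonneg : ∀ i j, 0 ≤ G i j
  le_cap : ∀ i j, G i j ≤ C i j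
  bal : ∀ v, ∑ j, G v j - ∑ i, G i v = (if v = s then x else 0) - if v = t then x else 0

theorem IsMatFlow.scale {n : ℕ} {C : Fin n → Fin n → ℕ} {s t : Fin n} {G : Fin n → Fin n → ℝ}
    {x a : ℝ} (h : IsMatFlow C s t G x) (h0 : 0 ≤ a) (h1 : a ≤ 1) :
    IsMatFlow C s t (fun i j => a * G i j) (a * x) where
  nonneg i j := mul_nonneg h0 (h.nonneg i j)
  le_cap i j := le_trans (mul_le_of_le_one_left (h.nonneg i j) h1) (h.le_cap i j)
  bal v := by
    rw [← Finset.mul_sum, ← Finset.mul_sum, ← mul_sub, h.bal v, mul_sub, mul_ite, mul_ite, mul_zero]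

theorem sum_mul_sub_eq {n : ℕ} (f : Fin n → Fin n → ℝ) (φ : Fin n → ℝ) :
    ∑ i, ∑ j, f i j * (φ i - φ j) = ∑ v, φ v * (∑ j, f v j - ∑ i, f i v) := by
  simp only [mul_sub, Finset.sum_sub_distrib, Finset.mul_sum]
  congr 1
  · exact Finset.sum_congr rfl fun i _ => Finset.sum_congr rfl fun j _ => mul_comm _ _
  · rw [Finset.sum_comm]
    exact Finset.sum_congr rfl fun i _ => Finset.sum_congr rfl fun j _ => mul_comm _ _

theorem IsMatFlow.sum_mul_sub {n : ℕ} {C : Fin n → Fin n → ℕ} {s t : Fin n}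
    {G : Fin n → Fin n → ℝ} {x : ℝ} (h : IsMatFlow C s t G x) (φ : Fin n → ℝ) :
    ∑ i, ∑ j, G i j * (φ i - φ j) = x * φ s - x * φ t := by
  rw [sum_mul_sub_eq]
  simp only [h.bal, mul_sub, mul_ite, mul_zero, Finset.sum_sub_distrib, Finset.sum_ite_eq',
    Finset.mem_univ, if_true]
  ring

/-- The flow that belongs to the residual matrix `R` of an upper triangular capacity matrix: the
entry below the diagonal is the residual capacity of the reverse edge. -/
def lowerFlow {n : ℕ} (R : Fin n → Fin n → ℕ) (i j : Fin n) : ℕ := if i < j then R j i else 0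

theorem IsPreflow.lowerFlow_bal {n : ℕ} {C : Fin n → Fin n → ℕ} {s : Fin n} {F : ℕ}
    {R : Fin n → Fin n → ℕ} {ex : Fin n → ℕ} (hC : ∀ i j, 0 < C i j → i < j)
    (h : IsPreflow C s F R ex) (v : Fin n) :
    ex v + ∑ j, lowerFlow R v j = (if v = s then F else 0) + ∑ i, lowerFlow R i v := by
  have h1 : ∑ j, (C v j + lowerFlow R j v) = ∑ j, (R v j + lowerFlow R v j) := by
    refine Finset.sum_congr rfl fun j _ => ?_
    have h2 := h.pair v j
    have h3 := hC v j
    have h4 := hC j v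
    unfold lowerFlow
    rcases lt_trichotomy v j with hlt | heq | hgt
    · have := hlt.not_gt
      simp only [hlt, this, if_true, if_false]; omega
    · subst heq; simp only [lt_irrefl, if_false] at *; omega
    · have := hgt.not_gt
      simp only [hgt, this, if_true, if_false]; omega
  simp only [Finset.sum_add_distrib] at h1
  have := h.bal v
  omega

theorem IsPreflow.lowerFlow_le {n : ℕ} {C : Fin n → Fin n → ℕ} {s : Fin n} {F : ℕ}
    {R : Fin n → Fin n → ℕ} {ex : Fin n → ℕ} (hC : ∀ i j, 0 < C i j → i < j)
    (h : IsPreflow C s F R ex) (i j : Fin n) : lowerFlow R i j ≤ C i j := by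
  unfold lowerFlow
  split_ifs with hij
  · have h1 := h.pair i j
    have h2 : ¬ 0 < C j i := fun hc => (hC j i hc).not_gt hij
    omega
  · exact Nat.zero_le _

/-- The fundamental estimate. Summing the label differences along a flow `G` of value `F` gives `F`
times the label of `s`. An edge that is not saturated by the preflow contributes at most its weight,
and on a saturated edge the preflow is at least `G`, so that the contribution is at most that of the
preflow. The weights are at most twice the differences of the positions, so they telescope along the
two flows; what remains is a bound for the excesses weighted by their labels. -/
theorem sum_ex_mul_lev_le {n : ℕ} {C : Fin n → Fin n → ℕ} {s t : Fin n} {F : ℕ}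
    {R : Fin n → Fin n → ℕ} {ex lev : Fin n → ℕ} (hC : ∀ i j, 0 < C i j → i < j)
    (h : IsPreflow C s F R ex) (hlab : ∀ u v, 0 < R u v → lev u ≤ lev v + weight u v)
    (ht : lev t = 0) {G : Fin n → Fin n → ℝ} (hG : IsMatFlow C s t G F) :
    ∑ v, ex v * lev v ≤ 4 * n * F := by
  set f : Fin n → Fin n → ℝ := fun i j => (lowerFlow R i j : ℝ) with hf
  set φ : Fin n → ℝ := fun v => (lev v : ℝ) with hφ
  set ψ : Fin n → ℝ := fun v => -(2 * (v : ℝ)) with hψ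
  have hbal : ∀ v, ∑ j, f v j - ∑ i, f i v = (if v = s then (F : ℝ) else 0) - ex v := by
    intro v
    have h1 : ((ex v + ∑ j, lowerFlow R v j : ℕ) : ℝ) =
        ((if v = s then F else 0) + ∑ i, lowerFlow R i v : ℕ) := by rw [h.lowerFlow_bal hC v]
    push_cast at h1
    simp only [hf]
    linarith
  have hterm : ∀ i j, G i j * (φ i - φ j) ≤
      G i j * (ψ i - ψ j) + (f i j * (φ i - φ j) + f i j * (ψ i - ψ j)) := by
    intro i j
    by_cases hij : i < j
    · have hij' : (i : ℕ) < j := hij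
      -- `hw` bounds a fall along the edge, `hback` bounds a rise along an edge that carries flow
      have hw : (weight i j : ℝ) ≤ ψ i - ψ j := by
        have h1 : ((weight i j : ℕ) : ℝ) ≤ ((2 * ((j : ℕ) - i) : ℕ) : ℝ) := by
          exact_mod_cast weight_le hij'
        rw [Nat.cast_mul, Nat.cast_sub hij'.le] at h1
        simp only [hψ]; push_cast at h1; linarith
      have hpair := h.pair i j
      have hC0 : C j i = 0 := by
        by_contra hc; exact (hC j i (Nat.pos_of_ne_zero hc)).not_gt hij
      have hfR : f i j = R j i := by simp [hf, lowerFlow, hij]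
      have hcap : (C i j : ℝ) = R i j + R j i := by
        have : C i j = R i j + R j i := by omega
        rw [this]; push_cast; rfl
      have hg0 := hG.nonneg i j
      have hgc := hG.le_cap i j
      have hback : 0 < R j i → 0 ≤ φ i - φ j + (ψ i - ψ j) := by
        intro hpos
        have h1 : ((lev j : ℕ) : ℝ) ≤ ((lev i + weight j i : ℕ) : ℝ) := by
          exact_mod_cast hlab j i hpos
        rw [weight_comm] at h1
        push_cast at h1
        simp only [hφ]; linarith
      have hfn : 0 ≤ f i j * (φ i - φ j + (ψ i - ψ j)) := by
        rcases Nat.eq_zero_or_pos (R j i) with h0 | h0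
        · rw [hfR, h0]; simp
        · exact mul_nonneg (by rw [hfR]; positivity) (hback h0)
      rcases Nat.eq_zero_or_pos (R i j) with h0 | h0
      · rw [h0, Nat.cast_zero, zero_add] at hcap
        rcases Nat.eq_zero_or_pos (R j i) with h0' | h0'
        · have : G i j = 0 := by rw [hcap, h0', Nat.cast_zero] at hgc; linarith
          rw [this]; linarith
        · have h1 := mul_le_mul_of_nonneg_right (hcap ▸ hgc) (hback h0')
          rw [← hfR] at h1
          have h2 := mul_nonneg hg0 ((Nat.cast_nonneg _).trans hw)
          linarith
      · have h1 : ((lev i : ℕ) : ℝ) ≤ ((lev j + weight i j : ℕ) : ℝ) := by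
          exact_mod_cast hlab i j h0
        push_cast at h1
        have h2 : φ i - φ j ≤ ψ i - ψ j := by simp only [hφ]; linarith
        have h3 := mul_le_mul_of_nonneg_left h2 hg0
        linarith
    · have hC0 : C i j = 0 := by
        by_contra hc; exact hij (hC i j (Nat.pos_of_ne_zero hc))
      have hg : G i j = 0 :=
        le_antisymm (by have := hG.le_cap i j; rwa [hC0, Nat.cast_zero] at this) (hG.nonneg i j)
      have hf0 : f i j = 0 := by simp [hf, lowerFlow, hij]
      rw [hg, hf0]; simp
  have hsum := Finset.sum_le_sum fun i (_ : i ∈ Finset.univ) =>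
    Finset.sum_le_sum fun j (_ : j ∈ Finset.univ) => hterm i j
  simp only [Finset.sum_add_distrib] at hsum
  have hpot : ∀ θ : Fin n → ℝ, ∑ i, ∑ j, f i j * (θ i - θ j) = F * θ s - ∑ v, ex v * θ v := by
    intro θ
    rw [sum_mul_sub_eq]
    simp only [hbal, mul_sub, mul_ite, mul_zero, Finset.sum_sub_distrib, Finset.sum_ite_eq',
      Finset.mem_univ, if_true]
    rw [mul_comm]
    congr 1
    exact Finset.sum_congr rfl fun v _ => mul_comm _ _
  rw [hG.sum_mul_sub, hG.sum_mul_sub, hpot, hpot] at hsum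
  have hlt : φ t = 0 := by simp [hφ, ht]
  have hF : (0 : ℝ) ≤ F := Nat.cast_nonneg _
  have hex : -(∑ v, (ex v : ℝ) * ψ v) ≤ 2 * n * F := by
    rw [← Finset.sum_neg_distrib]
    have hs : (∑ v, (ex v : ℝ)) = F := by exact_mod_cast h.sum_ex
    calc ∑ v, -((ex v : ℝ) * ψ v) ≤ ∑ v, (ex v : ℝ) * (2 * n) := by
          refine Finset.sum_le_sum fun v _ => ?_
          have h1 : ((v : ℕ) : ℝ) ≤ n := by exact_mod_cast v.2.le
          have h2 : (0 : ℝ) ≤ ex v := Nat.cast_nonneg _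
          simp only [hψ]; nlinarith
      _ = 2 * n * F := by rw [← Finset.sum_mul, hs]; ring
  have hs0 : (F : ℝ) * ψ s ≤ 0 := by
    have h1 : (0 : ℝ) ≤ (s : ℕ) := Nat.cast_nonneg _
    simp only [hψ]; nlinarith
  have ht0 : -(F * ψ t) ≤ 2 * n * F := by
    have h1 : ((t : ℕ) : ℝ) ≤ n := by exact_mod_cast t.2.le
    simp only [hψ]; nlinarith
  have hfin : ∑ v, (ex v : ℝ) * φ v ≤ 4 * n * F := by
    rw [hlt] at hsum; linarith
  simp only [hφ] at hfin
  exact_mod_cast hfin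

/-- If all labels stop at `16 * n`, the excess that is left at living vertices is small, and there
is a flow of value `F`, then at least half of the `F` units have arrived at the sink. -/
theorem le_two_mul_ex {n : ℕ} {C : Fin n → Fin n → ℕ} {s t : Fin n} {F : ℕ}
    {R : Fin n → Fin n → ℕ} {ex lev : Fin n → ℕ} (hC : ∀ i j, 0 < C i j → i < j)
    (h : IsPreflow C s F R ex) (hlab : ∀ u v, 0 < R u v → lev u ≤ lev v + weight u v)
    (ht : lev t = 0) (hlive : ∀ v, v ≠ t → lev v < 16 * n → 4 * n * ex v ≤ F)
    {G : Fin n → Fin n → ℝ} (hG : IsMatFlow C s t G F) : F ≤ 2 * ex t := by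
  have h1 := sum_ex_mul_lev_le hC h hlab ht hG
  have hn : 0 < n := s.pos
  have h2 : ∑ v, 16 * n * ex v ≤
      ∑ v, ((if v = t then 16 * n * ex t else 0) + (ex v * lev v + 4 * F)) := by
    refine Finset.sum_le_sum fun v _ => ?_
    by_cases hv : v = t
    · rw [if_pos hv, hv]; omega
    · rw [if_neg hv]
      rcases Nat.lt_or_ge (lev v) (16 * n) with hl | hl
      · have := hlive v hv hl; nlinarith
      · nlinarith
  simp only [Finset.sum_add_distrib, Finset.sum_ite_eq', Finset.mem_univ, if_true,
    Finset.sum_const, Finset.card_univ, Fintype.card_fin, smul_eq_mul, ← Finset.mul_sum,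
    h.sum_ex] at h2
  nlinarith

/-! ### Bottleneck values -/

/-- `b j` is the largest bottleneck capacity of a path from `s` to `j` (and `b s` is at least every
capacity), expressed by the recursion over the positions. -/
structure IsBottleneck {n : ℕ} (C : Fin n → Fin n → ℕ) (s : Fin n) (b : Fin n → ℕ) : Prop where
  step_le : ∀ i j, i < j → j ≠ s → min (b i) (C i j) ≤ b j
  attained : ∀ j, j ≠ s → b j = 0 ∨ ∃ i < j, b j ≤ b i ∧ b j ≤ C i j
  le_source : ∀ i j, C i j ≤ b s

/-- There is a flow along a path of bottleneck capacity `b t`. -/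
theorem IsBottleneck.exists_flow {n : ℕ} {C : Fin n → Fin n → ℕ} {s : Fin n} {b : Fin n → ℕ}
    (h : IsBottleneck C s b) (t : Fin n) {x : ℝ} (h0 : 0 ≤ x) (hx : x ≤ b t) :
    ∃ G, IsMatFlow C s t G x ∧ ∀ i j, t < j → G i j = 0 := by
  induction t using WellFoundedLT.induction with
  | _ t ih =>
    by_cases hts : t = s
    · exact ⟨fun _ _ => 0, ⟨fun _ _ => le_rfl, fun _ _ => Nat.cast_nonneg _,
        fun v => by simp [hts]⟩, fun _ _ _ => rfl⟩
    · rcases h.attained t hts with hb | ⟨i, hi, hbi, hci⟩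
      · have hx0 : x = 0 := le_antisymm (by rw [hb] at hx; exact_mod_cast hx) h0
        exact ⟨fun _ _ => 0, ⟨fun _ _ => le_rfl, fun _ _ => Nat.cast_nonneg _,
          fun v => by simp [hx0]⟩, fun _ _ _ => rfl⟩
      · have hbi' : ((b t : ℕ) : ℝ) ≤ b i := by exact_mod_cast hbi
        have hci' : ((b t : ℕ) : ℝ) ≤ C i t := by exact_mod_cast hci
        obtain ⟨G, hG, hz⟩ := ih i hi (hx.trans hbi')
        refine ⟨fun u v => G u v + if u = i ∧ v = t then x else 0, ⟨fun u v => ?_, fun u v => ?_,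
          fun v => ?_⟩, fun u v hv => ?_⟩
        · have := hG.nonneg u v
          split_ifs <;> linarith
        · by_cases huv : u = i ∧ v = t
          · rw [if_pos huv, huv.1, huv.2, hz i t hi]; linarith
          · rw [if_neg huv, add_zero]; exact hG.le_cap u v
        · have h1 : ∑ j, (if v = i ∧ j = t then x else 0) = if v = i then x else 0 := by
            by_cases hv : v = i <;> simp [hv]
          have h2 : ∑ j, (if j = i ∧ v = t then x else 0) = if v = t then x else 0 := by
            by_cases hv : v = t <;> simp [hv]
          rw [Finset.sum_add_distrib, Finset.sum_add_distrib, h1, h2]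
          have := hG.bal v
          linarith
        · have : ¬ (u = i ∧ v = t) := fun hc => by rw [hc.2] at hv; exact lt_irrefl _ hv
          simp only [this, if_false, add_zero]
          exact hz u v (hi.trans hv)

/-- Every edge that leaves the set of the vertices with a bottleneck value above `b t` has capacity
at most `b t`, and there are at most `n * n` of them. -/
theorem IsBottleneck.value_le {n : ℕ} {C : Fin n → Fin n → ℕ} {s t : Fin n} {b : Fin n → ℕ}
    (hC : ∀ i j, 0 < C i j → i < j) (h : IsBottleneck C s b) (hts : t ≠ s)
    {G : Fin n → Fin n → ℝ} {x : ℝ} (hG : IsMatFlow C s t G x) : x ≤ n * n * b t := by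
  classical
  set φ : Fin n → ℝ := fun v => if v = s ∨ b t < b v then 1 else 0 with hφ
  have h1 := hG.sum_mul_sub φ
  have hs : φ s = 1 := by simp [hφ]
  have ht : φ t = 0 := by simp [hφ, hts]
  rw [hs, ht] at h1
  have hterm : ∀ i j, G i j * (φ i - φ j) ≤ b t := by
    intro i j
    have hg := hG.nonneg i j
    have hb : (0 : ℝ) ≤ b t := Nat.cast_nonneg _
    by_cases hi : i = s ∨ b t < b i
    · by_cases hj : j = s ∨ b t < b j
      · simp [hφ, hi, hj]
      · simp only [hφ, hi, hj, if_true, if_false, sub_zero, mul_one]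
        refine (hG.le_cap i j).trans ?_
        have : C i j ≤ b t := by
          rcases Nat.eq_zero_or_pos (C i j) with h0 | h0
          · omega
          · push Not at hj
            have h2 := h.step_le i j (hC i j h0) hj.1
            have h3 := h.le_source i j
            rcases hi with hi | hi
            · rw [hi] at h2 h3 ⊢; omega
            · omega
        exact_mod_cast this
    · have : 0 ≤ φ j := by simp only [hφ]; split_ifs <;> norm_num
      have hi0 : φ i = 0 := by simp [hφ, hi]
      rw [hi0]; nlinarith
  have h2 := Finset.sum_le_sum fun i (_ : i ∈ Finset.univ) =>
    Finset.sum_le_sum fun j (_ : j ∈ Finset.univ) => hterm i j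
  rw [h1] at h2
  simp only [Finset.sum_const, Finset.card_univ, Fintype.card_fin, nsmul_eq_mul] at h2
  linarith

/-! ### Cancelling the remaining excess -/

/-- `f` is a preflow with excesses `ex` that receives `F` units at `s`. -/
def IsBalanced {n : ℕ} (s : Fin n) (F : ℕ) (f : Fin n → Fin n → ℕ) (ex : Fin n → ℕ) : Prop :=
  ∀ v, ex v + ∑ j, f v j = (if v = s then F else 0) + ∑ i, f i v

theorem IsBalanced.sum_ex {n : ℕ} {s : Fin n} {F : ℕ} {f : Fin n → Fin n → ℕ} {ex : Fin n → ℕ}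
    (h : IsBalanced s F f ex) : ∑ v, ex v = F := by
  have h1 : ∑ v, (ex v + ∑ j, f v j) = ∑ v, ((if v = s then F else 0) + ∑ i, f i v) :=
    Finset.sum_congr rfl fun v _ => h v
  simp only [Finset.sum_add_distrib, Finset.sum_ite_eq', Finset.mem_univ, if_true] at h1
  have h3 : ∑ v, ∑ i, f i v = ∑ v, ∑ j, f v j := Finset.sum_comm
  omega

/-- Cancelling `d` units on the edge from `u` to `v` moves excess from `v` back to `u`. -/
theorem IsBalanced.cancel {n : ℕ} {s : Fin n} {F : ℕ} {f f' : Fin n → Fin n → ℕ}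
    {ex ex' : Fin n → ℕ} (h : IsBalanced s F f ex) {u v : Fin n} {d : ℕ}
    (hf : ∀ i j, f' i j + (if i = u ∧ j = v then d else 0) = f i j)
    (hex : ∀ w, ex' w + (if w = v then d else 0) = ex w + if w = u then d else 0) :
    IsBalanced s F f' ex' := by
  intro w
  have h1 : ∑ j, (f' w j + if w = u ∧ j = v then d else 0) = ∑ j, f w j :=
    Finset.sum_congr rfl fun j _ => hf w j
  have h2 : ∑ i, (f' i w + if i = u ∧ w = v then d else 0) = ∑ i, f i w :=
    Finset.sum_congr rfl fun i _ => hf i w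
  have h3 : ∑ j, (if w = u ∧ j = v then d else 0) = if w = u then d else 0 := by
    by_cases hw : w = u <;> simp [hw]
  have h4 : ∑ i, (if i = u ∧ w = v then d else 0) = if w = v then d else 0 := by
    by_cases hw : w = v <;> simp [hw]
  rw [Finset.sum_add_distrib, h3] at h1
  rw [Finset.sum_add_distrib, h4] at h2
  have h5 := h w
  have h6 := hex w
  omega

/-! ### From matrices to the network -/

section Network

variable {n m : ℕ} (N : FlowNetwork n m) (τ : Fin n → Fin n)

/-- Edge values, added up over parallel edges; the vertices are renamed by `τ`. -/
def FlowNetwork.merge {M : Type*} [AddCommMonoid M] (h : Fin m → M) (i j : Fin n) : M :=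
  ∑ e, if τ (N.src e) = i ∧ τ (N.tgt e) = j then h e else 0

variable {N τ}

theorem FlowNetwork.sum_merge_right {M : Type*} [AddCommMonoid M] (hτ : Function.Injective τ)
    (h : Fin m → M) (v : Fin n) :
    ∑ j, N.merge τ h (τ v) j = ∑ e with N.src e = v, h e := by
  unfold FlowNetwork.merge
  rw [Finset.sum_comm, Finset.sum_filter]
  refine Finset.sum_congr rfl fun e _ => ?_
  by_cases he : N.src e = v
  · simp [he]
  · simp [he, hτ.eq_iff]

theorem FlowNetwork.sum_merge_left {M : Type*} [AddCommMonoid M] (hτ : Function.Injective τ)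
    (h : Fin m → M) (v : Fin n) :
    ∑ i, N.merge τ h i (τ v) = ∑ e with N.tgt e = v, h e := by
  unfold FlowNetwork.merge
  rw [Finset.sum_comm, Finset.sum_filter]
  refine Finset.sum_congr rfl fun e _ => ?_
  by_cases he : N.tgt e = v
  · simp [he]
  · simp [he, hτ.eq_iff]

theorem FlowNetwork.netOut_eq (hτ : Function.Injective τ) (h : Fin m → ℝ) (v : Fin n) :
    N.netOut h v = ∑ j, N.merge τ h (τ v) j - ∑ i, N.merge τ h i (τ v) := by
  rw [FlowNetwork.sum_merge_right hτ, FlowNetwork.sum_merge_left hτ]; rfl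

theorem FlowNetwork.sum_netOut (h : Fin m → ℝ) : ∑ v, N.netOut h v = 0 := by
  unfold FlowNetwork.netOut
  rw [Finset.sum_sub_distrib, Finset.sum_fiberwise, Finset.sum_fiberwise, sub_self]

theorem FlowNetwork.IsFlow.netOut_t {g : Fin m → ℝ} (hg : N.IsFlow g) (hst : N.s ≠ N.t) :
    N.netOut g N.t = - N.value g := by
  classical
  have h1 := N.sum_netOut g
  rw [← Finset.sum_subset (Finset.subset_univ {N.s, N.t}), Finset.sum_pair hst] at h1
  · unfold FlowNetwork.value; linarith
  · intro v _ hv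
    simp only [Finset.mem_insert, Finset.mem_singleton, not_or] at hv
    exact hg.conserve v hv.1 hv.2

/-- A flow of the network gives a flow of the merged capacity matrix. -/
theorem FlowNetwork.IsFlow.isMatFlow (hτ : Function.Bijective τ) {g : Fin m → ℝ}
    (hg : N.IsFlow g) (hst : N.s ≠ N.t) :
    IsMatFlow (N.merge τ N.cap) (τ N.s) (τ N.t) (N.merge τ g) (N.value g) where
  nonneg i j := Finset.sum_nonneg fun e _ => by split_ifs; exacts [hg.nonneg e, le_rfl]
  le_cap i j := by
    unfold FlowNetwork.merge
    push_cast
    refine Finset.sum_le_sum fun e _ => ?_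
    split_ifs
    exacts [hg.le_cap e, le_rfl]
  bal v := by
    obtain ⟨v, rfl⟩ := hτ.2 v
    rw [← FlowNetwork.netOut_eq hτ.1]
    simp only [hτ.1.eq_iff]
    by_cases hs : v = N.s
    · have : v ≠ N.t := fun h => hst (hs.symm.trans h)
      rw [if_pos hs, if_neg this, hs, sub_zero]; rfl
    · by_cases ht : v = N.t
      · rw [if_neg hs, if_pos ht, ht, hg.netOut_t hst, zero_sub]
      · rw [if_neg hs, if_neg ht, hg.conserve v hs ht, sub_zero]

/-- An integral flow on the matrix, distributed over parallel edges, is a flow of the network. -/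
theorem FlowNetwork.isFlow_of_balanced (hτ : Function.Bijective τ) (hst : N.s ≠ N.t) {F : ℕ}
    {f : Fin n → Fin n → ℕ} {ex : Fin n → ℕ} (hbal : IsBalanced (τ N.s) F f ex)
    (hex : ∀ v, v ≠ τ N.s → v ≠ τ N.t → ex v = 0) {o : Fin m → ℕ} (ho : ∀ e, o e ≤ N.cap e)
    (hm : ∀ i j, N.merge τ o i j = f i j) :
    N.IsFlow (fun e => (o e : ℝ)) ∧ N.value (fun e => (o e : ℝ)) = ex (τ N.t) := by
  classical
  have hmr : ∀ i j, N.merge τ (fun e => (o e : ℝ)) i j = f i j := by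
    intro i j
    rw [← hm i j]
    unfold FlowNetwork.merge
    push_cast; rfl
  have hnet : ∀ v, N.netOut (fun e => (o e : ℝ)) v = (if v = N.s then (F : ℝ) else 0) - ex (τ v) := by
    intro v
    rw [FlowNetwork.netOut_eq hτ.1]
    simp only [hmr]
    have h1 : ((ex (τ v) + ∑ j, f (τ v) j : ℕ) : ℝ) =
        ((if τ v = τ N.s then F else 0) + ∑ i, f i (τ v) : ℕ) := by rw [hbal (τ v)]
    simp only [hτ.1.eq_iff] at h1
    push_cast at h1
    linarith
  have hF : (F : ℝ) = ex (τ N.s) + ex (τ N.t) := by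
    have h1 := hbal.sum_ex
    rw [← Finset.sum_subset (Finset.subset_univ {τ N.s, τ N.t}),
      Finset.sum_pair (fun h => hst (hτ.1 h))] at h1
    · exact_mod_cast h1.symm
    · intro v _ hv
      simp only [Finset.mem_insert, Finset.mem_singleton, not_or] at hv
      exact hex v hv.1 hv.2
  refine ⟨⟨fun e => Nat.cast_nonneg _, fun e => by exact_mod_cast ho e, fun v hs ht => ?_⟩, ?_⟩
  · rw [hnet, if_neg hs, hex (τ v) (fun h => hs (hτ.1 h)) (fun h => ht (hτ.1 h))]; simp
  · unfold FlowNetwork.value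
    rw [hnet, if_pos rfl]; linarith

end Network

/-! ### The tournament tree -/

/- Registers: `rN` and `rM` hold the numbers of vertices and edges, `rS` and `rT` the positions of
the terminals, `rL` the height `16 * n`, `rInf` the largest key `16 * n * n`, `rF` the guess of the
flow value, `rD` the scale; `rV` and `rI` are auxiliary, as are `rU`, `rW`, `rG`, `rX`, `rJ` and
`rY` below.
Arrays: `aR` holds the residual matrix, row by row, `aEx`, `aLev`, `aCur` and `aHi` hold the other
components of the configuration, and `aTree` holds the tree of the keys. -/

local notation "rN" => (0 : ℕ)
local notation "rM" => (1 : ℕ)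
local notation "rS" => (4 : ℕ)
local notation "rT" => (5 : ℕ)
local notation "rL" => (8 : ℕ)
local notation "rInf" => (9 : ℕ)
local notation "rF" => (10 : ℕ)
local notation "rD" => (11 : ℕ)
local notation "rV" => (20 : ℕ)
local notation "rI" => (21 : ℕ)
local notation "aR" => (5 : Fin 16)
local notation "aEx" => (6 : Fin 16)
local notation "aLev" => (7 : Fin 16)
local notation "aCur" => (8 : Fin 16)
local notation "aHi" => (9 : Fin 16)
local notation "aTree" => (10 : Fin 16)

/-- The inner nodes of the tree hold the minima of their two children. Node `1` is the root, and the
nodes `n, …, 2 * n - 1` are the leaves. -/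
def IsTree (n : ℕ) (T : ℕ → ℕ) : Prop := ∀ j, 1 ≤ j → j < n → T j = min (T (2 * j)) (T (2 * j + 1))

theorem IsTree.root_le {n : ℕ} {T : ℕ → ℕ} (h : IsTree n T) (i : ℕ) (h1 : 1 ≤ i) (h2 : i < 2 * n) :
    T 1 ≤ T i := by
  induction i using Nat.strong_induction_on with
  | _ i ih =>
    rcases Nat.eq_or_lt_of_le h1 with h3 | h3
    · rw [h3]
    · refine (ih (i / 2) (by omega) (by omega) (by omega)).trans ?_
      rw [h (i / 2) (by omega) (by omega)]
      rcases Nat.mod_two_eq_zero_or_one i with h4 | h4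
      · have : 2 * (i / 2) = i := by omega
        rw [this]; exact min_le_left _ _
      · have : 2 * (i / 2) + 1 = i := by omega
        rw [this]; exact min_le_right _ _

theorem IsTree.exists_leaf {n : ℕ} {T : ℕ → ℕ} (h : IsTree n T) (hn : 0 < n) :
    ∃ v < n, T 1 = T (n + v) := by
  suffices H : ∀ d i, 1 ≤ i → i < 2 * n → 2 * n ≤ d + i → ∃ v < n, T i = T (n + v) from
    H (2 * n) 1 le_rfl (by omega) (by omega)
  intro d
  induction d with
  | zero => intro i _ h2 h3; omega
  | succ d ih =>
    intro i h1 h2 h3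
    rcases Nat.lt_or_ge i n with hi | hi
    · rw [h i h1 hi]
      rcases le_total (T (2 * i)) (T (2 * i + 1)) with hle | hle
      · rw [min_eq_left hle]; exact ih (2 * i) (by omega) (by omega) (by omega)
      · rw [min_eq_right hle]; exact ih (2 * i + 1) (by omega) (by omega) (by omega)
    · exact ⟨i - n, by omega, by rw [show n + (i - n) = i by omega]⟩

/-- The registers that are constant during the push-relabel algorithm. -/
structure Ctx (n S T : ℕ) (s : ASt) : Prop where
  size : s.reg rN = n
  source : s.reg rS = S
  sink : s.reg rT = T
  height : s.reg rL = 16 * n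
  inf : s.reg rInf = 16 * n * n

theorem Ctx.frame {n S T : ℕ} {s s' : ASt} {p : AProg} (h : Ctx n S T s) (hF : p.Frame s s')
    (hw : ∀ r ∈ [rN, rS, rT, rL, rInf], p.writesReg r = false) : Ctx n S T s' := by
  simp only [List.mem_cons, List.not_mem_nil, or_false, forall_eq_or_imp, forall_eq] at hw
  obtain ⟨h0, h4, h5, h8, h9⟩ := hw
  exact ⟨(hF.reg _ h0).trans h.size, (hF.reg _ h4).trans h.source, (hF.reg _ h5).trans h.sink,
    (hF.reg _ h8).trans h.height, (hF.reg _ h9).trans h.inf⟩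

/-- The key of a vertex: inactive vertices have the largest key; among the active ones, the keys are
ordered by the labels, and the vertex can be read off from the key. -/
def nodeKey (n T D : ℕ) (s : ASt) (v : ℕ) : ℕ :=
  if v ≠ T ∧ s.arr aLev v < 16 * n ∧ D < 2 * s.arr aEx v then s.arr aLev v * n + v else 16 * n * n

/-- Recompute the key of the vertex in register `rV`, and the minima on the path to the root. -/
def treeUpdate : AProg :=
  .ite (.eq (.reg rV) (.reg rT))
    (.put aTree (.reg rN + .reg rV) (.reg rInf))
    (.ite (.lt (.arr aLev (.reg rV)) (.reg rL) * .lt (.reg rD) (2 * .arr aEx (.reg rV)))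
      (.put aTree (.reg rN + .reg rV) (.arr aLev (.reg rV) * .reg rN + .reg rV))
      (.put aTree (.reg rN + .reg rV) (.reg rInf))) ;;
  .set rI (.reg rN + .reg rV) ;;
  .loop (.lt 1 (.reg rI))
    (.set rI (.reg rI / 2) ;;
     .ite (.lt (.arr aTree (2 * .reg rI + 1)) (.arr aTree (2 * .reg rI)))
      (.put aTree (.reg rI) (.arr aTree (2 * .reg rI + 1)))
      (.put aTree (.reg rI) (.arr aTree (2 * .reg rI))))

open AProg

variable {X B : ℕ}

theorem treeUpdate_spec {n S T v : ℕ} {s : ASt} (hc : Ctx n S T s) (hv : s.reg rV = v) (hvn : v < n)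
    (hB : 16 * n * n ≤ B) (hT : IsTree n (s.arr aTree)) :
    Tri X B treeUpdate s (Nat.log 2 n + 1) (fun s' => IsTree n (s'.arr aTree) ∧
      s'.arr aTree (n + v) = nodeKey n T (s.reg rD) s v ∧
      ∀ w < n, w ≠ v → s'.arr aTree (n + w) = s.arr aTree (n + w)) := by
  have hnB : 2 * n ≤ B := by nlinarith
  set key := nodeKey n T (s.reg rD) s v with hkey
  have h1 : Tri X B (.ite (.eq (.reg rV) (.reg rT))
    (.put aTree (.reg rN + .reg rV) (.reg rInf))
    (.ite (.lt (.arr aLev (.reg rV)) (.reg rL) * .lt (.reg rD) (2 * .arr aEx (.reg rV)))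
      (.put aTree (.reg rN + .reg rV) (.arr aLev (.reg rV) * .reg rN + .reg rV))
      (.put aTree (.reg rN + .reg rV) (.reg rInf)))) s 0
      (fun s' => s'.arr aTree = Function.update (s.arr aTree) (n + v) key) := by
    apply Tri.flat
    simp only [wp, AExp.val_eq, AExp.val_reg, AExp.val_mul, AExp.val_lt, AExp.val_arr,
      AExp.val_ofNat, AExp.val_add, AExp.fits_reg, AExp.fits_add, hc.size, hc.sink, hc.height, hc.inf, hv,
      true_and, forall_eq, ASt.arr_setArr, if_true]
    refine ⟨fun h => ?_, fun h => ⟨fun h' => ?_, fun h' => ?_⟩⟩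
    · have : v = T := by by_contra hne; simp [hne] at h
      rw [hkey, nodeKey, if_neg (by tauto)]
    · have h2 : v ≠ T := by rintro rfl; simp at h
      have h3 : s.arr aLev v < 16 * n ∧ s.reg rD < 2 * s.arr aEx v := by
        constructor <;> (by_contra hne; simp [hne] at h')
      refine ⟨?_, by rw [hkey, nodeKey, if_pos ⟨h2, h3⟩]⟩
      have : (s.arr aLev v + 1) * n ≤ 16 * n * n := Nat.mul_le_mul_right _ h3.1
      nlinarith
    · have : ¬ (v ≠ T ∧ s.arr aLev v < 16 * n ∧ s.reg rD < 2 * s.arr aEx v) := by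
        rintro ⟨_, h2, h3⟩; simp [h2, h3] at h'
      rw [hkey, nodeKey, if_neg this]
  refine ((h1.seq (J₂ := 0 + (Nat.log 2 n + 1) * (0 + 1)) ?_).mono (by omega) (fun _ h => h))
  intro s1 hs1 hF1
  have hc1 := hc.frame hF1 (by decide)
  have hv1 : s1.reg rV = v := by rw [hF1.reg _ (by decide), hv]
  refine Tri.seq (Q := fun s2 => s2 = s1.setReg rI (n + v)) (Tri.flat ?_) ?_
  · simp only [wp, AExp.val_add, AExp.val_reg, AExp.fits_add, hc1.size, hv1, forall_eq]
    exact ⟨by omega, trivial⟩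
  rintro s2 rfl -
  refine Tri.mono (Tri.loop (fun k s' => 1 ≤ s'.reg rI ∧ s'.reg rI < 2 * n ∧
      s'.reg rI < 2 ^ (k + 1) ∧ s'.arr aTree (n + v) = key ∧
      (∀ w < n, w ≠ v → s'.arr aTree (n + w) = s.arr aTree (n + w)) ∧
      ∀ j, 1 ≤ j → j < n → j ≠ s'.reg rI / 2 →
        s'.arr aTree j = min (s'.arr aTree (2 * j)) (s'.arr aTree (2 * j + 1))) ?_
      (k := Nat.log 2 n + 1) ?_) le_rfl ?_
  · -- all nodes except for the parent of the present node are the minima of their children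
    rintro k s' - ⟨i1, i2, i3, i4, i5, i6⟩ hb
    have hi : 1 < s'.reg rI := by
      by_contra hne; simp [hne] at hb
    have hk : 0 < k := by
      by_contra hne
      have : k = 0 := by omega
      rw [this] at i3; omega
    refine ⟨k - 1, by omega, Tri.flat ?_⟩
    set i := s'.reg rI / 2 with hi'
    have i3' : i < 2 ^ (k - 1 + 1) := by
      rw [Nat.sub_add_cancel hk]; rw [pow_succ] at i3; omega
    have key1 : ∀ T' : ℕ → ℕ, T' = Function.update (s'.arr aTree) i
        (min (s'.arr aTree (2 * i)) (s'.arr aTree (2 * i + 1))) →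
        T' (n + v) = key ∧ (∀ w < n, w ≠ v → T' (n + w) = s.arr aTree (n + w)) ∧
        ∀ j, 1 ≤ j → j < n → j ≠ i / 2 → T' j = min (T' (2 * j)) (T' (2 * j + 1)) := by
      rintro T' rfl
      refine ⟨?_, fun w hw hwv => ?_, fun j j1 j2 j3 => ?_⟩
      · rw [Function.update_of_ne (by omega), i4]
      · rw [Function.update_of_ne (by omega), i5 w hw hwv]
      · have hj1 : 2 * j ≠ i := by omega
        have hj2 : 2 * j + 1 ≠ i := by omega
        rw [Function.update_of_ne hj1, Function.update_of_ne hj2]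
        by_cases hj : j = i
        · rw [hj, Function.update_self]
        · rw [Function.update_of_ne hj, i6 j j1 j2 hj]
    simp only [wp, AExp.val_div, AExp.val_reg, AExp.val_ofNat, AExp.fits_div, AExp.fits_reg,
      AExp.val_lt, AExp.val_arr, AExp.val_add, AExp.val_mul, forall_eq, true_and, AExp.fits_arr,
      ASt.reg_setReg, ASt.arr_setReg, ASt.arr_setArr, ASt.reg_setArr, if_true, ← hi']
    refine ⟨fun h => ?_, fun h => ?_⟩
    · have : s'.arr aTree (2 * i + 1) < s'.arr aTree (2 * i) := by
        by_contra hne; simp [hne] at h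
      exact ⟨by omega, by omega, i3', key1 _ (by rw [min_eq_right this.le])⟩
    · have : ¬ s'.arr aTree (2 * i + 1) < s'.arr aTree (2 * i) := by
        intro hne; simp [hne] at h
      exact ⟨by omega, by omega, i3', key1 _ (by rw [min_eq_left (by omega)])⟩
  · have hlog : n < 2 ^ (Nat.log 2 n + 1) := Nat.lt_pow_succ_log_self (by norm_num) n
    have h2 : (2 : ℕ) ^ (Nat.log 2 n + 1 + 1) = 2 * 2 ^ (Nat.log 2 n + 1) := by rw [pow_succ']
    refine ⟨by simp; omega, by simp; omega, by simp; omega, ?_, ?_, ?_⟩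
    · simp [hs1]
    · intro w hw hwv
      simp [hs1, Function.update_of_ne, hwv]
    · intro j j1 j2 j3
      simp only [ASt.reg_setReg, if_true] at j3
      simp only [ASt.arr_setReg, hs1]
      rw [Function.update_of_ne (by omega), Function.update_of_ne (by omega),
        Function.update_of_ne (by omega)]
      exact hT j j1 j2
  · rintro s' ⟨⟨k, i1, i2, i3, i4, i5, i6⟩, hb⟩
    have hi : s'.reg rI = 1 := by
      have : ¬ 1 < s'.reg rI := by intro hne; simp [hne] at hb
      omega
    refine ⟨fun j j1 j2 => i6 j j1 j2 (by rw [hi]; omega), i4, i5⟩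

/-! ### One step of push-relabel -/

local notation "rU" => (22 : ℕ)
local notation "rW" => (23 : ℕ)
local notation "rG" => (24 : ℕ)
local notation "rX" => (25 : ℕ)

/-- The configuration that is stored in the arrays. -/
def toConfig (n : ℕ) (a : Fin 16 → ℕ → ℕ) : Config n where
  R i j := a aR (i * n + j)
  ex v := a aEx v
  lev v := a aLev v
  cur v := a aCur v
  hi v := a aHi v

theorem index_inj {n : ℕ} {i j i' j' : Fin n} :
    (i : ℕ) * n + j = i' * n + j' ↔ i = i' ∧ j = j' := by
  constructor
  · intro h
    have hj := j.2
    have hj' := j'.2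
    have h1 : (i : ℕ) = i' := by
      rcases lt_trichotomy (i : ℕ) i' with hlt | heq | hgt
      · have : ((i : ℕ) + 1) * n ≤ i' * n := Nat.mul_le_mul_right _ hlt
        rw [add_mul] at this; omega
      · exact heq
      · have : ((i' : ℕ) + 1) * n ≤ i * n := Nat.mul_le_mul_right _ hgt
        rw [add_mul] at this; omega
    exact ⟨Fin.ext h1, Fin.ext (by rw [h1] at h; omega)⟩
  · rintro ⟨rfl, rfl⟩; rfl

theorem index_lt {n i j : ℕ} (hi : i < n) (hj : j < n) : i * n + j < n * n := by
  have : (i + 1) * n ≤ n * n := Nat.mul_le_mul_right _ hi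
  rw [add_mul] at this; omega

/-- The amount that can be pushed from `rU` to `rW`. The excess of the sink is not limited. -/
def pushAmount : AProg :=
  .set rX (.arr aEx (.reg rU)) ;;
  .ite (.lt (.arr aR (.reg rU * .reg rN + .reg rW)) (.reg rX))
    (.set rX (.arr aR (.reg rU * .reg rN + .reg rW))) .skip ;;
  .ite (.eq (.reg rW) (.reg rT)) .skip
    (.ite (.lt (.reg rD - .arr aEx (.reg rW)) (.reg rX))
      (.set rX (.reg rD - .arr aEx (.reg rW))) .skip)

/-- Move `rX` units of excess from `rU` to `rW`. -/
def pushMove : AProg :=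
  .put aR (.reg rU * .reg rN + .reg rW) (.arr aR (.reg rU * .reg rN + .reg rW) - .reg rX) ;;
  .put aR (.reg rW * .reg rN + .reg rU) (.arr aR (.reg rW * .reg rN + .reg rU) + .reg rX) ;;
  .put aEx (.reg rU) (.arr aEx (.reg rU) - .reg rX) ;;
  .put aEx (.reg rW) (.arr aEx (.reg rW) + .reg rX) ;;
  .ite (.eq (.arr aR (.reg rU * .reg rN + .reg rW)) 0)
    (.put aCur (.reg rU) (.arr aCur (.reg rU) + 1)) .skip

theorem ite_one_ne_zero {p : Prop} [Decidable p] : (if p then 1 else 0 : ℕ) ≠ 0 ↔ p := by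
  by_cases h : p <;> simp [h]

theorem ite_one_eq_zero {p : Prop} [Decidable p] : (if p then 1 else 0 : ℕ) = 0 ↔ ¬ p := by
  by_cases h : p <;> simp [h]

theorem pushAmount_spec {n S T D : ℕ} {s : ASt} {u w : Fin n} (hc : Ctx n S T s)
    (hu : s.reg rU = u) (hw : s.reg rW = w) (hD : s.reg rD = D) :
    Tri X B pushAmount s 0 (fun s' =>
      ((s'.reg rX = min ((toConfig n s.arr).ex u) ((toConfig n s.arr).R u w) ∧ (w : ℕ) = T) ∨
        (s'.reg rX = min (min ((toConfig n s.arr).ex u) ((toConfig n s.arr).R u w))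
          (D - (toConfig n s.arr).ex w) ∧ (w : ℕ) ≠ T))) := by
  apply Tri.flat
  simp [pushAmount, wp, hu, hw, hc.size, hc.sink, hD, toConfig]
  omega

theorem pushMove_spec {n S T : ℕ} {s : ASt} {u w : Fin n} (hc : Ctx n S T s)
    (hu : s.reg rU = u) (hw : s.reg rW = w) (huw : u ≠ w)
    (hd : s.reg rX ≤ (toConfig n s.arr).ex u) (hd' : s.reg rX ≤ (toConfig n s.arr).R u w)
    (hR : (toConfig n s.arr).R w u + (toConfig n s.arr).R u w ≤ B)
    (hex : (toConfig n s.arr).ex w + (toConfig n s.arr).ex u ≤ B)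
    (hcur : (toConfig n s.arr).cur u < n) (hn : n ≤ B) :
    Tri X B pushMove s 0 (fun s' => IsPush (toConfig n s.arr) (toConfig n s'.arr) u w (s.reg rX)) := by
  have huw' : (u : ℕ) ≠ w := fun h => huw (Fin.ext h)
  have hidx : (w : ℕ) * n + u ≠ u * n + w := fun h => huw (index_inj.1 h).2
  simp only [toConfig] at hR hex hcur hd hd'
  apply Tri.flat
  simp [pushMove, wp, hu, hw, hc.size, huw'.symm, hidx, hidx.symm]
  have hcom : ∀ i j : Fin n, i = w ∧ j = u → ¬ (i = u ∧ j = w) := fun i j h h' =>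
    huw (h'.1.symm.trans h.1)
  refine ⟨by omega, by omega, fun h => ⟨by omega, ?_⟩, fun h => ?_⟩
  all_goals
    refine ⟨fun i j => ?_, fun i => ?_, rfl, rfl, fun i => ?_⟩
    · simp only [toConfig, ASt.arr_setArr, Function.update_apply, index_inj, Fin.reduceEq, if_false,
        if_true]
      have := hcom i j
      by_cases h1 : i = u ∧ j = w
      · have h2 : ¬ (i = w ∧ j = u) := fun h2 => hcom i j h2 h1
        obtain ⟨rfl, rfl⟩ := h1
        simp only [h2, and_self, if_false, if_true]; omega
      · by_cases h2 : i = w ∧ j = u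
        · obtain ⟨rfl, rfl⟩ := h2
          simp only [h1, and_self, if_false, if_true]; omega
        · simp only [h1, h2, if_false]
    · simp only [toConfig, ASt.arr_setArr, Function.update_apply, Fin.val_inj, Fin.reduceEq, if_false,
        if_true]
      by_cases h1 : i = u
      · subst h1; simp only [huw, if_false, if_true]; omega
      · by_cases h2 : i = w
        · subst h2; simp only [h1, if_false, if_true]; omega
        · simp only [h1, h2, if_false]
    · simp only [toConfig, ASt.arr_setArr, Function.update_apply, Fin.val_inj, Fin.reduceEq, if_false,
        if_true, index_inj, huw, false_and, and_self, h, and_true, and_false]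

/-- Raise the label of `rU` by one, and open the window for the new label. -/
def relabelVertex : AProg :=
  .put aLev (.reg rU) (.arr aLev (.reg rU) + 1) ;;
  .set rG 1 ;;
  .loop (.lt (.reg rG) (.reg rN) * .eq (.arr aLev (.reg rU) % (2 * .reg rG)) 0)
    (.set rG (2 * .reg rG)) ;;
  .put aCur (.reg rU) (.reg rU - .reg rG) ;;
  .put aHi (.reg rU) (.reg rU + .reg rG + 1) ;;
  .ite (.lt (.reg rN) (.arr aHi (.reg rU))) (.put aHi (.reg rU) (.reg rN)) .skip

theorem relabelVertex_spec {n S T : ℕ} {s : ASt} {u : Fin n} (hc : Ctx n S T s)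
    (hu : s.reg rU = u) (hL : (toConfig n s.arr).lev u < 16 * n) (hB : 16 * n * n ≤ B) :
    Tri X B relabelVertex s (Nat.log 2 n + 1) (fun s' => ∃ j ≤ Nat.log 2 n + 1,
      IsRelabel (toConfig n s.arr) (toConfig n s'.arr) u (2 ^ j) ∧
      2 ^ j ∣ (toConfig n s.arr).lev u + 1 ∧
      (n ≤ 2 ^ j ∨ ¬ 2 * 2 ^ j ∣ (toConfig n s.arr).lev u + 1)) := by
  have hn : 0 < n := u.pos
  have hun := u.2
  have hnB : 16 * n ≤ B := le_trans (Nat.le_mul_of_pos_right _ hn) hB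
  simp only [toConfig] at hL
  set l := s.arr aLev u + 1 with hl
  refine Tri.mono (Tri.seq (J₁ := 0) (Q := fun s' => s' = s.setArr aLev u l) (Tri.flat ?_) ?_)
    (Nat.zero_add _).le fun _ h => h
  · simp only [wp, AExp.fits_add, AExp.val_arr, AExp.val_reg, AExp.val_add, AExp.val_ofNat, hu,
      forall_eq]
    exact ⟨by omega, rfl⟩
  rintro s1 rfl -
  refine Tri.mono (Tri.seq (J₁ := 0) (Q := fun s' => s' = (s.setArr aLev u l).setReg rG 1)
    (Tri.flat ?_) ?_) (Nat.zero_add _).le fun _ h => h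
  · simp [wp]; omega
  rintro s2 rfl -
  refine Tri.mono (Tri.seq (J₂ := 0) (Tri.loop (t := 0) (k := Nat.log 2 n + 1) (fun k s' => ∃ j,
    j + k = Nat.log 2 n + 1 ∧ s'.reg rG = 2 ^ j ∧ 2 ^ j ∣ l) ?_ ⟨0, by simp⟩) ?_)
    (by omega) fun _ h => h
  · rintro k s' hF ⟨j, hjk, hg, hdvd⟩ hb
    have hN : s'.reg rN = n := by rw [hF.reg _ (by decide)]; simpa using hc.size
    have hl' : s'.arr aLev (s'.reg rU) = l := by
      rw [hF.arr _ (by decide), hF.reg _ (by decide)]; simp [hu]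
    simp [hN, hl', hg] at hb
    obtain ⟨hb2, hb1⟩ := hb
    have hj : j ≤ Nat.log 2 n := (Nat.le_log_iff_pow_le (by norm_num) (by omega)).2 hb1.le
    refine ⟨k - 1, by omega, Tri.flat ?_⟩
    simp only [wp, AExp.fits_mul, AExp.val_ofNat, AExp.val_reg, AExp.val_mul, hg, forall_eq]
    refine ⟨by omega, j + 1, by omega, by simp [pow_succ'], ?_⟩
    rw [pow_succ']
    omega
  · rintro s3 ⟨⟨k, j, hjk, hg, hdvd⟩, hb⟩ hF
    have hN : s3.reg rN = n := by rw [hF.reg _ (by decide)]; simpa using hc.size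
    have hU : s3.reg rU = u := by rw [hF.reg _ (by decide)]; simpa using hu
    have ha : s3.arr = (s.setArr aLev u l).arr := by
      funext k; rw [hF.arr _ (by revert k; decide)]; rfl
    have hj : 2 ^ j ≤ 2 * n := by
      calc 2 ^ j ≤ 2 ^ (Nat.log 2 n + 1) := Nat.pow_le_pow_right (by norm_num) (by omega)
        _ ≤ 2 * n := by
          rw [pow_succ']
          exact Nat.mul_le_mul_left _ (Nat.pow_log_le_self 2 hn.ne')
    have hmax : n ≤ 2 ^ j ∨ ¬ 2 * 2 ^ j ∣ l := by
      simp [hN, hU, ha, hg] at hb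
      by_cases h : 2 * 2 ^ j ∣ l
      · exact Or.inl (hb (Nat.mod_eq_zero_of_dvd h))
      · exact Or.inr h
    have hrel : ∀ a : Fin 16 → ℕ → ℕ, a aR = s.arr aR → a aEx = s.arr aEx →
        a aLev = Function.update (s.arr aLev) u l →
        a aHi = Function.update (s.arr aHi) u (min n (u + 2 ^ j + 1)) →
        a aCur = Function.update (s.arr aCur) u (u - 2 ^ j) →
        ∃ j ≤ Nat.log 2 n + 1, IsRelabel (toConfig n s.arr) (toConfig n a) u (2 ^ j) ∧
          2 ^ j ∣ (toConfig n s.arr).lev u + 1 ∧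
          (n ≤ 2 ^ j ∨ ¬ 2 * 2 ^ j ∣ (toConfig n s.arr).lev u + 1) := by
      intro a h5 h6 h7 h9 h8
      refine ⟨j, by omega, ⟨?_, ?_, fun w => ?_, fun w => ?_, fun w => ?_⟩, hdvd, hmax⟩
      · simp only [toConfig, h5]
      · simp only [toConfig, h6]
      · simp only [toConfig, h7, Function.update_apply, Fin.val_inj, hl]
      · simp only [toConfig, h9, Function.update_apply, Fin.val_inj]
      · simp only [toConfig, h8, Function.update_apply, Fin.val_inj]
    apply Tri.flat
    simp only [wp, AExp.fits_sub, AExp.fits_reg, AExp.val_reg, AExp.val_sub, AExp.fits_add,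
      AExp.val_add, AExp.val_ofNat, forall_eq, true_and, ASt.reg_setArr, AExp.val_lt, AExp.val_arr,
      hN, hU, hg, ite_one_ne_zero, ite_one_eq_zero]
    refine ⟨by omega, fun h => ?_, fun h => ?_⟩
    · simp only [ASt.arr_setArr, if_true, Function.update_self] at h
      apply hrel <;> simp [ha]
      congr 1; omega
    · simp only [ASt.arr_setArr, if_true, Function.update_self] at h
      apply hrel <;> simp [ha]
      congr 1; omega

local notation "rJ" => (26 : ℕ)

/-! ### Phases -/

/-- The invariant of the push-relabel algorithm. -/
structure IsPRState {n : ℕ} (C : Fin n → Fin n → ℕ) (S T : Fin n) (F D : ℕ) (s : ASt) : Prop where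
  ctx : Ctx n S T s
  scale : s.reg rD = D
  preflow : IsPreflow C S F (toConfig n s.arr).R (toConfig n s.arr).ex
  labelled : IsLabelled T (16 * n) (toConfig n s.arr)
  capped : (toConfig n s.arr).Capped T (16 * n) D
  pos : 0 < F → 0 < D

/-- Scan the next edge out of the vertex `rU`, or relabel it if the window has been scanned.
Afterwards `rW` is the only vertex other than `rU` whose excess may have changed. -/
def scanVertex : AProg :=
  .ite (.lt (.arr aCur (.reg rU)) (.arr aHi (.reg rU)))
    (.set rW (.arr aCur (.reg rU)) ;;
     .ite (.lt 0 (.arr aR (.reg rU * .reg rN + .reg rW)) *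
        .lt (.arr aLev (.reg rW)) (.arr aLev (.reg rU)))
      (pushAmount ;; pushMove)
      (.put aCur (.reg rU) (.arr aCur (.reg rU) + 1)))
    (.set rW (.reg rU) ;; relabelVertex)

theorem scanVertex_spec {n F D : ℕ} {C : Fin n → Fin n → ℕ} {S T u : Fin n} {s : ASt}
    (h : IsPRState C S T F D s) (hu : s.reg rU = u)
    (hact : (toConfig n s.arr).Active T (16 * n) D u)
    (hmin : ∀ w, (toConfig n s.arr).Active T (16 * n) D w →
      (toConfig n s.arr).lev u ≤ (toConfig n s.arr).lev w)
    (hB : 16 * n * n ≤ B) (hF : 2 * F ≤ B) (hC : ∀ i j, C i j + C j i ≤ B) :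
    Tri X B scanVertex s (Nat.log 2 n + 1) (fun s' => ∃ w : Fin n, s'.reg rU = u ∧ s'.reg rW = w ∧
      IsPRState C S T F D s' ∧
      (toConfig n s'.arr).potential (16 * n) (Nat.log 2 n + 1) D + D ≤
        (toConfig n s.arr).potential (16 * n) (Nat.log 2 n + 1) D ∧
      ∀ v, v ≠ u → v ≠ w → (toConfig n s'.arr).lev v = (toConfig n s.arr).lev v ∧
        (toConfig n s'.arr).ex v = (toConfig n s.arr).ex v) := by
  have hn : 0 < n := u.pos
  have hnB : 16 * n ≤ B := le_trans (Nat.le_mul_of_pos_right _ hn) hB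
  set c := toConfig n s.arr with hcdef
  have hpos := h.pos
  refine Tri.ite (fun hb => ?_) (fun hb => ?_)
  · simp only [AExp.val_lt, AExp.val_arr, AExp.val_reg, hu, ite_one_ne_zero] at hb
    have hb' : c.cur u < c.hi u := hb
    have hcn : c.cur u < n := lt_of_lt_of_le hb' (h.labelled.hi_le u)
    set w : Fin n := ⟨c.cur u, hcn⟩ with hwdef
    have hcw : c.cur u = w := rfl
    refine Tri.mono (Tri.seq (J₁ := 0) (J₂ := 0) (Q := fun s' => s' = s.setReg rW w) (Tri.flat ?_) ?_)
      (by omega) fun _ h => h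
    · simp only [wp, AExp.fits_arr, AExp.val_arr, AExp.val_reg, hu, forall_eq, true_and]
      exact congrArg _ hcw
    rintro s1 rfl -
    have hu1 : (s.setReg rW w).reg rU = u := by simpa using hu
    have hw1 : (s.setReg rW w).reg rW = w := by simp
    have hc1 : Ctx n S T (s.setReg rW w) := ⟨by simpa using h.ctx.size, by simpa using h.ctx.source,
      by simpa using h.ctx.sink, by simpa using h.ctx.height, by simpa using h.ctx.inf⟩
    have hD1 : (s.setReg rW w).reg rD = D := by simpa using h.scale
    refine Tri.ite (fun hb => ?_) (fun hb => ?_)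
    · have hb2 : 0 < c.R u w ∧ c.lev w < c.lev u := by
        simpa [hu, h.ctx.size, hcdef, toConfig, and_comm, Nat.pos_iff_ne_zero] using hb
      have huw : u ≠ w := by
        intro he; rw [← he] at hb2; omega
      refine Tri.mono (Tri.seq (J₂ := 0) (pushAmount_spec hc1 hu1 hw1 hD1) ?_)
        le_rfl fun _ h => h
      intro s2 hs2 hF2
      have ha : s2.arr = s.arr := by
        funext k; rw [hF2.arr _ (by revert k; decide)]; rfl
      simp only [ASt.arr_setReg, ← hcdef, Fin.val_inj] at hs2
      set d := s2.reg rX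
      have hle : d ≤ c.ex u ∧ d ≤ c.R u w ∧ (w ≠ T → d ≤ D - c.ex w) := by
        rcases hs2 with ⟨h1, h2⟩ | ⟨h1, h2⟩
        · exact ⟨by omega, by omega, fun h3 => absurd h2 h3⟩
        · exact ⟨by omega, by omega, fun _ => by omega⟩
      have hRle : c.R w u + c.R u w ≤ B := by rw [h.preflow.pair]; exact hC w u
      have hexle : c.ex w + c.ex u ≤ B := by
        have h1 := h.preflow.ex_le w
        have h2 := h.preflow.ex_le u
        simp only [← hcdef] at h1 h2
        omega
      refine Tri.mono (pushMove_spec (hc1.frame hF2 (by decide))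
        ((hF2.reg _ (by decide)).trans hu1) ((hF2.reg _ (by decide)).trans hw1) huw
        (by rw [ha]; exact hle.1) (by rw [ha]; exact hle.2.1) (by rw [ha]; exact hRle)
        (by rw [ha]; exact hexle) (by rw [ha]; exact hcn) (by omega)).framed (Nat.zero_le _) ?_
      rintro s3 ⟨hp, hF3⟩
      rw [ha] at hp
      change IsPush c _ u w d at hp
      refine ⟨w, (hF3.reg _ (by decide)).trans ((hF2.reg _ (by decide)).trans hu1),
        (hF3.reg _ (by decide)).trans ((hF2.reg _ (by decide)).trans hw1),
        ⟨(hc1.frame hF2 (by decide)).frame hF3 (by decide),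
        (hF3.reg _ (by decide)).trans ((hF2.reg _ (by decide)).trans hD1),
        h.preflow.push hp.R hp.ex, h.labelled.push hp hb2.2 hcw, fun v hv hvL => ?_, hpos⟩,
        hp.potential hb2.2 hact.2.1 hcw (lt_of_eq_of_lt hcw.symm hb')
          (push_amount hact hmin hb2.2 (by simpa only [ne_eq, Fin.val_inj] using hs2)), fun v hvu hvw => ?_⟩
      · have h1 := hp.ex v
        have h2 := h.capped v hv (by rw [hp.lev] at hvL; exact hvL)
        simp only [← hcdef] at h2
        by_cases hvw : v = w
        · rw [hvw] at h1 h2 hv ⊢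
          have := hle.2.2 hv
          rw [if_neg (Ne.symm huw), if_pos rfl] at h1
          omega
        · rw [if_neg hvw] at h1
          omega
      · have h1 := hp.ex v
        rw [if_neg hvu, if_neg hvw] at h1
        exact ⟨by rw [hp.lev], by omega⟩
    · have hb2 : c.R u w = 0 ∨ c.lev u ≤ c.lev w := by
        simp [hu, h.ctx.size] at hb
        by_cases h0 : c.lev w < c.lev u
        · exact Or.inl (hb h0)
        · exact Or.inr (by omega)
      apply Tri.flat
      simp only [wp, AExp.fits_add, AExp.val_arr, AExp.val_reg, AExp.val_ofNat, AExp.val_add, hu1,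
        ASt.arr_setReg, forall_eq]
      refine ⟨by have := hcw; have := w.2; simp only [hcdef, toConfig] at hcn; omega, w, ?_⟩
      have hp : IsSkip c (toConfig n ((s.setReg rW w).setArr aCur u (c.cur u + 1)).arr) u w := by
        refine ⟨rfl, rfl, rfl, rfl, fun v => ?_⟩
        simp only [toConfig, ASt.arr_setArr, if_true, Function.update_apply, Fin.val_inj, hcdef,
          ASt.arr_setReg]
      refine ⟨hu1, hw1, ⟨⟨hc1.size, hc1.source, hc1.sink, hc1.height, hc1.inf⟩, hD1, h.preflow,
        h.labelled.skip hp hb2 hcw, h.capped, hpos⟩, hp.potential hb', fun v _ _ => ⟨rfl, rfl⟩⟩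
  · simp only [AExp.val_lt, AExp.val_arr, AExp.val_reg, hu, ite_one_eq_zero, not_lt] at hb
    have hb' : c.hi u ≤ c.cur u := hb
    refine Tri.mono (Tri.seq (J₁ := 0) (Q := fun s' => s' = s.setReg rW u) (Tri.flat ?_) ?_)
      (Nat.zero_add _).le fun _ h => h
    · simp only [wp, AExp.fits_reg, AExp.val_reg, hu, forall_eq, true_and]
    rintro s1 rfl -
    have hu1 : (s.setReg rW u).reg rU = u := by simpa using hu
    have hc1 : Ctx n S T (s.setReg rW u) := ⟨by simpa using h.ctx.size, by simpa using h.ctx.source,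
      by simpa using h.ctx.sink, by simpa using h.ctx.height, by simpa using h.ctx.inf⟩
    refine Tri.mono (relabelVertex_spec hc1 hu1 hact.2.1 hB).framed le_rfl ?_
    rintro s2 ⟨⟨j, hj, hp, hdvd, hmax⟩, hF2⟩
    change IsRelabel c _ u _ at hp
    refine ⟨u, (hF2.reg _ (by decide)).trans hu1, (hF2.reg _ (by decide)).trans (by simp),
      ⟨hc1.frame hF2 (by decide), (hF2.reg _ (by decide)).trans (by simpa using h.scale), ?_,
      h.labelled.relabel hp hact.1 hact.2.1 hb' rfl hmax, ?_, hpos⟩,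
      hp.potential hact.2.1 (h.capped u hact.1 hact.2.1) rfl hj hdvd, fun v hv _ => ?_⟩
    · rw [hp.R, hp.ex]; exact h.preflow
    · intro v hv hvL
      rw [hp.ex]
      refine h.capped v hv ?_
      rw [hp.lev] at hvL
      split_ifs at hvL with hvu
      · rw [hvu]; exact hact.2.1
      · exact hvL
    · exact ⟨by rw [hp.lev, if_neg hv], by rw [hp.ex]⟩

/-- One step: select an active vertex of least label, scan it, and repair the tree. -/
def relaxStep : AProg :=
  .set rU (.arr aTree 1 % .reg rN) ;; scanVertex ;;
  .set rV (.reg rU) ;; treeUpdate ;; .set rV (.reg rW) ;; treeUpdate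

/-- The tree is up to date. -/
structure TreeReady (n T D : ℕ) (s : ASt) : Prop where
  tree : IsTree n (s.arr aTree)
  leaf : ∀ v < n, s.arr aTree (n + v) = nodeKey n T D s v

/-- If the root is smaller than the largest key, it encodes an active vertex of least label. -/
theorem TreeReady.exists_active {n D : ℕ} {T : Fin n} {s : ASt} (h : TreeReady n T D s)
    (hlt : s.arr aTree 1 < 16 * n * n) : ∃ u : Fin n, s.arr aTree 1 % n = u ∧
      (toConfig n s.arr).Active T (16 * n) D u ∧ ∀ w, (toConfig n s.arr).Active T (16 * n) D w →
      (toConfig n s.arr).lev u ≤ (toConfig n s.arr).lev w := by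
  have hkey : ∀ v : Fin n, (toConfig n s.arr).Active T (16 * n) D v →
      s.arr aTree (n + v) = s.arr aLev v * n + v := by
    rintro v ⟨h1, h2, h3⟩
    rw [h.leaf v v.2, nodeKey, if_pos ⟨fun he => h1 (Fin.ext he), h2, h3⟩]
  obtain ⟨v, hv, he⟩ := h.tree.exists_leaf T.pos
  have hact : (toConfig n s.arr).Active T (16 * n) D ⟨v, hv⟩ := by
    rw [he, h.leaf v hv, nodeKey] at hlt
    split_ifs at hlt with hc
    · exact ⟨fun hvT => hc.1 (congrArg Fin.val hvT), hc.2⟩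
    · omega
  rw [he, hkey ⟨v, hv⟩ hact]
  refine ⟨⟨v, hv⟩, by simp [Nat.mod_eq_of_lt hv], hact, fun w hw => ?_⟩
  have h1 := h.tree.root_le (n + w) (by have := w.2; omega) (by have := w.2; omega)
  rw [he, hkey ⟨v, hv⟩ hact, hkey w hw] at h1
  by_contra hc
  have h2 : ((toConfig n s.arr).lev w + 1) * n ≤ (toConfig n s.arr).lev ⟨v, hv⟩ * n :=
    Nat.mul_le_mul_right _ (by omega)
  rw [add_mul] at h2
  have h3 := w.2
  simp only [toConfig] at h1 h2
  omega

theorem nodeKey_congr {n T D v : ℕ} {s s' : ASt} (h1 : s'.arr aLev v = s.arr aLev v)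
    (h2 : s'.arr aEx v = s.arr aEx v) : nodeKey n T D s' v = nodeKey n T D s v := by
  unfold nodeKey; rw [h1, h2]

theorem IsPRState.congr {n F D : ℕ} {C : Fin n → Fin n → ℕ} {S T : Fin n} {s s' : ASt}
    (h : IsPRState C S T F D s) (hc : Ctx n S T s') (hD : s'.reg rD = s.reg rD)
    (hcfg : toConfig n s'.arr = toConfig n s.arr) : IsPRState C S T F D s' :=
  ⟨hc, hD.trans h.scale, hcfg ▸ h.preflow, hcfg ▸ h.labelled, hcfg ▸ h.capped, h.pos⟩

theorem toConfig_eq {n : ℕ} {a a' : Fin 16 → ℕ → ℕ} (h : ∀ k ∈ [aR, aEx, aLev, aCur, aHi], a' k = a k) :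
    toConfig n a' = toConfig n a := by
  simp only [List.mem_cons, List.not_mem_nil, or_false, forall_eq_or_imp, forall_eq] at h
  simp only [toConfig, h]

theorem relaxStep_spec {n F D : ℕ} {C : Fin n → Fin n → ℕ} {S T : Fin n} {s : ASt}
    (h : IsPRState C S T F D s) (ht : TreeReady n T D s) (hlt : s.arr aTree 1 < 16 * n * n)
    (hB : 16 * n * n ≤ B) (hF : 2 * F ≤ B) (hC : ∀ i j, C i j + C j i ≤ B) :
    Tri X B relaxStep s (3 * (Nat.log 2 n + 1)) (fun s' => IsPRState C S T F D s' ∧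
      TreeReady n T D s' ∧ (toConfig n s'.arr).potential (16 * n) (Nat.log 2 n + 1) D + D ≤
        (toConfig n s.arr).potential (16 * n) (Nat.log 2 n + 1) D) := by
  obtain ⟨u, hu, hact, hmin⟩ := ht.exists_active hlt
  refine Tri.mono (Tri.seq (J₁ := 0) (Q := fun s' => s' = s.setReg rU u) (Tri.flat ?_) ?_)
    (Nat.zero_add _).le fun _ h => h
  · simp only [wp, AExp.fits_mod, AExp.fits_arr, AExp.val_mod, AExp.val_arr, AExp.val_ofNat,
      AExp.val_reg, h.ctx.size, hu, forall_eq, true_and]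
  rintro s1 rfl -
  have h1 : IsPRState C S T F D (s.setReg rU u) := h.congr ⟨by simpa using h.ctx.size,
    by simpa using h.ctx.source, by simpa using h.ctx.sink, by simpa using h.ctx.height,
    by simpa using h.ctx.inf⟩ (by simp) rfl
  refine Tri.mono (Tri.seq (J₂ := 2 * (Nat.log 2 n + 1))
    (scanVertex_spec h1 (by simp) hact hmin hB hF hC) ?_) (by omega) fun _ h => h
  rintro s2 ⟨w, hu2, hw2, h2, hpot, hsame⟩ hF2
  have htree2 : s2.arr aTree = s.arr aTree := hF2.arr _ (by decide)
  refine Tri.mono (Tri.seq (J₁ := 0) (Q := fun s' => s' = s2.setReg rV u) (Tri.flat ?_) ?_)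
    (Nat.zero_add _).le fun _ h => h
  · simp only [wp, AExp.fits_reg, AExp.val_reg, hu2, forall_eq, true_and]
  rintro s3 rfl -
  have hc3 : Ctx n S T (s2.setReg rV u) := ⟨by simpa using h2.ctx.size,
    by simpa using h2.ctx.source, by simpa using h2.ctx.sink, by simpa using h2.ctx.height,
    by simpa using h2.ctx.inf⟩
  refine Tri.mono (Tri.seq (J₂ := Nat.log 2 n + 1)
    (treeUpdate_spec hc3 (by simp) u.2 hB (by rw [ASt.arr_setReg, htree2]; exact ht.tree)) ?_)
    (by omega) fun _ h => h
  rintro s4 ⟨ht4, hku, hk4⟩ hF4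
  have hw4 : s4.reg rW = w := by rw [hF4.reg _ (by decide)]; simpa using hw2
  refine Tri.mono (Tri.seq (J₁ := 0) (Q := fun s' => s' = s4.setReg rV w) (Tri.flat ?_) ?_)
    (Nat.zero_add _).le fun _ h => h
  · simp only [wp, AExp.fits_reg, AExp.val_reg, hw4, forall_eq, true_and]
  rintro s5 rfl -
  have hc4 := hc3.frame hF4 (by decide)
  have hc5 : Ctx n S T (s4.setReg rV w) := ⟨by simpa using hc4.size,
    by simpa using hc4.source, by simpa using hc4.sink, by simpa using hc4.height,
    by simpa using hc4.inf⟩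
  refine Tri.mono (treeUpdate_spec hc5 (by simp) w.2 hB ht4).framed le_rfl ?_
  rintro s6 ⟨⟨ht6, hkw, hk6⟩, hF6⟩
  have ha4 : ∀ k, k ≠ aTree → s4.arr k = s2.arr k := fun k hk =>
    (hF4.arr k (by revert k; decide)).trans rfl
  have ha6 : ∀ k, k ≠ aTree → s6.arr k = s2.arr k := fun k hk =>
    (hF6.arr k (by revert k; decide)).trans (ha4 k hk)
  have hD4 : s4.reg rD = D := by rw [hF4.reg _ (by decide)]; simpa using h2.scale
  have hD6 : s6.reg rD = D := by rw [hF6.reg _ (by decide)]; simpa using hD4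
  have hcfg : toConfig n s6.arr = toConfig n s2.arr := toConfig_eq fun k hk => ha6 k (by
    rintro rfl; simp at hk)
  refine ⟨h2.congr (hc5.frame hF6 (by decide)) (hD6.trans h2.scale.symm) hcfg, ⟨ht6, ?_⟩,
    by rw [hcfg]; exact hpot⟩
  intro v hv
  have hkey : ∀ s' : ASt, (∀ k, k ≠ aTree → s'.arr k = s2.arr k) →
      nodeKey n T D s' v = nodeKey n T D s2 v := fun s' hs' =>
    nodeKey_congr (by rw [hs' _ (by decide)]) (by rw [hs' _ (by decide)])
  rw [hkey s6 ha6]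
  by_cases hvw : v = w
  · rw [hvw, hkw, ASt.reg_setReg, if_neg (by decide), hD4, ← hvw]
    exact hkey _ ha4
  · rw [hk6 v hv hvw]
    by_cases hvu : v = u
    · rw [ASt.arr_setReg, hvu, hku, ASt.reg_setReg, if_neg (by decide), h2.scale]
      rfl
    · rw [ASt.arr_setReg, hk4 v hv hvu, ASt.arr_setReg, htree2, ht.leaf v hv]
      have := hsame ⟨v, hv⟩ (fun he => hvu (congrArg Fin.val he)) fun he => hvw (congrArg Fin.val he)
      exact (nodeKey_congr this.1 this.2).symm

/-- A phase: build the tree, then relax until no vertex is active. -/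
def phase : AProg :=
  forUp rJ rN (.set rV (.reg rJ) ;; treeUpdate) ;;
  .loop (.lt (.arr aTree 1) (.reg rInf)) relaxStep

/-- A bound for the number of steps in a phase: the potential at its beginning, divided by `D`. -/
def phaseSteps (n : ℕ) : ℕ :=
  2 * n * (16 * n) + 3 * n * (n + 2 * (Nat.log 2 n + 1 + 2) * (16 * n))

theorem phase_spec {n F D : ℕ} {C : Fin n → Fin n → ℕ} {S T : Fin n} {s : ASt}
    (h : IsPRState C S T F D s) (ht : IsTree n (s.arr aTree))
    (hB : 16 * n * n ≤ B) (hF : 2 * F ≤ B) (hC : ∀ i j, C i j + C j i ≤ B) :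
    Tri X B phase s (n * (Nat.log 2 n + 2) + phaseSteps n * (3 * (Nat.log 2 n + 1) + 1))
      (fun s' => IsPRState C S T F D s' ∧ IsTree n (s'.arr aTree) ∧
        ∀ v, v ≠ T → (toConfig n s'.arr).lev v < 16 * n → 2 * (toConfig n s'.arr).ex v ≤ D) := by
  have hn : 0 < n := S.pos
  have hnB : 16 * n ≤ B := le_trans (Nat.le_mul_of_pos_right _ hn) hB
  refine Tri.mono (Tri.seq (Tri.forUp (N := n) (t := Nat.log 2 n + 1)
    (fun i s' => IsTree n (s'.arr aTree) ∧ ∀ v < i, s'.arr aTree (n + v) = nodeKey n T D s v)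
    h.ctx.size (by omega) (by decide) (by decide) (by decide) ⟨ht, fun v hv => absurd hv (by omega)⟩
    ?_) ?_) le_rfl fun _ h => h
  · rintro i s1 hi hF1 hJ1 ⟨ht1, hk1⟩
    refine Tri.mono (Tri.seq (J₁ := 0) (Q := fun s' => s' = s1.setReg rV i) (Tri.flat ?_) ?_)
      (Nat.zero_add _).le fun _ h => h
    · simp only [wp, AExp.fits_reg, AExp.val_reg, hJ1, forall_eq, true_and]
    rintro s2 rfl -
    have hc1 := h.ctx.frame hF1 (by decide)
    have hc2 : Ctx n S T (s1.setReg rV i) := ⟨by simpa using hc1.size, by simpa using hc1.source,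
      by simpa using hc1.sink, by simpa using hc1.height, by simpa using hc1.inf⟩
    refine Tri.mono (treeUpdate_spec hc2 (by simp) hi hB ht1) le_rfl ?_
    rintro s3 ⟨ht3, hk3, hk3'⟩ -
    refine ⟨ht3, fun v hv => ?_⟩
    rw [ASt.arr_setReg]
    by_cases hvi : v = i
    · rw [hvi, hk3, ASt.reg_setReg, if_neg (by decide), hF1.reg _ (by decide), h.scale]
      exact nodeKey_congr (by rw [ASt.arr_setReg, hF1.arr _ (by decide)])
        (by rw [ASt.arr_setReg, hF1.arr _ (by decide)])
    · rw [hk3' v (by omega) hvi]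
      exact hk1 v (by omega)
  rintro s1 ⟨ht1, hk1⟩ hF1
  have ha1 : ∀ k, k ≠ aTree → s1.arr k = s.arr k := fun k hk => hF1.arr k (by revert k; decide)
  have h1 : IsPRState C S T F D s1 := h.congr (h.ctx.frame hF1 (by decide)) (hF1.reg _ (by decide))
    (toConfig_eq fun k hk => ha1 k (by rintro rfl; simp at hk))
  have hr1 : TreeReady n T D s1 := ⟨ht1, fun v hv => (hk1 v hv).trans
    (nodeKey_congr (by rw [ha1 _ (by decide)]) (by rw [ha1 _ (by decide)])).symm⟩
  refine Tri.mono (Tri.loop (t := 3 * (Nat.log 2 n + 1)) (fun k s' => IsPRState C S T F D s' ∧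
    TreeReady n T D s' ∧
    (toConfig n s'.arr).potential (16 * n) (Nat.log 2 n + 1) D ≤ k * D) ?_ (k := phaseSteps n)
    ⟨h1, hr1, potential_le h1.labelled h1.capped⟩) le_rfl ?_
  · rintro k s2 - ⟨h2, hr2, hp2⟩ hb
    simp only [AExp.val_lt, AExp.val_arr, AExp.val_ofNat, AExp.val_reg, h2.ctx.inf,
      ite_one_ne_zero] at hb
    have hD : 0 < D := by
      obtain ⟨u, -, hact, -⟩ := hr2.exists_active hb
      have := h2.preflow.ex_le u
      have := hact.2.2
      exact h2.pos (by omega)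
    -- a further step would make the potential negative
    have hk : 0 < k := by
      by_contra hk0
      obtain ⟨s3, J3, -, -, -, -, hp3⟩ := relaxStep_spec (X := X) h2 hr2 hb hB hF hC
      have : k = 0 := by omega
      rw [this, zero_mul] at hp2
      omega
    refine ⟨k - 1, by omega, Tri.mono (relaxStep_spec h2 hr2 hb hB hF hC) le_rfl ?_⟩
    rintro s3 ⟨h3, hr3, hp3⟩
    refine ⟨h3, hr3, ?_⟩
    have : k * D = (k - 1) * D + D := by
      rw [← Nat.succ_mul, Nat.succ_eq_add_one, Nat.sub_add_cancel hk]
    omega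
  · rintro s2 ⟨⟨k, h2, hr2, -⟩, hb⟩
    refine ⟨h2, hr2.tree, fun v hv hl => ?_⟩
    simp only [AExp.val_lt, AExp.val_arr, AExp.val_ofNat, AExp.val_reg, h2.ctx.inf,
      ite_one_eq_zero, not_lt] at hb
    by_contra hc
    have hvn := v.2
    have hroot := hr2.tree.root_le (n + v) (by omega) (by omega)
    rw [hr2.leaf v hvn, nodeKey, if_pos ⟨fun he => hv (Fin.ext he), hl, by
      simp only [toConfig] at hc; omega⟩] at hroot
    simp only [toConfig] at hl
    have h3 : (s2.arr aLev v + 1) * n ≤ 16 * n * n := Nat.mul_le_mul_right _ hl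
    rw [add_mul] at h3
    omega

/-! ### Guessing the value of the flow -/

/- The register `rNN` holds `n * n`; the arrays `aC` and `aB` hold the capacity matrix and the
bottleneck values. -/

local notation "rNN" => (6 : ℕ)
local notation "rQ" => (12 : ℕ)
local notation "rGo" => (13 : ℕ)
local notation "aC" => (4 : Fin 16)
local notation "aB" => (11 : Fin 16)

/-- The matrix that is stored in an array. -/
def toMatrix (n : ℕ) (a : ℕ → ℕ) (i j : Fin n) : ℕ := a (i * n + j)

/-- Initialise the push-relabel algorithm with `rF` units of excess at the source. -/
def startGuess : AProg :=
  forUp rJ rNN (.put aR (.reg rJ) (.arr aC (.reg rJ))) ;;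
  forUp rJ rN (.put aEx (.reg rJ) 0 ;; .put aLev (.reg rJ) 0 ;;
    .put aCur (.reg rJ) 0 ;; .put aHi (.reg rJ) 0) ;;
  .put aEx (.reg rS) (.reg rF) ;; .set rD (.reg rF) ;; .set rQ 1

theorem isPRState_of_start {n F : ℕ} {C : Fin n → Fin n → ℕ} {S T : Fin n} {s : ASt}
    (hc : Ctx n S T s) (hD : s.reg rD = F) (hR : (toConfig n s.arr).R = C)
    (hex : ∀ v, (toConfig n s.arr).ex v = if v = S then F else 0)
    (hlev : ∀ v, (toConfig n s.arr).lev v = 0) (hhi : ∀ v, (toConfig n s.arr).hi v = 0) :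
    IsPRState C S T F F s where
  ctx := hc
  scale := hD
  preflow := ⟨fun i j => by rw [hR], fun v => by rw [hR, hex]⟩
  labelled := ⟨fun u v k _ _ hk => by rw [hlev] at hk; omega, fun u v h => by rw [hlev] at h; omega,
    fun u => by rw [hhi]; omega, hlev T, fun u => by rw [hlev]; omega⟩
  capped := fun v _ _ => by rw [hex]; split_ifs <;> omega
  pos := fun h => h

theorem startGuess_spec {n F : ℕ} {S T : Fin n} {s : ASt} (hc : Ctx n S T s)
    (hnn : s.reg rNN = n * n) (hF : s.reg rF = F) (hB : 16 * n * n ≤ B) :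
    Tri X B startGuess s (n * n + n) (fun s' =>
      IsPRState (toMatrix n (s.arr aC)) S T F F s' ∧ s'.reg rQ = 1) := by
  have hn : 0 < n := S.pos
  have hnB : 16 * n ≤ B := le_trans (Nat.le_mul_of_pos_right _ hn) hB
  refine Tri.mono (Tri.seq (Tri.forUp (N := n * n) (t := 0)
    (fun i s' => ∀ k < i, s'.arr aR k = s.arr aC k)
    hnn (by nlinarith) (by decide) (by decide) (by decide) (fun v hv => absurd hv (by omega))
    ?_) (Q' := _) (J₂ := n * 1 + 0) ?_) (by omega) fun _ h => h
  · rintro i s1 hi hF1 hJ1 h1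
    apply Tri.flat
    simp only [wp, AExp.fits_arr, AExp.val_arr, AExp.val_reg, hJ1, forall_eq, true_and]
    intro _ k hk
    simp only [ASt.arr_setReg, ASt.arr_setArr, if_true, Function.update_apply]
    split_ifs with hki
    · rw [hF1.arr _ (by decide), hki]
    · exact h1 k (by omega)
  intro s1 h1 hF1
  refine Tri.seq (Tri.forUp (N := n) (t := 0)
    (fun i s' => ∀ v < i, s'.arr aEx v = 0 ∧ s'.arr aLev v = 0 ∧ s'.arr aCur v = 0 ∧
      s'.arr aHi v = 0) ((hc.frame hF1 (by decide)).size) (by omega) (by decide) (by decide)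
      (by decide) (fun v hv => absurd hv (by omega)) ?_) ?_
  · rintro i s2 hi hF2 hJ2 h2
    apply Tri.flat
    simp only [wp, AExp.fits_ofNat, AExp.val_ofNat, AExp.val_reg, hJ2, forall_eq, ASt.reg_setArr]
    refine ⟨by omega, by omega, by omega, by omega, fun _ v hv => ?_⟩
    simp only [ASt.arr_setReg, ASt.arr_setArr, if_true, Function.update_apply, Fin.reduceEq,
      if_false]
    split_ifs with hvi
    · simp
    · exact h2 v (by omega)
  · intro s2 h2 hF2
    have hc2 := (hc.frame hF1 (by decide)).frame hF2 (by decide)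
    have hF' : s2.reg rF = F := by rw [hF2.reg _ (by decide), hF1.reg _ (by decide), hF]
    have hR2 : s2.arr aR = s1.arr aR := hF2.arr _ (by decide)
    apply Tri.flat
    simp only [wp, AExp.fits_reg, AExp.val_reg, hc2.source, hF', forall_eq, true_and,
      ASt.reg_setArr, AExp.fits_ofNat, AExp.val_ofNat]
    refine ⟨by omega, isPRState_of_start ⟨by simpa using hc2.size, by simpa using hc2.source,
      by simpa using hc2.sink, by simpa using hc2.height, by simpa using hc2.inf⟩ (by simp)
      ?_ (fun v => ?_) (fun v => ?_) (fun v => ?_), by simp⟩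
    · funext i j
      simp only [toConfig, ASt.arr_setReg, ASt.arr_setArr, Fin.reduceEq, if_false, hR2, toMatrix]
      exact h1 _ (index_lt i.2 j.2)
    · simp only [toConfig, ASt.arr_setReg, ASt.arr_setArr, if_true, Function.update_apply,
        Fin.val_inj]
      split_ifs
      · rfl
      · exact (h2 v v.2).1
    · exact (h2 v v.2).2.1
    · exact (h2 v v.2).2.2.2

/-- Run the push-relabel algorithm with `rF` units of excess at the source; the scale is halved
from phase to phase, until it is about `rF / (8 * n)`. After `j` phases, `rQ` is `2 ^ j`. -/
def guess : AProg :=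
  startGuess ;;
  .loop (.lt (.reg rQ) (8 * .reg rN))
    (phase ;; .set rD ((.reg rD + 1) / 2) ;; .set rQ (2 * .reg rQ))

/-- A bound for the number of loop iterations in a phase. -/
def phaseTicks (n : ℕ) : ℕ := n * (Nat.log 2 n + 2) + phaseSteps n * (3 * (Nat.log 2 n + 1) + 1)

/-- Between two phases, the scale is rounded up. -/
theorem IsPRState.nextScale {n F D : ℕ} {C : Fin n → Fin n → ℕ} {S T : Fin n} {s s' : ASt}
    (h : IsPRState C S T F D s) (hc : Ctx n S T s') (hD : s'.reg rD = (D + 1) / 2)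
    (ha : s'.arr = s.arr)
    (hx : ∀ v, v ≠ T → (toConfig n s.arr).lev v < 16 * n → 2 * (toConfig n s.arr).ex v ≤ D) :
    IsPRState C S T F ((D + 1) / 2) s' :=
  ⟨hc, hD, ha ▸ h.preflow, ha ▸ h.labelled, fun v hv hl => by
    rw [ha] at hl ⊢
    have := hx v hv hl
    omega, fun hF => by have := h.pos hF; omega⟩

theorem guess_spec {n F : ℕ} {S T : Fin n} {s : ASt} (hc : Ctx n S T s)
    (hnn : s.reg rNN = n * n) (hF : s.reg rF = F) (ht : IsTree n (s.arr aTree))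
    (hB : 16 * n * n ≤ B) (hFB : 2 * F ≤ B)
    (hC : ∀ i j, toMatrix n (s.arr aC) i j + toMatrix n (s.arr aC) j i ≤ B) :
    Tri X B guess s (n * n + n + (Nat.log 2 n + 4) * (phaseTicks n + 1)) (fun s' =>
      IsPreflow (toMatrix n (s.arr aC)) S F (toConfig n s'.arr).R (toConfig n s'.arr).ex ∧
      IsLabelled T (16 * n) (toConfig n s'.arr) ∧ IsTree n (s'.arr aTree) ∧
      ∀ v, v ≠ T → (toConfig n s'.arr).lev v < 16 * n → 4 * n * (toConfig n s'.arr).ex v ≤ F) := by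
  have hn : 0 < n := S.pos
  have hnB : 16 * n ≤ B := le_trans (Nat.le_mul_of_pos_right _ hn) hB
  set C := toMatrix n (s.arr aC) with hCdef
  refine Tri.seq (startGuess_spec hc hnn hF hB) ?_
  rintro s1 ⟨h1, hq1⟩ hF1
  have ht1 : IsTree n (s1.arr aTree) := by rw [hF1.arr _ (by decide)]; exact ht
  refine Tri.mono (Tri.loop (t := phaseTicks n) (k := Nat.log 2 n + 4) (fun k s' => ∃ D j,
    IsPRState C S T F D s' ∧ IsTree n (s'.arr aTree) ∧ s'.reg rQ = 2 ^ j ∧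
    j + k = Nat.log 2 n + 4 ∧ D * 2 ^ j < F + 2 ^ j ∧
    ∀ v, v ≠ T → (toConfig n s'.arr).lev v < 16 * n → (toConfig n s'.arr).ex v * 2 ^ j ≤ 2 * F) ?_
    ⟨F, 0, h1, ht1, by simpa using hq1, by omega, by omega, fun v _ _ => by
      have := h1.preflow.ex_le v; omega⟩) le_rfl ?_
  · rintro k s2 - ⟨D, j, h2, ht2, hq2, hjk, hDj, hx2⟩ hb
    simp only [AExp.val_lt, AExp.val_mul, AExp.val_ofNat, AExp.val_reg, h2.ctx.size, hq2,
      ite_one_ne_zero] at hb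
    have hlog : n < 2 ^ (Nat.log 2 n + 1) := Nat.lt_pow_succ_log_self (by norm_num) n
    have hk : 0 < k := by
      by_contra hk0
      have : j = Nat.log 2 n + 1 + 3 := by omega
      rw [this, pow_add] at hb
      omega
    have hDF : D ≤ F := by
      by_contra hDF
      have h3 : (F + 1) * 2 ^ j ≤ D * 2 ^ j := Nat.mul_le_mul_right _ (by omega)
      have h4 : F * 1 ≤ F * 2 ^ j := Nat.mul_le_mul_left _ Nat.one_le_two_pow
      rw [add_mul] at h3
      omega
    refine ⟨k - 1, by omega, Tri.mono (Tri.seq (J₂ := 0) (phase_spec h2 ht2 hB hFB hC) ?_)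
      le_rfl fun _ h => h⟩
    rintro s3 ⟨h3, ht3, hx3⟩ hF3
    have hq3 : s3.reg rQ = 2 ^ j := by rw [hF3.reg _ (by decide), hq2]
    apply Tri.flat
    simp only [wp, AExp.fits_div, AExp.fits_add, AExp.val_div, AExp.val_add, AExp.val_reg,
      AExp.val_ofNat, h3.scale, forall_eq, AExp.fits_mul, AExp.val_mul, ASt.reg_setReg,
      Nat.reduceEqDiff, if_false, hq3]
    have hpow : (2 : ℕ) ^ (j + 1) = 2 * 2 ^ j := pow_succ' 2 j
    have hpos : 0 < 2 ^ j := Nat.pow_pos (by norm_num)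
    refine ⟨by omega, by omega, (D + 1) / 2, j + 1,
      h3.nextScale ⟨by simpa using h3.ctx.size, by simpa using h3.ctx.source,
      by simpa using h3.ctx.sink, by simpa using h3.ctx.height, by simpa using h3.ctx.inf⟩
      (by simp) rfl hx3, ht3, by simp [hpow], by omega, ?_, fun v hv hl => ?_⟩
    · have : (D + 1) / 2 * 2 * 2 ^ j ≤ (D + 1) * 2 ^ j :=
        Nat.mul_le_mul_right _ (Nat.div_mul_le_self _ _)
      rw [hpow]
      nlinarith
    · -- here `2 * ex ≤ D`, and `D` is `F / 2 ^ j` rounded up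
      have h4 := hx3 v hv hl
      simp only [ASt.arr_setReg] at hl ⊢
      rw [hpow]
      rcases Nat.eq_zero_or_pos ((toConfig n s3.arr).ex v) with h0 | h0
      · rw [h0]; omega
      · have h5 : ((toConfig n s3.arr).ex v + 1) * 2 ^ j ≤ D * 2 ^ j :=
          Nat.mul_le_mul_right _ (by omega)
        nlinarith
  · rintro s2 ⟨⟨k, D, j, h2, ht2, hq2, -, -, hx2⟩, hb⟩
    simp only [AExp.val_lt, AExp.val_mul, AExp.val_ofNat, AExp.val_reg, h2.ctx.size, hq2,
      ite_one_eq_zero, not_lt] at hb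
    refine ⟨h2.preflow, h2.labelled, ht2, fun v hv hl => ?_⟩
    have h3 := hx2 v hv hl
    have h4 := Nat.mul_le_mul_left ((toConfig n s2.arr).ex v) hb
    nlinarith

/-- Try flow values from an upper bound downwards, until half of the excess arrives at the sink. -/
def search : AProg :=
  .set rF (.reg rNN * .arr aB (.reg rT)) ;; .set rGo 1 ;;
  .loop (.reg rGo)
    (guess ;;
     .ite (.lt (2 * .arr aEx (.reg rT)) (.reg rF)) (.set rF ((.reg rF + 1) / 2)) (.set rGo 0))

/-- A bound for the number of loop iterations for one guess of the flow value. -/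
def guessTicks (n : ℕ) : ℕ := n * n + n + (Nat.log 2 n + 4) * (phaseTicks n + 1)

theorem search_spec {n : ℕ} {S T : Fin n} {s : ASt} (hc : Ctx n S T s) (hST : T ≠ S)
    (hnn : s.reg rNN = n * n) (ht : IsTree n (s.arr aTree))
    (htri : ∀ i j, 0 < toMatrix n (s.arr aC) i j → i < j)
    (hbot : IsBottleneck (toMatrix n (s.arr aC)) S (fun v => s.arr aB v))
    (hB : 16 * n * n ≤ B) (hFB : 2 * (n * n * s.arr aB T) ≤ B)
    (hC : ∀ i j, toMatrix n (s.arr aC) i j + toMatrix n (s.arr aC) j i ≤ B) :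
    Tri X B search s ((2 * Nat.log 2 n + 3) * (guessTicks n + 1)) (fun s' => ∃ F ≤ B,
      IsPreflow (toMatrix n (s.arr aC)) S F (toConfig n s'.arr).R (toConfig n s'.arr).ex ∧
      ∀ G x, IsMatFlow (toMatrix n (s.arr aC)) S T G x → x ≤ 4 * ((toConfig n s'.arr).ex T : ℝ)) := by
  have hn : 0 < n := S.pos
  have hnB : 16 * n ≤ B := le_trans (Nat.le_mul_of_pos_right _ hn) hB
  set C := toMatrix n (s.arr aC) with hCdef
  set b := s.arr aB T with hbdef
  refine Tri.mono (Tri.seq (J₁ := 0) (Q := fun s' => s' = s.setReg rF (n * n * b)) (Tri.flat ?_) ?_)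
    (Nat.zero_add _).le fun _ h => h
  · simp only [wp, AExp.fits_mul, AExp.val_mul, AExp.val_arr, AExp.val_reg, hnn, hc.sink, ← hbdef,
      forall_eq]
    exact ⟨by omega, trivial⟩
  rintro s1 rfl -
  refine Tri.mono (Tri.seq (J₁ := 0) (Q := fun s' => s' = (s.setReg rF (n * n * b)).setReg rGo 1)
    (Tri.flat ?_) ?_) (Nat.zero_add _).le fun _ h => h
  · simp only [wp, AExp.fits_ofNat, AExp.val_ofNat, forall_eq]
    exact ⟨by omega, trivial⟩
  rintro s1 rfl -
  set s1 := (s.setReg rF (n * n * b)).setReg rGo 1 with hs1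
  have hc1 : Ctx n S T s1 := ⟨by simpa [hs1] using hc.size, by simpa [hs1] using hc.source,
      by simpa [hs1] using hc.sink, by simpa [hs1] using hc.height, by simpa [hs1] using hc.inf⟩
  refine Tri.mono (Tri.loop (t := guessTicks n) (k := 2 * Nat.log 2 n + 3) (fun k s' =>
    IsTree n (s'.arr aTree) ∧
    ((s'.reg rGo = 1 ∧ ∃ F j, s'.reg rF = F ∧ j + k = 2 * Nat.log 2 n + 3 ∧ 0 < k ∧
      F * 2 ^ j < n * n * b + 2 ^ j ∧ ∀ G x, IsMatFlow C S T G x → x ≤ 2 * (F : ℝ)) ∨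
    (s'.reg rGo = 0 ∧ ∃ F ≤ B,
      IsPreflow C S F (toConfig n s'.arr).R (toConfig n s'.arr).ex ∧
      ∀ G x, IsMatFlow C S T G x → x ≤ 4 * ((toConfig n s'.arr).ex T : ℝ)))) ?_ ?_) le_rfl ?_
  · rintro k s2 hF2 ⟨ht2, ⟨hgo, F, j, hFr, hjk, hk0, hFj, hopt⟩ | ⟨hgo, -⟩⟩ hb
    swap
    · simp [hgo] at hb
    have hc2 := hc1.frame hF2 (by decide)
    have hC2 : s2.arr aC = s.arr aC := by rw [hF2.arr _ (by decide)]; rfl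
    have hFle : F ≤ n * n * b := by
      by_contra hDF
      have h3 : (n * n * b + 1) * 2 ^ j ≤ F * 2 ^ j := Nat.mul_le_mul_right _ (by omega)
      have h4 : n * n * b * 1 ≤ n * n * b * 2 ^ j := Nat.mul_le_mul_left _ Nat.one_le_two_pow
      rw [add_mul] at h3
      omega
    have hspec := guess_spec (X := X) hc2
      (by rw [hF2.reg _ (by decide)]; simpa [hs1] using hnn) hFr ht2 hB (by omega)
      (by rw [hC2]; exact hC)
    rw [hC2, ← hCdef] at hspec
    refine ⟨k - 1, by omega, Tri.mono (Tri.seq (J₂ := 0) hspec ?_) le_rfl fun _ h => h⟩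
    rintro s3 ⟨h3, hl3, ht3, hx3⟩ hF3
    have hFr3 : s3.reg rF = F := by rw [hF3.reg _ (by decide), hFr]
    have hgo3 : s3.reg rGo = 1 := by rw [hF3.reg _ (by decide), hgo]
    have hT3 : s3.reg rT = T := (hc2.frame hF3 (by decide)).sink
    apply Tri.flat
    simp only [wp, AExp.val_lt, AExp.val_mul, AExp.val_ofNat, AExp.val_arr, AExp.val_reg, hT3,
      hFr3, ite_one_ne_zero, ite_one_eq_zero, AExp.fits_div, AExp.fits_add, AExp.val_div,
      AExp.val_add, forall_eq, AExp.fits_ofNat, not_lt]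
    refine ⟨fun hlt => ?_, fun hle => ?_⟩
    · -- too little has arrived, so there is no flow of value `F`
      have hno : ∀ G, ¬ IsMatFlow C S T G F := by
        intro G hG
        have h4 := le_two_mul_ex htri h3 (fun u v => hl3.lev_le_add) hl3.lev_t hx3 hG
        simp only [toConfig] at h4
        omega
      have hbF : b < F := by
        by_contra hbF
        obtain ⟨G, hG, -⟩ := hbot.exists_flow T (x := (F : ℝ)) (Nat.cast_nonneg _)
          (by exact_mod_cast not_lt.1 hbF)
        exact hno G hG
      have hpow : (2 : ℕ) ^ (j + 1) = 2 * 2 ^ j := pow_succ' 2 j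
      refine ⟨by nlinarith [Nat.one_le_iff_ne_zero.2 hn.ne'], ht3, Or.inl ⟨by simpa using hgo3,
        (F + 1) / 2, j + 1, by simp, by omega, ?_, ?_, ?_⟩⟩
      · by_contra hk1
        have hj : j = 2 * Nat.log 2 n + 2 := by omega
        have h5 : n * n ≤ 2 ^ j := by
          have hlog : n < 2 ^ (Nat.log 2 n + 1) := Nat.lt_pow_succ_log_self (by norm_num) n
          rw [hj, show 2 * Nat.log 2 n + 2 = (Nat.log 2 n + 1) + (Nat.log 2 n + 1) by ring, pow_add]
          exact Nat.mul_le_mul hlog.le hlog.le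
        have h6 : (b + 1) * 2 ^ j ≤ F * 2 ^ j := Nat.mul_le_mul_right _ hbF
        have h7 : n * n * b ≤ 2 ^ j * b := Nat.mul_le_mul_right _ h5
        nlinarith
      · have : (F + 1) / 2 * 2 * 2 ^ j ≤ (F + 1) * 2 ^ j :=
          Nat.mul_le_mul_right _ (Nat.div_mul_le_self _ _)
        rw [hpow]
        nlinarith
      · intro G x hG
        have hF0 : (0 : ℝ) < F := by exact_mod_cast (by omega : 0 < F)
        have hx : x ≤ F := by
          by_contra hx
          have hx0 : 0 < x := by linarith
          have h4 := hG.scale (a := F / x) (by positivity) ((div_le_one hx0).2 (by linarith))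
          rw [div_mul_cancel₀ _ hx0.ne'] at h4
          exact hno _ h4
        have h5 : (F : ℝ) ≤ 2 * (((F + 1) / 2 : ℕ) : ℝ) := by
          exact_mod_cast (by omega : F ≤ 2 * ((F + 1) / 2))
        linarith
    · refine ⟨by omega, ht3, Or.inr ⟨by simp, F, by omega, h3, fun G x hG => (hopt G x hG).trans ?_⟩⟩
      have h4 : (F : ℝ) ≤ 2 * ((toConfig n s3.arr).ex T : ℝ) := by exact_mod_cast hle
      simp only [ASt.arr_setReg]
      linarith
  · refine ⟨ht, Or.inl ⟨by simp [hs1], n * n * b, 0, by simp [hs1], by omega, by omega, by omega,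
      fun G x hG => ?_⟩⟩
    have h1 := hbot.value_le htri hST hG
    have h2 : (0 : ℝ) ≤ n * n * s.arr aB T := by positivity
    push_cast
    simp only [hbdef]
    linarith
  · rintro s2 ⟨⟨k, -, ⟨hgo, -⟩ | ⟨hgo, h⟩⟩, hb⟩
    · simp [hgo] at hb
    · exact h

/-! ### Merging parallel edges -/

/- Registers: `rS0` and `rT0` hold the original names of the terminals, `rTot` the sum of all
capacities.
Arrays: `aA` holds the merged capacities before sorting, `aDeg` the indegrees, `aTau` the positions
of the vertices, and `aOrd` the vertices in the order of the positions. -/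

local notation "rS0" => (2 : ℕ)
local notation "rT0" => (3 : ℕ)
local notation "rTot" => (7 : ℕ)
local notation "rY" => (27 : ℕ)
local notation "aA" => (0 : Fin 16)
local notation "aDeg" => (1 : Fin 16)
local notation "aTau" => (2 : Fin 16)
local notation "aOrd" => (3 : Fin 16)

/-- The sum of the first `i` values of `g`. -/
def partialSum {m : ℕ} (g : Fin m → ℕ) (i : ℕ) : ℕ := ∑ e : Fin m, if (e : ℕ) < i then g e else 0

theorem partialSum_zero {m : ℕ} (g : Fin m → ℕ) : partialSum g 0 = 0 := by simp [partialSum]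

theorem partialSum_succ {m i : ℕ} (g : Fin m → ℕ) (hi : i < m) :
    partialSum g (i + 1) = partialSum g i + g ⟨i, hi⟩ := by
  have h1 : ∀ e : Fin m, (if (e : ℕ) < i + 1 then g e else 0) =
      (if (e : ℕ) < i then g e else 0) + if e = ⟨i, hi⟩ then g ⟨i, hi⟩ else 0 := by
    intro e
    by_cases he : e = ⟨i, hi⟩
    · simp [he]
    · have : (e : ℕ) ≠ i := fun h => he (Fin.ext h)
      by_cases hlt : (e : ℕ) < i
      · rw [if_pos (by omega), if_pos hlt, if_neg he, add_zero]
      · rw [if_neg (by omega), if_neg hlt, if_neg he]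
  unfold partialSum
  rw [Finset.sum_congr rfl fun e _ => h1 e, Finset.sum_add_distrib]
  simp

theorem partialSum_self {m : ℕ} (g : Fin m → ℕ) : partialSum g m = ∑ e, g e :=
  Finset.sum_congr rfl fun e _ => by rw [if_pos e.2]

theorem partialSum_le {m : ℕ} (g : Fin m → ℕ) (i : ℕ) : partialSum g i ≤ ∑ e, g e :=
  Finset.sum_le_sum fun e _ => by split_ifs; exacts [le_rfl, Nat.zero_le _]

/-- The raw memory holds the edges of the network. -/
structure HoldsEdges {n m : ℕ} (N : FlowNetwork n m) (raw : ℕ → ℕ) : Prop where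
  src : ∀ e : Fin m, raw (4 + 3 * e) = N.src e
  tgt : ∀ e : Fin m, raw (4 + 3 * e + 1) = N.tgt e
  cap : ∀ e : Fin m, raw (4 + 3 * e + 2) = N.cap e

theorem holdsEdges_inputMem {n m : ℕ} (N : FlowNetwork n m) : HoldsEdges N N.inputMem := by
  have hne : ∀ (e : Fin m) (d : ℕ), d < 3 →
      N.inputMem (4 + 3 * e + d) =
      if h : (4 + 3 * (e : ℕ) + d - 4) / 3 < m then
        if (4 + 3 * (e : ℕ) + d - 4) % 3 = 0 then (N.src ⟨(4 + 3 * (e : ℕ) + d - 4) / 3, h⟩ : ℕ)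
        else if (4 + 3 * (e : ℕ) + d - 4) % 3 = 1 then
          (N.tgt ⟨(4 + 3 * (e : ℕ) + d - 4) / 3, h⟩ : ℕ)
        else N.cap ⟨(4 + 3 * (e : ℕ) + d - 4) / 3, h⟩ else 0 := by
    intro e d _
    unfold FlowNetwork.inputMem
    rw [if_neg (by omega), if_neg (by omega), if_neg (by omega), if_neg (by omega)]
  have hdiv : ∀ (e : Fin m) (d : ℕ), d < 3 → (4 + 3 * (e : ℕ) + d - 4) / 3 = e := by
    intro e d _; omega
  have hmod : ∀ (e : Fin m) (d : ℕ), d < 3 → (4 + 3 * (e : ℕ) + d - 4) % 3 = d := by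
    intro e d _; omega
  refine ⟨fun e => ?_, fun e => ?_, fun e => ?_⟩
  · have := hne e 0 (by omega)
    rw [add_zero] at this
    rw [this]
    have h1 := hdiv e 0 (by omega)
    have h2 := hmod e 0 (by omega)
    rw [add_zero] at h1 h2
    simp only [h1, h2, e.2, dite_true, if_true, Fin.eta]
  · rw [hne e 1 (by omega)]
    simp only [hdiv e 1 (by omega), hmod e 1 (by omega), e.2, dite_true, if_true, Fin.eta,
      one_ne_zero, if_false]
  · rw [hne e 2 (by omega)]
    simp only [hdiv e 2 (by omega), hmod e 2 (by omega), e.2, dite_true, Fin.eta]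
    norm_num

/-- Read the sizes and the terminals, and compute the constants. -/
def readHeader : AProg :=
  .get rN 0 ;; .get rM 1 ;; .get rS0 2 ;; .get rT0 3 ;; .set rNN (.reg rN * .reg rN) ;;
  .set rL (16 * .reg rN) ;; .set rInf (.reg rL * .reg rN)

/-- The registers that are set by `readHeader`. -/
structure HasHeader {n m : ℕ} (N : FlowNetwork n m) (s : ASt) : Prop where
  size : s.reg rN = n
  edges : s.reg rM = m
  source : s.reg rS0 = N.s
  sink : s.reg rT0 = N.t
  square : s.reg rNN = n * n
  height : s.reg rL = 16 * n
  inf : s.reg rInf = 16 * n * n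

theorem HasHeader.frame {n m : ℕ} {N : FlowNetwork n m} {s s' : ASt} {p : AProg}
    (h : HasHeader N s) (hF : p.Frame s s')
    (hw : ∀ r ∈ [rN, rM, rS0, rT0, rNN, rL, rInf], p.writesReg r = false) : HasHeader N s' := by
  simp only [List.mem_cons, List.not_mem_nil, or_false, forall_eq_or_imp, forall_eq] at hw
  obtain ⟨h0, h1, h2, h3, h6, h8, h9⟩ := hw
  exact ⟨(hF.reg _ h0).trans h.size, (hF.reg _ h1).trans h.edges, (hF.reg _ h2).trans h.source,
    (hF.reg _ h3).trans h.sink, (hF.reg _ h6).trans h.square, (hF.reg _ h8).trans h.height,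
    (hF.reg _ h9).trans h.inf⟩

theorem readHeader_spec {n m : ℕ} {N : FlowNetwork n m} {s : ASt} (hraw : s.raw = N.inputMem)
    (hX : 4 ≤ X) (hB : 16 * n * n ≤ B) (hn : 0 < n) : Tri X B readHeader s 0 (HasHeader N) := by
  have h0 : N.inputMem 0 = n := rfl
  have h1 : N.inputMem 1 = m := rfl
  have h2 : N.inputMem 2 = N.s := rfl
  have h3 : N.inputMem 3 = N.t := rfl
  have hnB : 16 * n ≤ B := le_trans (Nat.le_mul_of_pos_right _ hn) hB
  suffices h : Tri X B readHeader s 0 (fun s' => s'.reg rN = n ∧ s'.reg rM = m ∧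
      s'.reg rS0 = N.s ∧ s'.reg rT0 = N.t ∧ s'.reg rNN = n * n ∧ s'.reg rL = 16 * n ∧
      s'.reg rInf = 16 * n * n) from
    h.mono le_rfl fun s' h => ⟨h.1, h.2.1, h.2.2.1, h.2.2.2.1, h.2.2.2.2.1, h.2.2.2.2.2.1,
      h.2.2.2.2.2.2⟩
  apply Tri.flat
  simp [readHeader, wp, hraw, h0, h1, h2, h3]
  refine ⟨by omega, by omega, by omega, by omega, by nlinarith, hnB, hB⟩

/-- Add up the capacities of parallel edges in a matrix. -/
def mergeEdges : AProg :=
  .set rTot 0 ;;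
  forUp rJ rM
    (.get rU (4 + 3 * .reg rJ) ;; .get rW (4 + 3 * .reg rJ + 1) ;; .get rX (4 + 3 * .reg rJ + 2) ;;
     .put aA (.reg rU * .reg rN + .reg rW) (.arr aA (.reg rU * .reg rN + .reg rW) + .reg rX) ;;
     .set rTot (.reg rTot + .reg rX))

theorem mergeEdges_spec {n m : ℕ} {N : FlowNetwork n m} {s : ASt} (hN : s.reg rN = n)
    (hM : s.reg rM = m) (hraw : HoldsEdges N s.raw) (hA : ∀ i, s.arr aA i = 0)
    (hX : 4 + 3 * m ≤ X) (hmB : m ≤ B) (hB : ∑ e, N.cap e ≤ B) :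
    Tri X B mergeEdges s m (fun s' =>
      (∀ u v : Fin n, s'.arr aA (u * n + v) = N.merge id N.cap u v) ∧
      s'.reg rTot = ∑ e, N.cap e) := by
  refine Tri.mono (Tri.seq (J₁ := 0) (Q := fun s' => s' = s.setReg rTot 0) (Tri.flat ?_) ?_)
    (Nat.zero_add _).le fun _ h => h
  · simp [wp]
  rintro s1 rfl -
  refine Tri.mono (Tri.forUp (N := m) (t := 0) (fun i s' =>
    (∀ u v : Fin n, s'.arr aA (u * n + v) =
      partialSum (fun e => if N.src e = u ∧ N.tgt e = v then N.cap e else 0) i) ∧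
    s'.reg rTot = partialSum N.cap i) (by simpa using hM) hmB (by decide) (by decide) (by decide)
    ⟨fun u v => by simp [partialSum_zero, hA], by simp [partialSum_zero]⟩ ?_) (by omega) ?_
  · rintro i s1 hi hF1 hJ1 ⟨hA1, hT1⟩
    have hN1 : s1.reg rN = n := by rw [hF1.reg _ (by decide)]; simpa using hN
    have hraw1 : s1.raw = s.raw := by rw [hF1.raw (by decide)]; rfl
    have hs := hraw.src ⟨i, hi⟩
    have ht := hraw.tgt ⟨i, hi⟩
    have hc := hraw.cap ⟨i, hi⟩
    have hb1 := partialSum_le N.cap (i + 1)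
    rw [partialSum_succ _ hi] at hb1
    have hA' := hA1 (N.src ⟨i, hi⟩) (N.tgt ⟨i, hi⟩)
    have hb2 : partialSum (fun e => if N.src e = N.src ⟨i, hi⟩ ∧ N.tgt e = N.tgt ⟨i, hi⟩ then
        N.cap e else 0) i ≤ partialSum N.cap i :=
      Finset.sum_le_sum fun e _ => by dsimp only; split_ifs <;> omega
    apply Tri.flat
    simp only [wp, AExp.val_add, AExp.val_mul, AExp.val_ofNat, AExp.val_reg, hJ1, ASt.raw_setReg,
      hraw1, ASt.reg_setReg, forall_eq, AExp.fits_add, AExp.val_arr, Nat.reduceEqDiff, if_false,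
      if_true, hN1, hs, ht, hc, ASt.arr_setReg, ASt.reg_setArr, hT1, hA']
    norm_num [hs, ht, hc, hA', hT1]
    refine ⟨by omega, by omega, by omega, by omega, by omega, fun _ => ⟨fun u v => ?_, ?_⟩⟩
    · rw [partialSum_succ _ hi, Function.update_apply]
      simp only [index_inj]
      by_cases h : u = N.src ⟨i, hi⟩ ∧ v = N.tgt ⟨i, hi⟩
      · rw [if_pos h, if_pos ⟨h.1.symm, h.2.symm⟩, h.1, h.2]
      · rw [if_neg h, if_neg (fun h' => h ⟨h'.1.symm, h'.2.symm⟩), hA1 u v, add_zero]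
    · rw [partialSum_succ _ hi]
  · rintro s1 ⟨h1, h2⟩
    refine ⟨fun u v => ?_, by rw [h2, partialSum_self]⟩
    rw [h1, partialSum_self]; rfl

/-! ### Topological sorting -/

/-- The state of the sorting after `i` rounds: `P` is the set of the vertices that have a position;
`deg` counts the predecessors without a position (and is `1` for the vertices that have one). -/
structure IsPartialSort {n : ℕ} (r : Fin n → Fin n → Prop) [DecidableRel r] (i : ℕ)
    (P : Finset (Fin n)) (deg tau ord : ℕ → ℕ) : Prop where
  card : P.card = i
  tau_lt : ∀ v ∈ P, tau v < i
  ord_tau : ∀ v ∈ P, ord (tau v) = v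
  deg_in : ∀ v ∈ P, deg v = 1
  pred : ∀ u v, r u v → v ∈ P → u ∈ P ∧ tau u < tau v
  deg_out : ∀ v, v ∉ P → deg v = (Finset.univ.filter fun u => u ∉ P ∧ r u v).card

/-- As long as there are vertices without a position, one of them has no predecessor among them. -/
theorem exists_deg_eq_zero {n i : ℕ} {r : Fin n → Fin n → Prop} [DecidableRel r]
    (hr : ∀ v, ¬ Relation.TransGen r v v) {P : Finset (Fin n)} {deg tau ord : ℕ → ℕ}
    (h : IsPartialSort r i P deg tau ord) (hi : i < n) : ∃ v : Fin n, deg v = 0 := by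
  have hwf : WellFounded (Relation.TransGen r) := by
    have : Std.Irrefl (Relation.TransGen r) := ⟨hr⟩
    exact Finite.wellFounded_of_trans_of_irrefl _
  have hne : {v : Fin n | v ∉ P}.Nonempty := by
    by_contra hc
    have : P = Finset.univ := by
      ext v
      simp only [Finset.mem_univ, iff_true]
      by_contra hv
      exact hc ⟨v, hv⟩
    have h1 := h.card
    rw [this, Finset.card_univ, Fintype.card_fin] at h1
    omega
  obtain ⟨v, hv, hmin⟩ := hwf.has_min _ hne
  refine ⟨v, ?_⟩
  rw [h.deg_out v hv, Finset.card_eq_zero, Finset.filter_eq_empty_iff]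
  rintro u - ⟨hu, huv⟩
  exact hmin u hu (Relation.TransGen.single huv)

theorem IsPartialSort.insert_vertex {n i : ℕ} {r : Fin n → Fin n → Prop} [DecidableRel r]
    {P : Finset (Fin n)} {deg tau ord : ℕ → ℕ} (h : IsPartialSort r i P deg tau ord)
    {v : Fin n} (hv : deg v = 0) {deg' : ℕ → ℕ}
    (hdeg : ∀ w : Fin n, deg' w = (if w = v then 1 else deg w) - if r v w then 1 else 0) :
    IsPartialSort r (i + 1) (insert v P) deg' (Function.update tau v i)
      (Function.update ord i v) := by
  have hvP : v ∉ P := fun hc => by rw [h.deg_in v hc] at hv; omega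
  have hnone : ∀ u, r u v → u ∈ P := by
    intro u hu
    rw [h.deg_out v hvP, Finset.card_eq_zero, Finset.filter_eq_empty_iff] at hv
    by_contra hc
    exact hv (Finset.mem_univ u) ⟨hc, hu⟩
  have hne : ∀ w ∈ P, w ≠ v := fun w hw he => hvP (he ▸ hw)
  have hne' : ∀ w ∈ P, (w : ℕ) ≠ v := fun w hw he => hne w hw (Fin.ext he)
  refine ⟨by rw [Finset.card_insert_of_notMem hvP, h.card], fun w hw => ?_, fun w hw => ?_,
    fun w hw => ?_, fun u w huw hw => ?_, fun w hw => ?_⟩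
  · rcases Finset.mem_insert.1 hw with rfl | hw
    · simp
    · rw [Function.update_of_ne (hne' w hw)]
      have := h.tau_lt w hw; omega
  · rcases Finset.mem_insert.1 hw with rfl | hw
    · simp
    · rw [Function.update_of_ne (hne' w hw),
        Function.update_of_ne (by have := h.tau_lt w hw; omega), h.ord_tau w hw]
  · rw [hdeg]
    rcases Finset.mem_insert.1 hw with rfl | hw
    · rw [if_pos rfl, if_neg (fun hc => hvP (hnone _ hc))]
    · rw [if_neg (hne w hw), if_neg (fun hc => hvP (h.pred v w hc hw).1), h.deg_in w hw]
  · rcases Finset.mem_insert.1 hw with rfl | hw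
    · have hu := hnone u huw
      refine ⟨Finset.mem_insert_of_mem hu, ?_⟩
      rw [Function.update_of_ne (hne' u hu), Function.update_self]
      exact h.tau_lt u hu
    · have hu := h.pred u w huw hw
      refine ⟨Finset.mem_insert_of_mem hu.1, ?_⟩
      rw [Function.update_of_ne (hne' u hu.1), Function.update_of_ne (hne' w hw)]
      exact hu.2
  · rw [Finset.mem_insert, not_or] at hw
    rw [hdeg, if_neg hw.1, h.deg_out w hw.2]
    by_cases hvw : r v w
    · have : (Finset.univ.filter fun u => u ∉ P ∧ r u w) =
          insert v (Finset.univ.filter fun u => u ∉ insert v P ∧ r u w) := by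
        ext u
        simp only [Finset.mem_filter, Finset.mem_univ, true_and, Finset.mem_insert, not_or]
        by_cases hu : u = v
        · subst hu; simp [hvP, hvw]
        · simp [hu]
      rw [this, Finset.card_insert_of_notMem (by simp), if_pos hvw]
      omega
    · rw [if_neg hvw, Nat.sub_zero]
      congr 1
      ext u
      simp only [Finset.mem_filter, Finset.mem_univ, true_and, Finset.mem_insert, not_or]
      by_cases hu : u = v
      · subst hu; simp [hvw]
      · simp [hu]

/-- Compute the indegrees. -/
def countDegrees : AProg :=
  forUp rJ rN
    (forUp rI rN
      (.put aDeg (.reg rJ)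
        (.arr aDeg (.reg rJ) + .lt 0 (.arr aA (.reg rI * .reg rN + .reg rJ)))))

theorem countDegrees_spec {n : ℕ} {s : ASt} (hN : s.reg rN = n) (hnB : n ≤ B)
    (hD : ∀ i, s.arr aDeg i = 0) :
    Tri X B countDegrees s (n * (n + 1)) (fun s' => ∀ v : Fin n, s'.arr aDeg v =
      (Finset.univ.filter fun u : Fin n => 0 < s.arr aA (u * n + v)).card) := by
  have hcard : ∀ v : ℕ, (Finset.univ.filter fun u : Fin n => 0 < s.arr aA (u * n + v)).card =
      partialSum (fun u : Fin n => if 0 < s.arr aA (u * n + v) then 1 else 0) n := fun v => by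
    rw [partialSum_self, Finset.card_filter]
  simp only [hcard]
  refine Tri.mono (Tri.forUp (N := n) (t := n * (0 + 1)) (fun j s' =>
    ∀ v < n, s'.arr aDeg v = if v < j then
      partialSum (fun u : Fin n => if 0 < s.arr aA (u * n + v) then 1 else 0) n else 0)
    hN hnB (by decide) (by decide) (by decide) (fun v _ => by simpa using hD v) ?_)
    (by simp) fun s' h v => by rw [h v v.2, if_pos v.2]
  rintro j s1 hj hF1 hJ1 h1
  have hN1 : s1.reg rN = n := by rw [hF1.reg _ (by decide), hN]
  have hA1 : s1.arr aA = s.arr aA := hF1.arr _ (by decide)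
  refine Tri.mono (Tri.forUp (N := n) (t := 0) (fun i s' => ∀ v < n, s'.arr aDeg v =
    if v < j then partialSum (fun u : Fin n => if 0 < s.arr aA (u * n + v) then 1 else 0) n
    else if v = j then partialSum (fun u : Fin n => if 0 < s.arr aA (u * n + v) then 1 else 0) i
    else 0) hN1 hnB (by decide) (by decide) (by decide) (fun v hv => ?_) ?_) le_rfl ?_
  · simp only [ASt.arr_setReg, h1 v hv, partialSum_zero, ite_self]
  · rintro i s2 hi hF2 hI2 h2
    have hN2 : s2.reg rN = n := by rw [hF2.reg _ (by decide), hN1]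
    have hA2 : s2.arr aA = s.arr aA := by rw [hF2.arr _ (by decide), hA1]
    have hJ2 : s2.reg rJ = j := by rw [hF2.reg _ (by decide), hJ1]
    have hjd := h2 j hj
    rw [if_neg (lt_irrefl j), if_pos rfl] at hjd
    have hle : partialSum (fun u : Fin n => if 0 < s.arr aA (u * n + j) then 1 else 0) (i + 1) ≤ n := by
      refine (partialSum_le _ _).trans ?_
      rw [← Finset.card_filter]
      exact (Finset.card_filter_le _ _).trans (by simp)
    rw [partialSum_succ _ hi] at hle
    apply Tri.flat
    simp only [wp, AExp.fits_add, AExp.val_add, AExp.val_arr, AExp.val_reg, AExp.val_lt,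
      AExp.val_ofNat, AExp.val_mul, hN2, hI2, hJ2, hA2, hjd, forall_eq]
    refine ⟨by simp only at hle; omega, fun _ v hv => ?_⟩
    simp only [ASt.arr_setReg, ASt.arr_setArr, if_true, Function.update_apply]
    by_cases hvj : v = j
    · rw [if_pos hvj, hvj, if_neg (lt_irrefl j), if_pos rfl, partialSum_succ _ hi]
    · rw [if_neg hvj, h2 v hv, if_neg hvj, if_neg hvj]
  · intro s2 h2 hF2 v hv
    simp only [ASt.arr_setReg]
    rw [h2 v hv]
    by_cases hvj : v < j
    · rw [if_pos hvj, if_pos (by omega)]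
    · by_cases hvj' : v = j
      · rw [if_neg hvj, if_pos hvj', if_pos (by omega)]
      · rw [if_neg hvj, if_neg hvj', if_neg (by omega)]

/-- Assign the positions one by one, always to a vertex without remaining predecessors. The degree
of a vertex that has a position is set to `1`, so that it is not chosen again. -/
def assignPositions : AProg :=
  forUp rJ rN
    (.set rU 0 ;;
     forUp rI rN (.ite (.eq (.arr aDeg (.reg rI)) 0) (.set rU (.reg rI)) .skip) ;;
     .put aTau (.reg rU) (.reg rJ) ;; .put aOrd (.reg rJ) (.reg rU) ;; .put aDeg (.reg rU) 1 ;;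
     forUp rI rN
      (.put aDeg (.reg rI)
        (.arr aDeg (.reg rI) - .lt 0 (.arr aA (.reg rU * .reg rN + .reg rI)))))

theorem assignPositions_spec {n : ℕ} {s : ASt} (hN : s.reg rN = n) (hnB : n ≤ B) (hn : 0 < n)
    (hr : ∀ v : Fin n, ¬ Relation.TransGen (fun u v : Fin n => 0 < s.arr aA (u * n + v)) v v)
    (hD : ∀ v : Fin n, s.arr aDeg v =
      (Finset.univ.filter fun u : Fin n => 0 < s.arr aA (u * n + v)).card) :
    Tri X B assignPositions s (n * (2 * n + 1)) (fun s' => ∃ τ : Fin n → Fin n,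
      Function.Bijective τ ∧ (∀ v : Fin n, s'.arr aTau v = τ v) ∧
      (∀ v : Fin n, s'.arr aOrd (τ v) = v) ∧
      ∀ u v : Fin n, 0 < s.arr aA (u * n + v) → τ u < τ v) := by
  refine Tri.mono (Tri.forUp (N := n) (t := 2 * n) (fun i s' => ∃ P,
    IsPartialSort (fun u v : Fin n => 0 < s.arr aA (u * n + v)) i P (s'.arr aDeg) (s'.arr aTau)
      (s'.arr aOrd)) hN hnB (by decide) (by decide) (by decide)
    ⟨∅, ⟨rfl, by simp, by simp, by simp, by simp, fun v _ => by simpa using hD v⟩⟩ ?_) le_rfl ?_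
  · rintro i s1 hi hF1 hJ1 ⟨P, hP⟩
    have hN1 : s1.reg rN = n := by rw [hF1.reg _ (by decide), hN]
    have hA1 : s1.arr aA = s.arr aA := hF1.arr _ (by decide)
    obtain ⟨v0, hv0⟩ := exists_deg_eq_zero hr hP hi
    refine Tri.mono (Tri.seq (J₁ := 0) (J₂ := n * 1 + (0 + (0 + (0 + n * 1))))
      (Q := fun s' => s' = s1.setReg rU 0) (Tri.flat ?_) ?_) (by omega) fun _ h => h
    · simp [wp]
    rintro s2 rfl -
    refine Tri.seq (Tri.forUp (N := n) (t := 0) (fun k s' => s'.reg rU < n ∧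
      ((∃ w < k, s1.arr aDeg w = 0) → s1.arr aDeg (s'.reg rU) = 0)) (by simpa using hN1) hnB
      (by decide) (by decide) (by decide) ⟨by simpa using hn, by rintro ⟨w, hw, -⟩; omega⟩ ?_) ?_
    · rintro k s2 hk hF2 hI2 ⟨h2, h2'⟩
      have hD2 : s2.arr aDeg = s1.arr aDeg := by rw [hF2.arr _ (by decide)]; rfl
      apply Tri.flat
      simp only [wp, AExp.val_eq, AExp.val_arr, AExp.val_reg, AExp.val_ofNat, hI2, hD2,
        ite_one_ne_zero, ite_one_eq_zero, AExp.fits_reg, forall_eq, true_and]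
      refine ⟨fun h => ?_, fun h => ?_⟩
      · intro _
        exact ⟨by simpa using hk, fun _ => by simpa using h⟩
      · intro _
        refine ⟨by simpa using h2, ?_⟩
        rintro ⟨w, hw, hw0⟩
        have : w ≠ k := by rintro rfl; exact h hw0
        simpa using h2' ⟨w, by omega, hw0⟩
    rintro s2 ⟨h2, h2'⟩ hF2
    have hv := h2' ⟨v0, v0.2, hv0⟩
    set v : Fin n := ⟨s2.reg rU, h2⟩ with hvdef
    have hvr : s2.reg rU = v := rfl
    have hN2 : s2.reg rN = n := by rw [hF2.reg _ (by decide)]; simpa using hN1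
    have hJ2 : s2.reg rJ = i := by rw [hF2.reg _ (by decide)]; simpa using hJ1
    have ha2 : s2.arr = s1.arr := by
      funext k; rw [hF2.arr _ (by revert k; decide)]; rfl
    refine Tri.seq (J₁ := 0) (Q := fun s' => s' = s2.setArr aTau v i) (Tri.flat ?_) ?_
    · simp only [wp, AExp.fits_reg, AExp.val_reg, hJ2, forall_eq, true_and, hvr]
    rintro s3 rfl -
    refine Tri.seq (J₁ := 0) (Q := fun s' => s' = (s2.setArr aTau v i).setArr aOrd i v)
      (Tri.flat ?_) ?_
    · simp only [wp, AExp.fits_reg, AExp.val_reg, ASt.reg_setArr, hJ2, forall_eq, true_and, hvr]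
    rintro s3 rfl -
    refine Tri.seq (J₁ := 0) (Q := fun s' => s' =
      ((s2.setArr aTau v i).setArr aOrd i v).setArr aDeg v 1) (Tri.flat ?_) ?_
    · simp only [wp, AExp.fits_ofNat, AExp.val_reg, AExp.val_ofNat, ASt.reg_setArr, forall_eq,
        and_true, hvr]
      omega
    rintro s3 rfl -
    refine Tri.mono (Tri.forUp (N := n) (t := 0) (fun k s' => ∀ w : Fin n, s'.arr aDeg w =
      (if w = v then 1 else s1.arr aDeg w) - if (w : ℕ) < k ∧ 0 < s.arr aA (v * n + w) then 1 else 0)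
      (by simpa using hN2) hnB (by decide) (by decide) (by decide) (fun w => ?_) ?_).framed le_rfl ?_
    · simp [ha2, Function.update_apply, Fin.val_inj]
    · rintro k s4 hk hF4 hI4 h4
      have hA4 : s4.arr aA = s.arr aA := by
        rw [hF4.arr _ (by decide)]; simp [ha2, hA1]
      have hN4 : s4.reg rN = n := by rw [hF4.reg _ (by decide)]; simpa using hN2
      have hU4 : s4.reg rU = v := by rw [hF4.reg _ (by decide)]; simp [hvr]
      apply Tri.flat
      simp only [wp, AExp.fits_sub, AExp.fits_arr, AExp.val_sub, AExp.val_arr, AExp.val_reg,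
        AExp.val_lt, AExp.val_ofNat, AExp.val_add, AExp.val_mul, hI4, hN4, hU4, hA4, forall_eq,
        true_and]
      intro _ w
      simp only [ASt.arr_setReg, ASt.arr_setArr, if_true, Function.update_apply]
      by_cases hwk : (w : ℕ) = k
      · rw [if_pos hwk, ← hwk, h4 w]
        simp [hwk]
      · rw [if_neg hwk, h4 w]
        have : (w : ℕ) < k + 1 ↔ (w : ℕ) < k := by omega
        simp only [this]
    · rintro s5 ⟨h5, hF5⟩ hFb
      have hT5 : s5.arr aTau = Function.update (s1.arr aTau) v i := by
        rw [hF5.arr _ (by decide)]; simp [ha2]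
      have hO5 : s5.arr aOrd = Function.update (s1.arr aOrd) i v := by
        rw [hF5.arr _ (by decide)]; simp [ha2]
      refine ⟨insert v P, ?_⟩
      simp only [ASt.arr_setReg, hT5, hO5]
      refine hP.insert_vertex hv fun w => ?_
      rw [h5 w]
      simp [w.2]
  · rintro s1 ⟨P, hP⟩
    have hall : ∀ v, v ∈ P := by
      have : P = Finset.univ := by
        rw [← Finset.card_eq_iff_eq_univ, hP.card, Fintype.card_fin]
      intro v; rw [this]; exact Finset.mem_univ v
    refine ⟨fun v => ⟨s1.arr aTau v, hP.tau_lt v (hall v)⟩, ?_, fun v => rfl,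
      fun v => hP.ord_tau v (hall v), fun u v huv => (hP.pred u v huv (hall v)).2⟩
    refine Finite.injective_iff_bijective.1 fun u v huv => ?_
    have h1 := hP.ord_tau u (hall u)
    rw [show s1.arr aTau u = s1.arr aTau v from congrArg Fin.val huv,
      hP.ord_tau v (hall v)] at h1
    exact Fin.ext h1.symm

/-! ### The capacity matrix and the bottleneck values -/

/-- Write the merged capacities in the order of the positions. -/
def buildMatrix : AProg :=
  .set rS (.arr aTau (.reg rS0)) ;; .set rT (.arr aTau (.reg rT0)) ;;
  forUp rJ rNN
    (.put aC (.reg rJ)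
      (.arr aA (.arr aOrd (.reg rJ / .reg rN) * .reg rN + .arr aOrd (.reg rJ % .reg rN))))

theorem buildMatrix_spec {n : ℕ} {s : ASt} (hN : s.reg rN = n) (hNN : s.reg rNN = n * n)
    (hB : n * n ≤ B) :
    Tri X B buildMatrix s (n * n) (fun s' =>
      s'.reg rS = s.arr aTau (s.reg rS0) ∧ s'.reg rT = s.arr aTau (s.reg rT0) ∧
      ∀ i j : Fin n, toMatrix n (s'.arr aC) i j =
        s.arr aA (s.arr aOrd i * n + s.arr aOrd j)) := by
  refine Tri.mono (Tri.seq (J₁ := 0) (J₂ := n * n * 1)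
    (Q := fun s' => s' = s.setReg rS (s.arr aTau (s.reg rS0))) (Tri.flat ?_) ?_)
    (by omega) fun _ h => h
  · simp [wp]
  rintro s1 rfl -
  refine Tri.mono (Tri.seq (J₁ := 0) (J₂ := n * n * 1) (Q := fun s' =>
    s' = (s.setReg rS (s.arr aTau (s.reg rS0))).setReg rT (s.arr aTau (s.reg rT0))) (Tri.flat ?_) ?_)
    (by omega) fun _ h => h
  · simp [wp]
  rintro s1 rfl -
  refine Tri.mono (Tri.forUp (N := n * n) (t := 0) (fun k s' => ∀ l < k, s'.arr aC l =
    s.arr aA (s.arr aOrd (l / n) * n + s.arr aOrd (l % n))) (by simpa using hNN) hB (by decide)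
    (by decide) (by decide) (fun l hl => absurd hl (by omega)) ?_).framed le_rfl ?_
  · rintro k s1 hk hF1 hJ1 h1
    have hN1 : s1.reg rN = n := by rw [hF1.reg _ (by decide)]; simpa using hN
    have hA1 : s1.arr aA = s.arr aA := hF1.arr _ (by decide)
    have hO1 : s1.arr aOrd = s.arr aOrd := hF1.arr _ (by decide)
    apply Tri.flat
    simp only [wp, AExp.fits_arr, AExp.val_arr, AExp.val_add, AExp.val_mul, AExp.val_div,
      AExp.val_mod, AExp.val_reg, hJ1, hN1, hA1, hO1, forall_eq, true_and]
    intro _ l hl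
    simp only [ASt.arr_setReg, ASt.arr_setArr, if_true, Function.update_apply]
    split_ifs with hlk
    · rw [hlk]
    · exact h1 l (by omega)
  · rintro s1 ⟨h1, hF1⟩
    refine ⟨by rw [hF1.reg _ (by decide)]; simp, by rw [hF1.reg _ (by decide)]; simp,
      fun i j => ?_⟩
    have hn : 0 < n := i.pos
    unfold toMatrix
    rw [h1 _ (index_lt i.2 j.2)]
    have hd : ((i : ℕ) * n + j) / n = i := by
      rw [mul_comm, Nat.mul_add_div hn, Nat.div_eq_of_lt j.2, add_zero]
    have hm : ((i : ℕ) * n + j) % n = j := by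
      rw [mul_comm, Nat.mul_add_mod, Nat.mod_eq_of_lt j.2]
    rw [hd, hm]

/-- Compute the bottleneck values in the order of the positions. The value of the source is the sum
of all capacities, which is as good as infinity. -/
def bottleneck : AProg :=
  .put aB (.reg rS) (.reg rTot) ;;
  forUp rJ rN
    (.ite (.eq (.reg rJ) (.reg rS)) .skip
      (.set rX 0 ;;
       forUp rI rJ
        (.set rY (.arr aC (.reg rI * .reg rN + .reg rJ)) ;;
         .ite (.lt (.arr aB (.reg rI)) (.reg rY)) (.set rY (.arr aB (.reg rI))) .skip ;;
         .ite (.lt (.reg rX) (.reg rY)) (.set rX (.reg rY)) .skip) ;;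
       .put aB (.reg rJ) (.reg rX)))

/-- The value `x` is the maximum of `min (b i) (c i)` over the positions `i < k`. -/
structure IsMaxMin (b c : ℕ → ℕ) (k x : ℕ) : Prop where
  le : ∀ i < k, min (b i) (c i) ≤ x
  attained : x = 0 ∨ ∃ i < k, x ≤ b i ∧ x ≤ c i

theorem IsMaxMin.congr {b b' c : ℕ → ℕ} {k x : ℕ} (h : IsMaxMin b c k x)
    (hb : ∀ i < k, b' i = b i) : IsMaxMin b' c k x := by
  refine ⟨fun i hi => by rw [hb i hi]; exact h.le i hi, h.attained.imp_right ?_⟩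
  rintro ⟨i, hi, h1⟩
  exact ⟨i, hi, by rwa [hb i hi]⟩

theorem IsMaxMin.succ {b c : ℕ → ℕ} {k x : ℕ} (h : IsMaxMin b c k x) :
    IsMaxMin b c (k + 1) (max x (min (b k) (c k))) := by
  refine ⟨fun i hi => ?_, ?_⟩
  · rcases Nat.lt_succ_iff_lt_or_eq.1 hi with hi | rfl
    · exact (h.le i hi).trans (le_max_left _ _)
    · exact le_max_right _ _
  · rcases le_total x (min (b k) (c k)) with hx | hx
    · rw [max_eq_right hx]
      exact Or.inr ⟨k, by omega, min_le_left _ _, min_le_right _ _⟩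
    · rw [max_eq_left hx]
      refine h.attained.imp_right ?_
      rintro ⟨i, hi, h1⟩
      exact ⟨i, by omega, h1⟩

theorem bottleneck_spec {n tot : ℕ} {S : Fin n} {s : ASt} (hN : s.reg rN = n)
    (hS : s.reg rS = S) (htot : s.reg rTot = tot) (hnB : n ≤ B)
    (hC : ∀ i j, toMatrix n (s.arr aC) i j ≤ tot) :
    Tri X B bottleneck s (n * (n + 1)) (fun s' =>
      IsBottleneck (toMatrix n (s.arr aC)) S (fun v => s'.arr aB v) ∧
      ∀ v : Fin n, s'.arr aB v ≤ tot) := by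
  refine Tri.mono (Tri.seq (J₁ := 0) (Q := fun s' => s' = s.setArr aB S tot) (Tri.flat ?_) ?_)
    (Nat.zero_add _).le fun _ h => h
  · simp [wp, hS, htot]
  rintro s1 rfl -
  refine Tri.mono (Tri.forUp (N := n) (t := n) (fun j s' => s'.arr aB S = tot ∧
    (∀ v < j, v ≠ S → IsMaxMin (s'.arr aB) (fun i => s.arr aC (i * n + v)) v (s'.arr aB v)) ∧
    ∀ v < j, s'.arr aB v ≤ tot) (by simpa using hN) hnB (by decide) (by decide) (by decide)
    ⟨by simp, fun v hv => absurd hv (by omega), fun v hv => absurd hv (by omega)⟩ ?_) le_rfl ?_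
  · rintro j s1 hj hF1 hJ1 ⟨h1, h1', h1''⟩
    have hN1 : s1.reg rN = n := by rw [hF1.reg _ (by decide)]; simpa using hN
    have hS1 : s1.reg rS = S := by rw [hF1.reg _ (by decide)]; simpa using hS
    have hC1 : s1.arr aC = s.arr aC := by rw [hF1.arr _ (by decide)]; simp
    refine Tri.ite (fun hb => Tri.flat ?_) (fun hb => ?_)
    · simp only [AExp.val_eq, AExp.val_reg, hJ1, hS1, ite_one_ne_zero] at hb
      intro _
      refine ⟨h1, fun v hv hvS => h1' v (by omega) hvS, fun v hv => ?_⟩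
      by_cases hvj : v = j
      · simp only [ASt.arr_setReg, hvj, hb, h1, le_refl]
      · exact h1'' v (by omega)
    simp only [AExp.val_eq, AExp.val_reg, hJ1, hS1, ite_one_eq_zero] at hb
    refine Tri.mono (Tri.seq (J₁ := 0) (J₂ := j * 1 + 0) (Q := fun s' => s' = s1.setReg rX 0)
      (Tri.flat ?_) ?_) (by omega) fun _ h => h
    · simp [wp]
    rintro s2 rfl -
    refine Tri.seq (Tri.forUp (N := j) (t := 0) (fun k s' =>
      IsMaxMin (s1.arr aB) (fun i => s.arr aC (i * n + j)) k (s'.reg rX) ∧ s'.reg rX ≤ tot)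
      (by simpa using hJ1) (by omega) (by decide) (by decide) (by decide)
      ⟨⟨fun i hi => absurd hi (by omega), Or.inl (by simp)⟩, by simp⟩ ?_) ?_
    · rintro k s2 hk hF2 hI2 ⟨h2, h2'⟩
      have hN2 : s2.reg rN = n := by rw [hF2.reg _ (by decide)]; simpa using hN1
      have hJ2 : s2.reg rJ = j := by rw [hF2.reg _ (by decide)]; simpa using hJ1
      have hC2 : s2.arr aC = s.arr aC := by rw [hF2.arr _ (by decide)]; simpa using hC1
      have hB2 : s2.arr aB = s1.arr aB := by rw [hF2.arr _ (by decide)]; simp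
      have h3 := h2.succ
      have hle := h1'' k (by omega)
      set y := s1.arr aB k with hy
      set c := s.arr aC (k * n + j) with hc
      set x := s2.reg rX with hx
      have key : ∀ r : ℕ, r = max x (min y c) →
          IsMaxMin (s1.arr aB) (fun i => s.arr aC (i * n + j)) (k + 1) r ∧ r ≤ tot := by
        intro r hs'
        rw [hs']
        exact ⟨h3, by omega⟩
      apply Tri.flat
      simp only [wp, AExp.fits_arr, AExp.val_arr, AExp.val_add, AExp.val_mul, AExp.val_reg,
        hI2, hN2, hJ2, hC2, hB2, forall_eq, true_and, AExp.val_lt, ASt.reg_setReg, ASt.arr_setReg,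
        ite_one_ne_zero, ite_one_eq_zero, Nat.reduceEqDiff, if_false, if_true, AExp.fits_reg,
        ← hy, ← hc, ← hx]
      refine ⟨fun h4 => ⟨fun h5 _ => key _ ?_, fun h5 _ => key _ ?_⟩,
        fun h4 => ⟨fun h5 _ => key _ ?_, fun h5 _ => key _ ?_⟩⟩ <;>
      · omega
    · rintro s2 ⟨h2, h2'⟩ hF2
      have hJ2 : s2.reg rJ = j := by rw [hF2.reg _ (by decide)]; simpa using hJ1
      have hB2 : s2.arr aB = s1.arr aB := by rw [hF2.arr _ (by decide)]; simp
      apply Tri.flat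
      simp only [wp, AExp.fits_reg, AExp.val_reg, hJ2, forall_eq, true_and]
      intro _
      simp only [ASt.arr_setReg, ASt.arr_setArr, if_true, hB2]
      have hne : ∀ v, v ≠ j → Function.update (s1.arr aB) j (s2.reg rX) v = s1.arr aB v :=
        fun v hv => Function.update_of_ne hv _ _
      refine ⟨by rw [hne _ (Ne.symm hb), h1], fun v hv hvS => ?_, fun v hv => ?_⟩
      · by_cases hvj : v = j
        · subst hvj
          rw [Function.update_self]
          exact h2.congr fun i hi => hne i (by omega)
        · rw [hne v hvj]
          exact (h1' v (by omega) hvS).congr fun i hi => hne i (by omega)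
      · by_cases hvj : v = j
        · subst hvj
          rwa [Function.update_self]
        · rw [hne v hvj]
          exact h1'' v (by omega)
  · rintro s1 ⟨h1, h1', h1''⟩
    refine ⟨⟨fun i j hij hjS => (h1' j j.2 fun h => hjS (Fin.ext h)).le i hij, fun j hjS => ?_,
      fun i j => ?_⟩, fun v => h1'' v v.2⟩
    · refine (h1' j j.2 fun h => hjS (Fin.ext h)).attained.imp_right ?_
      rintro ⟨i, hi, h2⟩
      exact ⟨⟨i, hi.trans j.2⟩, hi, h2⟩
    · simp only [h1]; exact hC i j

/-! ### Cancelling the excess and distributing the flow -/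

/-- In reverse order of the positions, send the excess of the vertices other than the terminals back
along the incoming edges. -/
def cancelExcess : AProg :=
  forUp rJ rN
    (.set rV (.reg rN - 1 - .reg rJ) ;;
     .ite (.eq (.reg rV) (.reg rS)) .skip
      (.ite (.eq (.reg rV) (.reg rT)) .skip
        (forUp rI rV
          (.set rX (.arr aEx (.reg rV)) ;;
           .set rY (.arr aR (.reg rV * .reg rN + .reg rI)) ;;
           .ite (.lt (.reg rY) (.reg rX)) (.set rX (.reg rY)) .skip ;;
           .put aR (.reg rV * .reg rN + .reg rI) (.reg rY - .reg rX) ;;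
           .put aEx (.reg rV) (.arr aEx (.reg rV) - .reg rX) ;;
           .put aEx (.reg rI) (.arr aEx (.reg rI) + .reg rX)))))

/-- The preflow while excess is cancelled: the last `p` vertices have no excess any more, apart from
the terminals, and at least `e₀` units are at the sink. -/
structure IsPartlyCancelled {n : ℕ} (C : Fin n → Fin n → ℕ) (S T : Fin n) (F e₀ p : ℕ)
    (R : Fin n → Fin n → ℕ) (ex : Fin n → ℕ) : Prop where
  bal : IsBalanced S F (lowerFlow R) ex
  le_cap : ∀ i j, lowerFlow R i j ≤ C i j
  le_sink : e₀ ≤ ex T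
  done : ∀ v : Fin n, n ≤ v + p → v ≠ S → v ≠ T → ex v = 0

theorem IsPartlyCancelled.cancel {n : ℕ} {C : Fin n → Fin n → ℕ} {S T : Fin n} {F e₀ p : ℕ}
    {R R' : Fin n → Fin n → ℕ} {ex ex' : Fin n → ℕ} (h : IsPartlyCancelled C S T F e₀ p R ex)
    {u v : Fin n} (huv : u < v) (hvT : v ≠ T) (hp : v + p < n) {d : ℕ} (hd : d ≤ R v u)
    (hR : ∀ i j, R' i j = if i = v ∧ j = u then R i j - d else R i j)
    (hex : ∀ w, ex' w + (if w = v then d else 0) = ex w + if w = u then d else 0) :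
    IsPartlyCancelled C S T F e₀ p R' ex' := by
  have hle : ∀ i j, lowerFlow R' i j + (if i = u ∧ j = v then d else 0) = lowerFlow R i j := by
    intro i j
    unfold lowerFlow
    rw [hR]
    by_cases hij : i = u ∧ j = v
    · rw [hij.1, hij.2, if_pos huv, if_pos huv, if_pos ⟨rfl, rfl⟩, if_pos ⟨rfl, rfl⟩]
      omega
    · have hji : ¬(j = v ∧ i = u) := fun h' => hij ⟨h'.2, h'.1⟩
      rw [if_neg hij, if_neg hji, add_zero]
  refine ⟨h.bal.cancel hle hex, fun i j => ?_, ?_, fun w hw hwS hwT => ?_⟩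
  · have := hle i j
    have := h.le_cap i j
    omega
  · have h1 := hex T
    rw [if_neg (Ne.symm hvT)] at h1
    have := h.le_sink
    omega
  · have h1 := hex w
    have hwv : (v : ℕ) < w := by omega
    have hwu : (u : ℕ) < w := lt_trans huv hwv
    rw [if_neg (fun he => by rw [he] at hwv; omega),
      if_neg (fun he => by rw [he] at hwu; omega), h.done w hw hwS hwT] at h1
    omega

/-- A vertex without incoming flow has no excess, except for the source. -/
theorem IsBalanced.ex_eq_zero {n : ℕ} {s v : Fin n} {F : ℕ} {f : Fin n → Fin n → ℕ}
    {ex : Fin n → ℕ} (h : IsBalanced s F f ex) (hv : v ≠ s) (h0 : ∀ i, f i v = 0) : ex v = 0 := by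
  have h1 := h v
  rw [if_neg hv, Finset.sum_eq_zero fun i _ => h0 i] at h1
  omega

theorem cancelExcess_spec {n F : ℕ} {C : Fin n → Fin n → ℕ} {S T : Fin n} {s : ASt}
    (hc : Ctx n S T s) (hnB : n ≤ B) (hFB : F ≤ B)
    (hbal : IsBalanced S F (lowerFlow (toMatrix n (s.arr aR))) (fun v => s.arr aEx v))
    (hle : ∀ i j, lowerFlow (toMatrix n (s.arr aR)) i j ≤ C i j) :
    Tri X B cancelExcess s (n * (n + 1)) (fun s' =>
      IsPartlyCancelled C S T F (s.arr aEx T) n (toMatrix n (s'.arr aR)) (fun v => s'.arr aEx v)) := by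
  refine Tri.forUp (N := n) (t := n) (fun p s' => IsPartlyCancelled C S T F (s.arr aEx T) p
    (toMatrix n (s'.arr aR)) (fun v => s'.arr aEx v)) hc.size hnB (by decide) (by decide)
    (by decide) ⟨hbal, hle, le_rfl, fun v hv => absurd hv (by omega)⟩ ?_
  rintro p s1 hp hF1 hJ1 h1
  have hc1 := hc.frame hF1 (by decide)
  set v : Fin n := ⟨n - 1 - p, by omega⟩ with hv
  have hvn : (v : ℕ) + p + 1 = n := by simp only [hv]; omega
  have hsucc : ∀ (R : Fin n → Fin n → ℕ) (ex : Fin n → ℕ),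
      IsPartlyCancelled C S T F (s.arr aEx T) p R ex → (v ≠ S → v ≠ T → ex v = 0) →
      IsPartlyCancelled C S T F (s.arr aEx T) (p + 1) R ex := by
    intro R ex h hz
    refine ⟨h.bal, h.le_cap, h.le_sink, fun w hw hwS hwT => ?_⟩
    by_cases hwv : w = v
    · rw [hwv] at hwS hwT ⊢; exact hz hwS hwT
    · have : (w : ℕ) ≠ v := fun he => hwv (Fin.ext he)
      exact h.done w (by omega) hwS hwT
  refine Tri.mono (Tri.seq (J₁ := 0) (J₂ := n) (Q := fun s' => s' = s1.setReg rV v)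
    (Tri.flat ?_) ?_) (by omega) fun _ h => h
  · simp [wp, hJ1, hc1.size, hv]
  rintro s2 rfl -
  refine Tri.ite (fun hb => Tri.flat fun _ => ?_) (fun hb => ?_)
  · simp only [AExp.val_eq, AExp.val_reg, ASt.reg_setReg, hc1.source, ite_one_ne_zero, if_true,
      Nat.reduceEqDiff, if_false, Fin.val_inj] at hb
    exact hsucc _ _ h1 fun h => absurd hb h
  simp only [AExp.val_eq, AExp.val_reg, ASt.reg_setReg, hc1.source, ite_one_eq_zero, if_true,
    Nat.reduceEqDiff, if_false, Fin.val_inj] at hb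
  refine Tri.ite (fun hb' => Tri.flat fun _ => ?_) (fun hb' => ?_)
  · simp only [AExp.val_eq, AExp.val_reg, ASt.reg_setReg, hc1.sink, ite_one_ne_zero, if_true,
      Nat.reduceEqDiff, if_false, Fin.val_inj] at hb'
    exact hsucc _ _ h1 fun _ h => absurd hb' h
  simp only [AExp.val_eq, AExp.val_reg, ASt.reg_setReg, hc1.sink, ite_one_eq_zero, if_true,
    Nat.reduceEqDiff, if_false, Fin.val_inj] at hb'
  refine Tri.mono (Tri.forUp (N := v) (t := 0) (fun k s' =>
    IsPartlyCancelled C S T F (s.arr aEx T) p (toMatrix n (s'.arr aR)) (fun v => s'.arr aEx v) ∧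
    (s'.arr aEx v ≠ 0 → ∀ u : Fin n, (u : ℕ) < k → toMatrix n (s'.arr aR) v u = 0))
    (by simp) (by omega) (by decide) (by decide) (by decide) ⟨h1, fun _ u hu => absurd hu (by omega)⟩
    ?_) (by have := v.2; omega) ?_
  · rintro k s2 hk hF2 hI2 ⟨h2, h2'⟩
    set u : Fin n := ⟨k, hk.trans v.2⟩ with hu
    have huk : (u : ℕ) = k := rfl
    have huv : u < v := hk
    have hN2 : s2.reg rN = n := by rw [hF2.reg _ (by decide)]; simpa using hc1.size
    have hV2 : s2.reg rV = v := by rw [hF2.reg _ (by decide)]; simp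
    have hI2' : s2.reg rI = u := hI2
    have hvu : (v : ℕ) ≠ u := fun h => absurd huv (by rw [Fin.lt_def]; omega)
    have hsum := h2.bal.sum_ex
    have hpair : s2.arr aEx u + s2.arr aEx v ≤ F := by
      rw [← hsum]
      have := Finset.sum_le_sum_of_subset (f := fun v : Fin n => s2.arr aEx v)
        (Finset.subset_univ {u, v})
      rwa [Finset.sum_pair huv.ne] at this
    set d := min (s2.arr aEx v) (s2.arr aR (v * n + u)) with hd
    have hRvu : toMatrix n (s2.arr aR) v u = s2.arr aR (v * n + u) := rfl
    have key : ∀ a e : ℕ → ℕ,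
        a = Function.update (s2.arr aR) (v * n + u) (s2.arr aR (v * n + u) - d) →
        e = Function.update (Function.update (s2.arr aEx) v (s2.arr aEx v - d)) u
          (s2.arr aEx u + d) →
        IsPartlyCancelled C S T F (s.arr aEx T) p (toMatrix n a) (fun v => e v) ∧
        (e v ≠ 0 → ∀ w : Fin n, (w : ℕ) < k + 1 → toMatrix n a v w = 0) := by
      intro a e hR' hE'
      have hR : ∀ i j, toMatrix n a i j = if i = v ∧ j = u then
          toMatrix n (s2.arr aR) i j - d else toMatrix n (s2.arr aR) i j := by
        intro i j
        unfold toMatrix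
        rw [hR', Function.update_apply]
        simp only [index_inj]
        split_ifs with hij
        · rw [hij.1, hij.2]
        · rfl
      have hEv : e v = s2.arr aEx v - d := by
        rw [hE', Function.update_of_ne hvu, Function.update_self]
      refine ⟨h2.cancel huv hb' (by omega) (min_le_right _ _) hR fun w => ?_, fun h0 w hw => ?_⟩
      · simp only [hE', Function.update_apply, Fin.val_inj]
        by_cases hwu : w = u
        · have hwv : w ≠ v := hwu ▸ huv.ne
          simp only [hwu, if_true, if_neg huv.ne]
          omega
        · by_cases hwv : w = v
          · simp only [hwv, if_true, if_neg huv.ne']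
            omega
          · simp only [hwu, hwv, if_false]
      · rw [hEv] at h0
        rw [hR]
        by_cases hwu : w = u
        · rw [if_pos ⟨rfl, hwu⟩, hwu]
          omega
        · rw [if_neg (fun h => hwu h.2)]
          have : (w : ℕ) ≠ u := fun h => hwu (Fin.ext h)
          exact h2' (by omega) w (by omega)
    apply Tri.flat
    simp only [wp, AExp.fits_arr, AExp.val_arr, AExp.val_add, AExp.val_mul, AExp.val_reg,
      hI2', hN2, hV2, forall_eq, true_and, AExp.val_lt, ASt.reg_setReg, ASt.arr_setReg,
      ite_one_ne_zero, ite_one_eq_zero, Nat.reduceEqDiff, if_false, if_true, AExp.fits_reg,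
      AExp.fits_sub, AExp.val_sub, ASt.reg_setArr, ASt.arr_setArr, Fin.reduceEq, AExp.fits_add,
      Function.update_of_ne (Ne.symm hvu)]
    refine ⟨fun h4 => ⟨by omega, fun _ => key _ _ ?_ ?_⟩, fun h4 => ⟨by omega, fun _ => key _ _ ?_ ?_⟩⟩
    · rw [show d = s2.arr aR (v * n + u) by omega]
    · rw [show d = s2.arr aR (v * n + u) by omega]
    · rw [show d = s2.arr aEx v by omega]
    · rw [show d = s2.arr aEx v by omega]
  · rintro s2 ⟨h2, h2'⟩ -
    refine hsucc _ _ h2 fun _ _ => ?_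
    by_contra h0
    refine h0 (h2.bal.ex_eq_zero hb fun i => ?_)
    unfold lowerFlow
    split_ifs with hi
    · exact h2' h0 i hi
    · rfl

theorem partialSum_congr {m i : ℕ} {g g' : Fin m → ℕ} (h : ∀ e : Fin m, (e : ℕ) < i → g e = g' e) :
    partialSum g i = partialSum g' i :=
  Finset.sum_congr rfl fun e _ => by split_ifs with he; exacts [h e he, rfl]

/-- Distribute the flow greedily over parallel edges, and write the output. -/
def distribute : AProg :=
  forUp rJ rM
    (.get rU (4 + 3 * .reg rJ) ;; .get rW (4 + 3 * .reg rJ + 1) ;; .get rX (4 + 3 * .reg rJ + 2) ;;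
     .set rV (.arr aTau (.reg rW) * .reg rN + .arr aTau (.reg rU)) ;;
     .ite (.lt (.arr aR (.reg rV)) (.reg rX)) (.set rX (.arr aR (.reg rV))) .skip ;;
     .put aR (.reg rV) (.arr aR (.reg rV) - .reg rX) ;;
     .out (4 + 3 * .reg rM + .reg rJ) (.reg rX))

/-- The state of the distribution of the flow values `f` after `k` edges: a pair of vertices for
which flow is left is such that the remaining edges have enough capacity for it. -/
structure IsPartlyDistributed {n m : ℕ} (N : FlowNetwork n m) (τ : Fin n → Fin n)
    (f : Fin n → Fin n → ℕ) (k : ℕ) (R : Fin n → Fin n → ℕ) (o : Fin m → ℕ) : Prop where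
  le_cap : ∀ e : Fin m, (e : ℕ) < k → o e ≤ N.cap e
  sum : ∀ i j, i < j → R j i +
    partialSum (fun e => if τ (N.src e) = i ∧ τ (N.tgt e) = j then o e else 0) k = f i j
  room : ∀ i j, i < j → R j i = 0 ∨ R j i +
    partialSum (fun e => if τ (N.src e) = i ∧ τ (N.tgt e) = j then N.cap e else 0) k ≤
      N.merge τ N.cap i j

theorem IsPartlyDistributed.succ {n m : ℕ} {N : FlowNetwork n m} {τ : Fin n → Fin n}
    {f : Fin n → Fin n → ℕ} {k : ℕ} {R R' : Fin n → Fin n → ℕ} {o o' : Fin m → ℕ}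
    (h : IsPartlyDistributed N τ f k R o) (hk : k < m) {d : ℕ}
    (hd : d = min (R (τ (N.tgt ⟨k, hk⟩)) (τ (N.src ⟨k, hk⟩))) (N.cap ⟨k, hk⟩))
    (hR : ∀ i j, R' i j = if i = τ (N.tgt ⟨k, hk⟩) ∧ j = τ (N.src ⟨k, hk⟩) then R i j - d
      else R i j)
    (ho : ∀ e : Fin m, o' e = if (e : ℕ) = k then d else o e) :
    IsPartlyDistributed N τ f (k + 1) R' o' := by
  have ho' : ∀ e : Fin m, (e : ℕ) < k → o' e = o e := fun e he => by
    rw [ho, if_neg (by omega)]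
  have hok : o' ⟨k, hk⟩ = d := by rw [ho, if_pos rfl]
  refine ⟨fun e he => ?_, fun i j hij => ?_, fun i j hij => ?_⟩
  · rcases Nat.lt_succ_iff_lt_or_eq.1 he with he | he
    · rw [ho' e he]; exact h.le_cap e he
    · have : e = ⟨k, hk⟩ := Fin.ext he
      rw [this, hok, hd]; exact min_le_right _ _
  · rw [partialSum_succ _ hk, partialSum_congr (g' := fun e =>
      if τ (N.src e) = i ∧ τ (N.tgt e) = j then o e else 0) fun e he => by rw [ho' e he], hok, hR]
    have h1 := h.sum i j hij
    by_cases he : τ (N.src ⟨k, hk⟩) = i ∧ τ (N.tgt ⟨k, hk⟩) = j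
    · rw [if_pos he, if_pos ⟨he.2.symm, he.1.symm⟩]
      rw [he.1, he.2] at hd
      omega
    · rw [if_neg he, if_neg (fun h' => he ⟨h'.2.symm, h'.1.symm⟩), add_zero]
      exact h1
  · rw [partialSum_succ _ hk, hR]
    have h1 := h.room i j hij
    by_cases he : τ (N.src ⟨k, hk⟩) = i ∧ τ (N.tgt ⟨k, hk⟩) = j
    · rw [if_pos he, if_pos ⟨he.2.symm, he.1.symm⟩]
      rw [he.1, he.2] at hd
      omega
    · rw [if_neg he, if_neg (fun h' => he ⟨h'.2.symm, h'.1.symm⟩), add_zero]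
      exact h1

theorem IsPartlyDistributed.merge_eq {n m : ℕ} {N : FlowNetwork n m} {τ : Fin n → Fin n}
    {f : Fin n → Fin n → ℕ} {R : Fin n → Fin n → ℕ} {o : Fin m → ℕ}
    (h : IsPartlyDistributed N τ f m R o) (hC : ∀ i j, 0 < N.merge τ N.cap i j → i < j)
    (hf : ∀ i j, f i j ≤ N.merge τ N.cap i j) (i j : Fin n) : N.merge τ o i j = f i j := by
  by_cases hij : i < j
  · have h1 := h.sum i j hij
    have h2 := h.room i j hij
    rw [partialSum_self] at h1 h2
    unfold FlowNetwork.merge at h2 ⊢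
    omega
  · have h0 : N.merge τ N.cap i j = 0 := by
      by_contra hc
      exact hij (hC i j (Nat.pos_of_ne_zero hc))
    have h1 : N.merge τ o i j ≤ N.merge τ N.cap i j :=
      Finset.sum_le_sum fun e _ => by split_ifs; exacts [h.le_cap e e.2, le_rfl]
    have := hf i j
    omega

theorem distribute_spec {n m : ℕ} {N : FlowNetwork n m} {τ : Fin n → Fin n} {s : ASt}
    (hN : s.reg rN = n) (hM : s.reg rM = m) (hraw : HoldsEdges N s.raw)
    (hτ : ∀ v : Fin n, s.arr aTau v = τ v)
    (hle : ∀ i j, lowerFlow (toMatrix n (s.arr aR)) i j ≤ N.merge τ N.cap i j)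
    (hX : 4 + 4 * m ≤ X) (hmB : m ≤ B) (hB : n * n ≤ B) :
    Tri X B distribute s m (fun s' => ∃ R, IsPartlyDistributed N τ
      (lowerFlow (toMatrix n (s.arr aR))) m R (fun e => s'.raw (4 + 3 * m + e))) := by
  refine Tri.mono (Tri.forUp (N := m) (t := 0) (fun k s' => HoldsEdges N s'.raw ∧
    IsPartlyDistributed N τ (lowerFlow (toMatrix n (s.arr aR))) k (toMatrix n (s'.arr aR))
      (fun e => s'.raw (4 + 3 * m + e))) hM hmB (by decide) (by decide) (by decide)
    ⟨hraw, fun e he => absurd he (by omega), fun i j hij => ?_, fun i j hij => Or.inr ?_⟩ ?_)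
    (by omega) fun s' h => ⟨_, h.2⟩
  · rw [partialSum_zero, add_zero, lowerFlow, if_pos hij]; rfl
  · have := hle i j
    rw [lowerFlow, if_pos hij] at this
    rwa [partialSum_zero, add_zero]
  rintro k s1 hk hF1 hJ1 ⟨hraw1, h1⟩
  have hN1 : s1.reg rN = n := by rw [hF1.reg _ (by decide), hN]
  have hM1 : s1.reg rM = m := by rw [hF1.reg _ (by decide), hM]
  have hτ1 : ∀ v : Fin n, s1.arr aTau v = τ v := fun v => by rw [hF1.arr _ (by decide), hτ]
  have hs := hraw1.src ⟨k, hk⟩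
  have ht := hraw1.tgt ⟨k, hk⟩
  have hc := hraw1.cap ⟨k, hk⟩
  simp only at hs ht hc
  set i := τ (N.src ⟨k, hk⟩) with hi
  set j := τ (N.tgt ⟨k, hk⟩) with hj
  set d := min (s1.arr aR (j * n + i)) (N.cap ⟨k, hk⟩) with hd
  have hlt := index_lt j.2 i.2
  have key : ∀ s' : ASt, s'.raw = Function.update s1.raw (4 + 3 * m + k) d →
      s'.arr aR = Function.update (s1.arr aR) (j * n + i) (s1.arr aR (j * n + i) - d) →
      HoldsEdges N s'.raw ∧ IsPartlyDistributed N τ (lowerFlow (toMatrix n (s.arr aR))) (k + 1)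
        (toMatrix n (s'.arr aR)) (fun e => s'.raw (4 + 3 * m + e)) := by
    intro s' hr' hR'
    refine ⟨⟨fun e => ?_, fun e => ?_, fun e => ?_⟩, h1.succ hk (d := d) rfl (fun a b => ?_)
      fun e => ?_⟩
    · rw [hr', Function.update_of_ne (by omega)]; exact hraw1.src e
    · rw [hr', Function.update_of_ne (by omega)]; exact hraw1.tgt e
    · rw [hr', Function.update_of_ne (by omega)]; exact hraw1.cap e
    · unfold toMatrix
      rw [hR', Function.update_apply]
      simp only [index_inj]
      split_ifs with hij
      · rw [hij.1, hij.2]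
      · rfl
    · simp only [hr', Function.update_apply, Nat.add_left_cancel_iff]
  apply Tri.flat
  simp only [wp, AExp.fits_arr, AExp.val_arr, AExp.val_add, AExp.val_mul, AExp.val_reg,
    AExp.val_ofNat, forall_eq, true_and, AExp.val_lt, ASt.reg_setReg, ASt.arr_setReg,
    ASt.raw_setReg, ite_one_ne_zero, ite_one_eq_zero, Nat.reduceEqDiff, if_false, if_true,
    AExp.fits_reg, AExp.fits_sub, AExp.val_sub, ASt.reg_setArr, AExp.fits_add, hJ1, hN1, hM1, hs,
    ht, hc, hτ1, and_true, ← hi, ← hj, OfNat.zero_ne_ofNat, OfNat.one_ne_ofNat]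
  refine ⟨by omega, by omega, by omega, by omega, fun h4 => ⟨by omega, fun _ => key _ ?_ ?_⟩,
    fun h4 => ⟨by omega, fun _ => key _ ?_ ?_⟩⟩
  · simp only [ASt.raw_setReg, ASt.raw_setRaw, ASt.raw_setArr]
    rw [show d = s1.arr aR (j * n + i) by omega]
  · simp only [ASt.arr_setReg, ASt.arr_setArr, ASt.arr_setRaw, if_true]
    rw [show d = s1.arr aR (j * n + i) by omega]
  · simp only [ASt.raw_setReg, ASt.raw_setRaw, ASt.raw_setArr]
    rw [show d = N.cap ⟨k, hk⟩ by omega]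
  · simp only [ASt.arr_setReg, ASt.arr_setArr, ASt.arr_setRaw, if_true]
    rw [show d = N.cap ⟨k, hk⟩ by omega]

/-! ### The algorithm -/

theorem FlowNetwork.merge_apply {n m : ℕ} {N : FlowNetwork n m} {τ : Fin n → Fin n} {M : Type*}
    [AddCommMonoid M] (hτ : Function.Injective τ) (h : Fin m → M) (u v : Fin n) :
    N.merge τ h (τ u) (τ v) = N.merge id h u v := by
  unfold FlowNetwork.merge
  simp only [hτ.eq_iff, id]

theorem FlowNetwork.merge_le_sum {n m : ℕ} (N : FlowNetwork n m) (τ : Fin n → Fin n)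
    (h : Fin m → ℕ) (i j : Fin n) : N.merge τ h i j ≤ ∑ e, h e :=
  Finset.sum_le_sum fun e _ => by split_ifs; exacts [le_rfl, Nat.zero_le _]

theorem FlowNetwork.edge_of_merge_pos {n m : ℕ} {N : FlowNetwork n m} {h : Fin m → ℕ}
    {u v : Fin n} (huv : 0 < N.merge id h u v) : N.Edge u v := by
  obtain ⟨e, -, he⟩ := Finset.exists_ne_zero_of_sum_ne_zero huv.ne'
  by_cases hc : N.src e = u ∧ N.tgt e = v
  · exact ⟨e, hc⟩
  · exact absurd (if_neg hc) he

/-- The whole algorithm, as a program of the array language. -/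
def maxFlow : AProg :=
  readHeader ;; mergeEdges ;; countDegrees ;; assignPositions ;; buildMatrix ;; bottleneck ;;
  search ;; cancelExcess ;; distribute

/-- A bound for the number of loop iterations of the whole algorithm. -/
def maxFlowTicks (n m : ℕ) : ℕ :=
  m + (n * (n + 1) + (n * (2 * n + 1) + (n * n + (n * (n + 1) +
    ((2 * Nat.log 2 n + 3) * (guessTicks n + 1) + (n * (n + 1) + m))))))

theorem maxFlow_spec {n m : ℕ} {N : FlowNetwork n m} {s : ASt} (hac : N.Acyclic) (hst : N.s ≠ N.t)
    (hraw : s.raw = N.inputMem) (hzero : ∀ k i, s.arr k i = 0) (hX : 4 + 4 * m ≤ X)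
    (hmB : m ≤ B) (hB : 16 * n * n ≤ B) (hcap : 2 * ∑ e, N.cap e ≤ B)
    (hcap' : 2 * (n * n * ∑ e, N.cap e) ≤ B) :
    Tri X B maxFlow s (maxFlowTicks n m) (fun s' =>
      N.IsApproxMaxFlow (1 / 4) (fun e => (s'.raw (4 + 3 * m + e) : ℝ))) := by
  have hn : 0 < n := N.s.pos
  have hnnB : n * n ≤ B := by nlinarith
  have hnB : n ≤ B := (Nat.le_mul_of_pos_right n hn).trans hnnB
  refine Tri.mono (Tri.seq (readHeader_spec hraw (by omega) hB hn) ?_) (Nat.zero_add _).le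
    fun _ h => h
  intro s1 h1 hF1
  have hraw1 : s1.raw = N.inputMem := by rw [hF1.raw (by decide), hraw]
  have hedge1 : HoldsEdges N s1.raw := hraw1 ▸ holdsEdges_inputMem N
  refine Tri.seq (mergeEdges_spec h1.size h1.edges hedge1
    (fun i => by rw [hF1.arr _ (by decide), hzero]) (by omega) hmB (by omega)) ?_
  rintro s2 ⟨hA2, htot2⟩ hF2
  have h2 := h1.frame hF2 (by decide)
  refine Tri.seq (countDegrees_spec h2.size hnB
    (fun i => by rw [hF2.arr _ (by decide), hF1.arr _ (by decide), hzero])) ?_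
  intro s3 hD3 hF3
  have h3 := h2.frame hF3 (by decide)
  have hA3 : s3.arr aA = s2.arr aA := hF3.arr _ (by decide)
  refine Tri.seq (assignPositions_spec h3.size hnB hn (fun v hv => hac v ?_)
    (by rw [hA3]; exact hD3)) ?_
  · refine Relation.TransGen.mono (p := N.Edge) (fun a b hab => ?_) v v hv
    rw [hA3, hA2] at hab
    exact FlowNetwork.edge_of_merge_pos hab
  rintro s4 ⟨τ, hτ, htau4, hord4, hlt4⟩ hF4
  have h4 := h3.frame hF4 (by decide)
  have hA4 : s4.arr aA = s2.arr aA := by rw [hF4.arr _ (by decide), hA3]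
  refine Tri.seq (buildMatrix_spec h4.size h4.square hnnB) ?_
  rintro s5 ⟨hS5, hT5, hC5⟩ hF5
  have h5 := h4.frame hF5 (by decide)
  rw [h4.source, htau4] at hS5
  rw [h4.sink, htau4] at hT5
  have hC : toMatrix n (s5.arr aC) = N.merge τ N.cap := by
    funext i j
    obtain ⟨u, rfl⟩ := hτ.2 i
    obtain ⟨v, rfl⟩ := hτ.2 j
    rw [hC5, hord4, hord4, hA4, hA2, FlowNetwork.merge_apply hτ.1]
  have htri : ∀ i j, 0 < N.merge τ N.cap i j → i < j := by
    intro i j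
    obtain ⟨u, rfl⟩ := hτ.2 i
    obtain ⟨v, rfl⟩ := hτ.2 j
    rw [FlowNetwork.merge_apply hτ.1, ← hA2, ← hA3]
    exact hlt4 u v
  have htot5 : s5.reg rTot = ∑ e, N.cap e := by
    rw [hF5.reg _ (by decide), hF4.reg _ (by decide), hF3.reg _ (by decide), htot2]
  refine Tri.seq (bottleneck_spec h5.size hS5 htot5 hnB
    (fun i j => by rw [hC]; exact N.merge_le_sum τ _ i j)) ?_
  rintro s6 ⟨hb6, hle6⟩ hF6
  have h6 := h5.frame hF6 (by decide)
  have hC6 : toMatrix n (s6.arr aC) = N.merge τ N.cap := by rw [hF6.arr _ (by decide), hC]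
  have hc6 : Ctx n (τ N.s) (τ N.t) s6 := ⟨h6.size, by rw [hF6.reg _ (by decide), hS5],
    by rw [hF6.reg _ (by decide), hT5], h6.height, h6.inf⟩
  have htree : IsTree n (s6.arr aTree) := by
    rw [hF6.arr _ (by decide), hF5.arr _ (by decide), hF4.arr _ (by decide), hF3.arr _ (by decide),
      hF2.arr _ (by decide), hF1.arr _ (by decide)]
    intro j _ _
    simp only [hzero, min_self]
  have hsearch := search_spec (X := X) (B := B) hc6 (fun h => hst (hτ.1 h).symm) h6.square htree
    (by rw [hC6]; exact htri) (by rw [hC6, ← hC]; exact hb6) hB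
    ((Nat.mul_le_mul_left _ (Nat.mul_le_mul_left _ (hle6 _))).trans hcap')
    (fun i j => by
      rw [hC6]
      have h1 := N.merge_le_sum τ N.cap i j
      have h2 := N.merge_le_sum τ N.cap j i
      omega)
  rw [hC6] at hsearch
  refine Tri.seq hsearch ?_
  rintro s7 ⟨F, hFB, hpre, hopt⟩ hF7
  have h7 := h6.frame hF7 (by decide)
  refine Tri.seq (cancelExcess_spec (hc6.frame hF7 (by decide)) hnB hFB
    (hpre.lowerFlow_bal htri) (hpre.lowerFlow_le htri)) ?_
  intro s8 h8 hF8
  have h8' := h7.frame hF8 (by decide)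
  have hraw8 : s8.raw = N.inputMem := by
    rw [hF8.raw (by decide), hF7.raw (by decide), hF6.raw (by decide), hF5.raw (by decide),
      hF4.raw (by decide), hF3.raw (by decide), hF2.raw (by decide), hraw1]
  have htau8 : s8.arr aTau = s4.arr aTau := by
    rw [hF8.arr _ (by decide), hF7.arr _ (by decide), hF6.arr _ (by decide), hF5.arr _ (by decide)]
  refine Tri.mono (distribute_spec h8'.size h8'.edges (hraw8 ▸ holdsEdges_inputMem N)
    (fun v => by rw [htau8, htau4]) h8.le_cap hX hmB hnnB) le_rfl ?_
  rintro s9 ⟨R, h9⟩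
  obtain ⟨hflow, hval⟩ := FlowNetwork.isFlow_of_balanced hτ hst h8.bal
    (fun v => h8.done v (by omega)) (fun e => h9.le_cap e e.2) (h9.merge_eq htri h8.le_cap)
  refine ⟨hflow, fun g hg => ?_⟩
  have h10 := hopt _ _ (hg.isMatFlow hτ hst)
  have h11 : ((s7.arr aEx (τ N.t) : ℕ) : ℝ) ≤ s8.arr aEx (τ N.t) := by exact_mod_cast h8.le_sink
  simp only [toConfig] at h10
  rw [hval]
  linarith

theorem maxFlowTicks_le {n m : ℕ} (hn : 0 < n) :
    maxFlowTicks n m + 1 ≤ 15561 * ((m + n ^ 2) * (Nat.log 2 n + 1) ^ 4) := by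
  set l := Nat.log 2 n + 1 with hl
  have hl1 : 1 ≤ l := by omega
  have hlog : Nat.log 2 n = l - 1 := by omega
  have hnn : n ≤ n ^ 2 := Nat.le_self_pow (by norm_num) n
  set q := n ^ 2 with hq
  have hq1 : 1 ≤ q := hn.trans_le hnn
  have hqq : n * n = q := (sq n).symm
  have hl2 : l ≤ l ^ 2 := Nat.le_self_pow (by norm_num) l
  have hstep : phaseSteps n ≤ 323 * (q * l) := by
    have h1 : phaseSteps n = 35 * q + 96 * (q * (l + 2)) := by
      unfold phaseSteps
      rw [← hl, hq]; ring
    have h2 : q ≤ q * l := Nat.le_mul_of_pos_right _ hl1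
    rw [h1, mul_add]; omega
  have hphase : phaseTicks n ≤ 1294 * (q * l ^ 2) := by
    have h1 : n * (Nat.log 2 n + 2) ≤ q * (2 * l) := Nat.mul_le_mul hnn (by omega)
    have h2 : phaseSteps n * (3 * (Nat.log 2 n + 1) + 1) ≤ 323 * (q * l) * (4 * l) :=
      Nat.mul_le_mul hstep (by omega)
    have h3 : q * (2 * l) ≤ q * (2 * l ^ 2) := Nat.mul_le_mul_left _ (by omega)
    unfold phaseTicks
    calc _ ≤ q * (2 * l ^ 2) + 323 * (q * l) * (4 * l) := by omega
      _ = 1294 * (q * l ^ 2) := by ring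
  have hql : 1 ≤ q * l ^ 2 := Nat.mul_pos hq1 (Nat.pow_pos hl1)
  have hguess : guessTicks n ≤ 5182 * (q * l ^ 3) := by
    have h1 : (Nat.log 2 n + 4) * (phaseTicks n + 1) ≤ (4 * l) * (1295 * (q * l ^ 2)) :=
      Nat.mul_le_mul (by omega) (by omega)
    have h2 : q ≤ q * l ^ 3 := Nat.le_mul_of_pos_right _ (Nat.pow_pos hl1)
    unfold guessTicks
    calc _ ≤ 2 * (q * l ^ 3) + (4 * l) * (1295 * (q * l ^ 2)) := by omega
      _ = 5182 * (q * l ^ 3) := by ring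
  have hql3 : 1 ≤ q * l ^ 3 := Nat.mul_pos hq1 (Nat.pow_pos hl1)
  have hsearch : (2 * Nat.log 2 n + 3) * (guessTicks n + 1) ≤ 15549 * (q * l ^ 4) := by
    calc _ ≤ (3 * l) * (5183 * (q * l ^ 3)) := Nat.mul_le_mul (by omega) (by omega)
      _ = 15549 * (q * l ^ 4) := by ring
  have hrest : n * (n + 1) ≤ 2 * q ∧ n * (2 * n + 1) ≤ 3 * q := by
    constructor <;> nlinarith
  have hl4 : 1 ≤ l ^ 4 := Nat.pow_pos hl1
  have h1 : q ≤ q * l ^ 4 := Nat.le_mul_of_pos_right _ hl4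
  have h2 : m ≤ m * l ^ 4 := Nat.le_mul_of_pos_right _ hl4
  have h3 : (m + q) * l ^ 4 = m * l ^ 4 + q * l ^ 4 := add_mul _ _ _
  unfold maxFlowTicks
  generalize (2 * Nat.log 2 n + 3) * (guessTicks n + 1) = x at hsearch ⊢
  omega

/-- Store the base address `4 + 4 * m` of the arrays, which lie behind the `4 + 3 * m` cells of the
input and the `m` cells of the output. -/
def setBase : WordRAM.Prog :=
  .assign 0 (.op .add (.lit 4) (.op .mul (.lit 4) (.load (.lit 1))))

theorem FlowNetwork.inputMem_eq_zero {n m : ℕ} (N : FlowNetwork n m) {a : ℕ} (ha : 4 + 3 * m ≤ a) :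
    N.inputMem a = 0 := by
  unfold FlowNetwork.inputMem
  rw [if_neg (by omega), if_neg (by omega), if_neg (by omega), if_neg (by omega),
    dif_neg (by omega)]

theorem FlowNetwork.inputMem_le {n m : ℕ} (N : FlowNetwork n m) {U B : ℕ} (hU : ∀ e, N.cap e ≤ U)
    (hn : n ≤ B) (hm : m ≤ B) (hUB : U ≤ B) (a : ℕ) : N.inputMem a ≤ B := by
  have hv : ∀ v : Fin n, (v : ℕ) ≤ B := fun v => v.2.le.trans hn
  unfold FlowNetwork.inputMem
  split_ifs
  exacts [hn, hm, hv _, hv _, hv _, hv _, (hU _).trans hUB, Nat.zero_le _]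

/-- The exponent `12` is the weight of the expression in `setBase`. -/
theorem runs_setBase {n m W B : ℕ} {N : FlowNetwork n m} (hB : ∀ a, N.inputMem a ≤ B)
    (hmB : 4 + 4 * m ≤ B) (hW : (B + 2) ^ 12 ≤ 2 ^ W) :
    ∃ σ, WordRAM.Runs W setBase N.input σ 7 ∧
      Rep (4 + 4 * m) B σ ⟨fun _ => 0, fun _ _ => 0, N.inputMem⟩ := by
  refine ⟨_, .assign _ _ _, ?_⟩
  have heval := (WordRAM.Exp.eval_eq_uval (W := W) (P := B + 2) (σ := N.input) (by omega)
    (fun r => Nat.succ_pos _) (fun a => Nat.lt_succ_of_le ((hB a).trans (Nat.le_succ _)))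
    (.op .add (.lit 4) (.op .mul (.lit 4) (.load (.lit 1)))) hW).1
  rw [heval]
  have h1 : N.inputMem 1 = m := rfl
  simp only [WordRAM.Exp.uval, WordRAM.Op.apply, FlowNetwork.input, h1]
  exact
    { base := by simp
      reg := fun r => by simp
      arr := fun k i => N.inputMem_eq_zero (by omega)
      raw := fun i _ => rfl
      reg_le := fun r => by
        simp only [Function.update_apply]; split_ifs; exacts [hmB, Nat.zero_le _]
      mem_le := hB }

/-- There are a single deterministic word RAM program and constants such that on every DAG with `n`
vertices, `m` edges, integral capacities at most `U`, source `s` and sink `t ≠ s`, and for every word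
length `W ≥ c * log₂ (n + m + U + 2)`, the program halts within `C * (m + n²) * (log₂ n + 1) ^ k`
steps and outputs an (integral) flow of value at least `α` times the maximum. -/
theorem mainTheorem3 :
    ∃ (P : WordRAM.Prog) (α : ℝ) (c C k : ℕ), 0 < α ∧
      ∀ (n m : ℕ) (N : FlowNetwork n m) (U W : ℕ),
        N.Acyclic → N.s ≠ N.t → (∀ e, N.cap e ≤ U) → (n + m + U + 2) ^ c ≤ 2 ^ W →
        ∃ (σ : WordRAM.State) (T : ℕ),
          WordRAM.Runs W P N.input σ T ∧
          T ≤ C * (m + n ^ 2) * (Nat.log 2 n + 1) ^ k ∧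
          N.IsApproxMaxFlow α (fun e => (flowOutput m σ e : ℝ)) := by
  refine ⟨.seq setBase maxFlow.comp, 1 / 4, 7 * (maxFlow.comp.wt + 12),
    (maxFlow.comp.unitCost + 7) * 15561, 4, by norm_num, fun n m N U W hac hst hU hW => ?_⟩
  have hn : 0 < n := N.s.pos
  set M := n + m + U + 2 with hM
  -- all numbers that occur are at most `M ^ 6`
  set B := M ^ 6 with hB
  have hpow : ∀ k, k ≤ 6 → M ^ k ≤ B := fun k hk => Nat.pow_le_pow_right (by omega) hk
  have hM1 : M ≤ B := by simpa using hpow 1 (by omega)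
  have hBM : B + 2 ≤ M ^ 7 := by
    have h1 : M ^ 7 = M ^ 6 * M := pow_succ M 6
    rw [h1, ← hB]
    nlinarith
  have hW' : ∀ k, k ≤ maxFlow.comp.wt + 12 → (B + 2) ^ k ≤ 2 ^ W := fun k hk =>
    calc (B + 2) ^ k ≤ (M ^ 7) ^ k := Nat.pow_le_pow_left hBM k
      _ = M ^ (7 * k) := (pow_mul M 7 k).symm
      _ ≤ M ^ (7 * (maxFlow.comp.wt + 12)) := Nat.pow_le_pow_right (by omega) (by omega)
      _ ≤ 2 ^ W := hW
  have hsum : ∑ e, N.cap e ≤ m * U := by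
    have := Finset.sum_le_sum fun e (_ : e ∈ Finset.univ) => hU e
    simpa using this
  have hmU : m * U ≤ M ^ 2 := by
    rw [sq]; exact Nat.mul_le_mul (by omega) (by omega)
  have hnn : n * n ≤ M ^ 2 := by
    rw [sq]; exact Nat.mul_le_mul (by omega) (by omega)
  have h2M : 2 ≤ M := by omega
  have h16 : 2 ^ 4 ≤ M ^ 4 := Nat.pow_le_pow_left h2M 4
  have hB2 : M ^ 2 * 16 ≤ B := by
    rw [hB, show M ^ 6 = M ^ 2 * M ^ 4 by ring]
    exact Nat.mul_le_mul_left _ h16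
  have hcap' : 2 * (n * n * ∑ e, N.cap e) ≤ B := by
    calc _ ≤ M * (M ^ 2 * M ^ 2) :=
          Nat.mul_le_mul h2M (Nat.mul_le_mul hnn (hsum.trans hmU))
      _ = M ^ 5 := by ring
      _ ≤ B := hpow 5 (by omega)
  have h4m : 4 + 4 * m ≤ B := by nlinarith
  obtain ⟨σ, hσ, hrep⟩ := runs_setBase (N := N) (W := W)
    (N.inputMem_le hU (by omega) (by omega) (by omega)) h4m (hW' 12 (by omega))
  obtain ⟨s', J, he, hJ, hflow⟩ := maxFlow_spec (X := 4 + 4 * m) (B := B)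
    (s := ⟨fun _ => 0, fun _ _ => 0, N.inputMem⟩) hac hst rfl (fun _ _ => rfl) le_rfl (by omega)
    (by rw [mul_assoc]; omega) (by omega) hcap'
  obtain ⟨σ', T, hT, hTJ, hrep'⟩ := he.simulate (hW' _ (by omega)) σ hrep
  refine ⟨σ', 7 + T, .seq hσ hT, ?_, ?_⟩
  · have h1 := maxFlowTicks_le (m := m) hn
    calc 7 + T ≤ (maxFlow.comp.unitCost + 7) * (maxFlowTicks n m + 1) := by nlinarith
      _ ≤ (maxFlow.comp.unitCost + 7) * (15561 * ((m + n ^ 2) * (Nat.log 2 n + 1) ^ 4)) :=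
        Nat.mul_le_mul_left _ h1
      _ = _ := by ring
  · have hout : ∀ e : Fin m, flowOutput m σ' e = s'.raw (4 + 3 * m + e) := fun e =>
      hrep'.raw _ (by omega)
    simp only [hout]
    exact hflow
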